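/- Let $d\ge 1$, $n\ge 0$, $m=n+2d+1$, let $t_1<\dots<t_m$ be real numbers, and let $C(m,2d)\subset\mathbb R^{2d}$ be the cyclic polytope with vertices $p_i=(t_i,t_i^2,\dots,t_i^{2d})$, $i\in[m]=\{1,\dots,m\}$. A $k$-simplex is a $(k+1)$-subset of $[m]$; its realisation is the convex hull of the corresponding $p_i$. A triangulation of $C(m,2d)$ is a set $\mathcal T$ of $2d$-simplices whose realisations have pairwise disjoint interiors and union $C(m,2d)$; a $k$-simplex of $\mathcal T$ is one contained in a member of $\mathcal T$. A $d$-arc of $\mathcal T$ is a $d$-simplex of $\mathcal T$ whose realisation does not lie within a facet of $C(m,2d)$. A $(d+1)$-simplex of $\mathcal T$ is interior if all its $d+2$ facets are $d$-arcs of $\mathcal T$. For $d$-simplices $A,B$ write $A\wr B$ if their elements can be labelled such that $a_0<b_0<a_1<b_1<\dots<a_d<b_d$ in one of the cyclically shifted orders $l<l+1<\dots<m<1<\dots<l-1$ of $[m]$, and let $A-\mathbf 1$ be obtained from $A$ by subtracting $1$ modulo $m$ from each element. The quiver $Q(\mathcal T)$ has as vertices the $d$-arcs of $\mathcal T$, and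 an arrow $A\to B$ if and only if $A\ne B$, $(A-\mathbf 1)\wr B$, and there is no $d$-arc $A'\notin\{A,B\}$ of $\mathcal T$ with $(A-\mathbf 1)\wr A'$ and $(A'-\mathbf 1)\wr B$. The quiver $Q^{(d,n)}$ has as vertices the tuples $(a_0,\dots,a_d)\in\mathbb Z_{\ge0}^{d+1}$ with $\sum_i a_i=n-1$, and the arrows $A\to A+f_i$ ($0\le i\le d$) whenever both are vertices, where $f_i$ has entry $-1$ in position $i$, $1$ in position $i+1$ (position $0$ if $i=d$), and $0$ elsewhere. A cut is a set $C$ of arrows of $Q^{(d,n)}$ that contains exactly one arrow from each oriented cycle of length $d+1$; a cut quiver of $Q^{(d,n)}$ is the quiver obtained from it by removing the arrows of a cut. Then for every triangulation $\mathcal T$ of $C(n+2d+1,2d)$ the following are equivalent: 1. $\mathcal T$ has no interior $(d+1)$-simplex; 2. $Q(\mathcal T)$ has no oriented cycle; 3. $Q(\mathcal T)$ is isomorphic, as a quiver, to a cut quiver of $Q^{(d,n)}$. -/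

import Mathlib

namespace CyclicTriang

/-- The point `(x, x ^ 2, …, x ^ δ)` of the moment curve in `ℝ ^ δ`. -/
def momentPoint (δ : ℕ) (x : ℝ) : Fin δ → ℝ := fun i => x ^ ((i : ℕ) + 1)

/-- The convex hull of the points of the moment curve in `ℝ ^ δ` that have their parameters
`t i` labelled by the elements `i` of `A`: the geometric realisation of the simplex `A`. -/
def realisation {m : ℕ} (δ : ℕ) (t : Fin m → ℝ) (A : Finset (Fin m)) : Set (Fin δ → ℝ) :=
  convexHull ℝ ((fun i => momentPoint δ (t i)) '' (A : Set (Fin m)))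

/-- The cyclic polytope `C(m, δ)` on the parameters `t 0 < ⋯ < t (m - 1)`. -/
def cyclicPolytope {m : ℕ} (δ : ℕ) (t : Fin m → ℝ) : Set (Fin δ → ℝ) :=
  convexHull ℝ (Set.range fun i => momentPoint δ (t i))

/-- `T` is a triangulation of the cyclic polytope `C(m, δ)`: a collection of `δ`-simplices on the
vertices of the polytope whose interiors are pairwise disjoint and whose union is the polytope. -/
structure IsTriangulation {m : ℕ} (δ : ℕ) (t : Fin m → ℝ) (T : Finset (Finset (Fin m))) :
    Prop where
  card_eq : ∀ S ∈ T, S.card = δ + 1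
  disjoint_interiors : ∀ S ∈ T, ∀ S' ∈ T, S ≠ S' →
    Disjoint (interior (realisation δ t S)) (interior (realisation δ t S'))
  union_eq : (⋃ S ∈ T, realisation δ t S) = cyclicPolytope δ t

/-- `F` is a facet of the cyclic polytope `C(m, δ)`: a face of codimension one. -/
def IsFacet {m : ℕ} (δ : ℕ) (t : Fin m → ℝ) (F : Set (Fin δ → ℝ)) : Prop :=
  IsExposed ℝ (cyclicPolytope δ t) F ∧ Module.finrank ℝ (vectorSpan ℝ F) + 1 = δ

/-- `A` is a `k`-simplex of `T`, that is, a `k`-dimensional face of a member of `T`. -/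
def IsSimplexOf {m : ℕ} (T : Finset (Finset (Fin m))) (k : ℕ) (A : Finset (Fin m)) : Prop :=
  A.card = k + 1 ∧ ∃ S ∈ T, A ⊆ S

/-- `A` is a `d`-arc of the triangulation `T` of `C(m, 2 d)`: a `d`-simplex of `T` that is internal,
that is, does not lie within a facet of `C(m, 2 d)`. -/
def IsArc {m : ℕ} (d : ℕ) (t : Fin m → ℝ) (T : Finset (Finset (Fin m)))
    (A : Finset (Fin m)) : Prop :=
  IsSimplexOf T d A ∧ ¬ ∃ F, IsFacet (2 * d) t F ∧ realisation (2 * d) t A ⊆ F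

/-- `A` is an interior `(d + 1)`-simplex of the triangulation `T` of `C(m, 2 d)`: all its facets
are `d`-arcs of `T`. -/
def IsInteriorSimplex {m : ℕ} (d : ℕ) (t : Fin m → ℝ) (T : Finset (Finset (Fin m)))
    (A : Finset (Fin m)) : Prop :=
  IsSimplexOf T (d + 1) A ∧ ∀ v ∈ A, IsArc d t T (A.erase v)

/-- The `d`-simplices `A = {a₀, …, a_d}` and `B = {b₀, …, b_d}` are intertwining:
`a₀ < b₀ < a₁ < b₁ < ⋯ < a_d < b_d` is a cyclic ordering, which means that it holds for the
cyclically shifted order `x <ₗ y ↔ x - l < y - l` for some `l`. -/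
def Intertwining {m : ℕ} (d : ℕ) (A B : Finset (Fin m)) : Prop :=
  ∃ (l : Fin m) (a b : Fin (d + 1) → Fin m),
    Set.range a = (A : Set (Fin m)) ∧ Set.range b = (B : Set (Fin m)) ∧
    (∀ i, a i - l < b i - l) ∧ ∀ i : Fin d, b i.castSucc - l < a i.succ - l

/-- The simplex `A - (1, …, 1)`, with entries taken modulo `m`. -/
def shiftDown {m : ℕ} [NeZero m] (A : Finset (Fin m)) : Finset (Fin m) :=
  A.image fun x => x - 1

/-- The quiver of a triangulation `T` of `C(m, 2 d)`: its vertices are the `d`-arcs of `T`. It has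
no multiple arrows. -/
def triangulationQuiver {m : ℕ} [NeZero m] (d : ℕ) (t : Fin m → ℝ)
    (T : Finset (Finset (Fin m))) : Digraph {A : Finset (Fin m) // IsArc d t T A} where
  Adj A B := A ≠ B ∧ Intertwining d (shiftDown A.1) B.1 ∧
    ¬ ∃ A' : {A : Finset (Fin m) // IsArc d t T A}, A' ≠ A ∧ A' ≠ B ∧
      Intertwining d (shiftDown A.1) A'.1 ∧ Intertwining d (shiftDown A'.1) B.1

/-- There is an oriented cycle: a path of positive length from a vertex to itself. -/
def HasOrientedCycle {V : Type} (Q : Digraph V) : Prop :=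
  ∃ v, Relation.TransGen Q.Adj v v

/-- The vertices of `Q^{(d, n)}`: the tuples `(a₀, …, a_d)` of natural numbers with sum `n - 1`
(no tuples if `n = 0`). -/
abbrev CutVertex (d n : ℕ) : Type := {a : Fin (d + 1) → ℕ // (∑ i, a i) + 1 = n}

/-- The vector `f_i`, with entry `-1` at `i` and `1` at `i + 1`, where `d + 1` is read as `0`. -/
def arrowVec (d : ℕ) (i : Fin (d + 1)) : Fin (d + 1) → ℤ :=
  Pi.single (i + 1) 1 - Pi.single i 1

/-- The quiver `Q^{(d, n)}`, with the arrows `A → A + f_i`. It has no multiple arrows for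
`d ≥ 1`, as the vectors `f_i` are distinct then. -/
def typeAQuiver (d n : ℕ) : Digraph (CutVertex d n) where
  Adj A B := ∃ i, ∀ j, (B.1 j : ℤ) = (A.1 j : ℤ) + arrowVec d i j

/-- A set `C` of arrows of `Q^{(d, n)}` is a cut if it contains exactly one arrow of each
`(d + 1)`-cycle `c 0 → c 1 → ⋯ → c d → c 0` (the index `i + 1` is cyclic here). The vertices of
such a closed path are distinct, because each `f_j` must occur in it exactly once. -/
structure IsCut {d n : ℕ} (C : Set (CutVertex d n × CutVertex d n)) : Prop where
  arrows : ∀ p ∈ C, (typeAQuiver d n).Adj p.1 p.2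
  existsUnique : ∀ c : Fin (d + 1) → CutVertex d n,
    (∀ i, (typeAQuiver d n).Adj (c i) (c (i + 1))) → ∃! i, (c i, c (i + 1)) ∈ C

/-- The quiver that remains of `Q^{(d, n)}` when the arrows in `C` are removed. -/
def cutQuiver {d n : ℕ} (C : Set (CutVertex d n × CutVertex d n)) : Digraph (CutVertex d n) where
  Adj A B := (typeAQuiver d n).Adj A B ∧ (A, B) ∉ C

/-- `Q` is a cut quiver of `Q^{(d, n)}`, up to isomorphism of quivers. -/
def IsCutQuiver {V : Type} (d n : ℕ) (Q : Digraph V) : Prop :=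
  ∃ C : Set (CutVertex d n × CutVertex d n), IsCut C ∧ Nonempty (Q.Adj ≃r (cutQuiver C).Adj)

end CyclicTriang

/-! A set of `D` residues modulo `m` is encoded by the increasing sequence `a : ℤ → ℤ` that
enumerates its preimage in `ℤ`, so `a (j + D) = a j + m`; it is unique up to an index shift. Then `A
≀ B` says that `a j < b j < a (j + 1)` for suitable enumerations. The geometry enters through two
facts. Minimal affine dependences on the moment curve alternate in sign, so two crossing simplices
contain an intertwining pair, which a triangulation cannot contain. By Gale's evenness criterion, a
`d`-simplex lies in a facet exactly if it has two cyclically adjacent vertices. So arcs are the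
`d`-simplices of `T` whose sequences have all gaps at least 2 (`isArc_iff`).

3 ⇒ 2. Follow a path in `Q^{(d, n)}` and count the arrows of the cut that it uses. Steps with
distinct labels commute, counter included, because both orders complete to cycles of length `d + 1`,
each with one cut arrow. A closed path uses all labels equally often, say `K` times, so its counter
is `K`. If it avoids the cut, then `K = 0`.

2 ⇒ 1. If `X` is an interior simplex, moving the cyclic predecessor `w` of `v` up to `v` leads from
the facet `X \ v` to the facet `X \ w`. This relation refines to a path of the quiver. Going on from
facet to facet gives a cycle, as there are finitely many arcs.

1 ⇒ 3. Let `a` be an arc whose entry `k` can be raised to give a separated sequence `a + e_k`.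
Without interior simplices, either `a + e_k` is an arc or the other entries of `a` can be lowered
freely by one (`IsArcSeq.bump_or`); in particular `a + e_k - 1` is then an arc. Hence the moves `a →
a + e_k` up to translation are deterministic and commute, and a round of all labels returns to `a`.
The arcs reached from one arc therefore meet each translation class of separated sequences exactly
once, which gives a height function `h` with zero level in the arcs (`exists_height`). It is
monotone, grows by one under translation and by at most one under a unit step. Each arc has an
enumeration of height zero, since arcs do not intertwine (`exists_shift_eq_zero`). Translation
classes correspond to gap vectors, the vertices of `Q^{(d, n)}`. Under this bijection the arrows of
`Q(T)` are the steps `a → a + e_k` within height zero; the other arrows of `Q^{(d, n)}` are of the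
form `a → a + e_k - 1`, and they form a cut, because around a `(d + 1)`-cycle the total displacement
vanishes. -/

namespace CyclicTriang

/-! ### Periodic sequences and subsets of `ℤ / m` -/

/-- The residue of an integer modulo `m`, as an element of `Fin m`. -/
def residue (m : ℕ) [NeZero m] (k : ℤ) : Fin m :=
  ⟨(k % m).toNat, by
    have hm : (0 : ℤ) < m := by exact_mod_cast NeZero.pos m
    have h1 := Int.emod_nonneg k hm.ne'
    have h2 := Int.emod_lt_of_pos k hm
    omega⟩

section residue

variable {m : ℕ} [NeZero m]

theorem residue_val_cast (k : ℤ) : ((residue m k).val : ℤ) = k % m := by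
  have hm : (0 : ℤ) < m := by exact_mod_cast NeZero.pos m
  have h1 := Int.emod_nonneg k hm.ne'
  simp only [residue]
  omega

theorem residue_eq_iff {k l : ℤ} : residue m k = residue m l ↔ (m : ℤ) ∣ k - l := by
  rw [Fin.ext_iff, ← Int.natCast_inj (m := (residue m k).val), residue_val_cast, residue_val_cast,
    Int.emod_eq_emod_iff_emod_sub_eq_zero, Int.dvd_iff_emod_eq_zero]

theorem residue_val (v : Fin m) : residue m (v.val : ℤ) = v := by
  have hv := v.isLt
  rw [Fin.ext_iff, ← Int.natCast_inj (m := (residue m _).val), residue_val_cast]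
  exact Int.emod_eq_of_lt (by positivity) (by exact_mod_cast hv)

theorem residue_sub_val_cast (k l : ℤ) :
    ((residue m k - residue m l : Fin m).val : ℤ) = (k - l) % m := by
  have hl : ((residue m l).val : ℤ) ≤ m := by exact_mod_cast (residue m l).isLt.le
  rw [Fin.sub_def]
  have : ((m - (residue m l).val : ℕ) : ℤ) = m - (residue m l).val := by
    rw [Nat.cast_sub (by exact_mod_cast hl)]
  simp only [Int.natCast_emod, Nat.cast_add, this, residue_val_cast]
  rw [Int.emod_eq_emod_iff_emod_sub_eq_zero, ← Int.dvd_iff_emod_eq_zero]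
  have h1 := Int.emod_add_mul_ediv k m
  have h2 := Int.emod_add_mul_ediv l m
  exact ⟨1 + l / m - k / m, by linear_combination h1 - h2⟩

theorem residue_sub (k l : ℤ) : residue m k - residue m l = residue m (k - l) := by
  rw [Fin.ext_iff, ← Int.natCast_inj (m := (residue m k - residue m l).val), residue_sub_val_cast,
    residue_val_cast]

theorem residue_one : residue m 1 = 1 := by
  rw [Fin.ext_iff, ← Int.natCast_inj (m := (residue m 1).val), residue_val_cast, Fin.val_one']
  simp

theorem residue_sub_one (k : ℤ) : residue m (k - 1) = residue m k - 1 := by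
  rw [← residue_sub, residue_one]

theorem residue_zero : residue m 0 = 0 := by
  rw [Fin.ext_iff, ← Int.natCast_inj (m := (residue m 0).val), residue_val_cast]
  simp

theorem residue_add_one (k : ℤ) : residue m (k + 1) = residue m k + 1 := by
  have := residue_sub_one (m := m) (k + 1)
  simp only [add_sub_cancel_right] at this
  rw [this]
  open Fin.CommRing in simp

end residue

/-- A strictly increasing sequence of integers with `a (j + D) = a j + m`: an enumeration of the
preimage in `ℤ` of a subset of `ℤ / m` with `D` elements. -/
structure IsCyclicSeq (D m : ℕ) (a : ℤ → ℤ) : Prop where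
  strictMono : StrictMono a
  add_period : ∀ j, a (j + D) = a j + m

/-- The subset of `ℤ / m` that is enumerated by a periodic sequence. -/
def supp (D m : ℕ) [NeZero m] (a : ℤ → ℤ) : Finset (Fin m) :=
  (Finset.range D).image fun j : ℕ => residue m (a j)

/-- Two increasing enumerations of one set that agree at `j` have the same next and the same
previous value there. -/
theorem strictMono_int_eq {f g : ℤ → ℤ} (hf : StrictMono f) (hg : StrictMono g)
    (h : ∀ k, (∃ j, f j = k) ↔ ∃ j, g j = k) (h0 : f 0 = g 0) : f = g := by
  have up : ∀ {f g : ℤ → ℤ}, StrictMono f → StrictMono g →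
      (∀ k, (∃ j, f j = k) ↔ ∃ j, g j = k) → ∀ j, f j = g j → g (j + 1) ≤ f (j + 1) := by
    intro f g hf hg h j hj
    obtain ⟨k, hk⟩ := (h (f (j + 1))).1 ⟨_, rfl⟩
    have : g j < g k := by rw [hk, ← hj]; exact hf (by omega)
    rw [← hk]
    exact hg.monotone (by have := hg.lt_iff_lt.1 this; omega)
  have down : ∀ {f g : ℤ → ℤ}, StrictMono f → StrictMono g →
      (∀ k, (∃ j, f j = k) ↔ ∃ j, g j = k) → ∀ j, f j = g j → f (j - 1) ≤ g (j - 1) := by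
    intro f g hf hg h j hj
    obtain ⟨k, hk⟩ := (h (f (j - 1))).1 ⟨_, rfl⟩
    have : g k < g j := by rw [hk, ← hj]; exact hf (by omega)
    rw [← hk]
    exact hg.monotone (by have := hg.lt_iff_lt.1 this; omega)
  funext j
  induction j using Int.induction_on with
  | zero => exact h0
  | succ i ih =>
    exact le_antisymm (up hg hf (fun k => (h k).symm) _ ih.symm) (up hf hg h _ ih)
  | pred i ih =>
    exact le_antisymm (down hf hg h _ ih) (down hg hf (fun k => (h k).symm) _ ih.symm)

namespace IsCyclicSeq

variable {D m : ℕ} {a b : ℤ → ℤ}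

theorem add_mul_period (ha : IsCyclicSeq D m a) (j q : ℤ) : a (j + D * q) = a j + m * q := by
  induction q using Int.induction_on with
  | zero => simp
  | succ i ih => rw [mul_add, mul_one, ← add_assoc, ha.add_period, ih]; ring
  | pred i ih =>
    have := ha.add_period (j + D * (-i - 1))
    rw [show j + D * (-(i : ℤ) - 1) + D = j + D * -i by ring, ih] at this
    linear_combination -this

theorem add_mul_period' (ha : IsCyclicSeq D m a) (j : ℤ) :
    a j = a (j % D) + m * (j / D) := by
  rw [← ha.add_mul_period, Int.emod_add_mul_ediv]

theorem shift (ha : IsCyclicSeq D m a) (k : ℤ) : IsCyclicSeq D m fun j => a (j + k) where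
  strictMono := fun i j h => ha.strictMono (by omega)
  add_period j := by
    rw [← ha.add_period]; congr 1; ring

theorem add_const (ha : IsCyclicSeq D m a) (c : ℤ) : IsCyclicSeq D m fun j => a j + c where
  strictMono := fun i j h => by simpa using ha.strictMono h
  add_period j := by simp only [ha.add_period]; ring

variable [NeZero m]

theorem mem_supp (ha : IsCyclicSeq D m a) (hD : 0 < D) {v : Fin m} :
    v ∈ supp D m a ↔ ∃ j, residue m (a j) = v := by
  simp only [supp, Finset.mem_image, Finset.mem_range]
  constructor
  · rintro ⟨j, -, h⟩; exact ⟨j, h⟩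
  · rintro ⟨j, h⟩
    have hD' : (0 : ℤ) < D := by exact_mod_cast hD
    have h1 := Int.emod_nonneg j hD'.ne'
    have h2 := Int.emod_lt_of_pos j hD'
    refine ⟨(j % D).toNat, by omega, ?_⟩
    rw [← h, residue_eq_iff, Int.toNat_of_nonneg h1, ha.add_mul_period' j]
    exact ⟨-(j / D), by ring⟩

theorem residue_mem_supp (ha : IsCyclicSeq D m a) (hD : 0 < D) {k : ℤ} :
    residue m k ∈ supp D m a ↔ ∃ j, a j = k := by
  rw [ha.mem_supp hD]
  constructor
  · rintro ⟨j, h⟩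
    obtain ⟨q, hq⟩ := residue_eq_iff.1 h
    exact ⟨j + D * (-q), by rw [ha.add_mul_period]; linear_combination hq⟩
  · rintro ⟨j, rfl⟩; exact ⟨j, rfl⟩

theorem card_supp (ha : IsCyclicSeq D m a) : (supp D m a).card = D := by
  rw [supp, Finset.card_image_of_injOn, Finset.card_range]
  have key : ∀ i j : ℕ, i < j → j < D → residue m (a i) ≠ residue m (a j) := by
    intro i j hij hj h
    have h1 : a i < a j := ha.strictMono (by omega)
    have h2 : a j < a i + m := by rw [← ha.add_period]; exact ha.strictMono (by omega)
    have := Int.le_of_dvd (by omega) (residue_eq_iff.1 h.symm)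
    omega
  intro i hi j hj h
  simp only [Finset.coe_range, Set.mem_Iio] at hi hj
  rcases lt_trichotomy i j with hij | hij | hij
  · exact absurd h (key i j hij hj)
  · exact hij
  · exact absurd h.symm (key j i hij hi)

theorem supp_shift (ha : IsCyclicSeq D m a) (hD : 0 < D) (k : ℤ) :
    supp D m (fun j => a (j + k)) = supp D m a := by
  ext v
  rw [ha.mem_supp hD, (ha.shift k).mem_supp hD]
  exact ⟨fun ⟨j, h⟩ => ⟨_, h⟩, fun ⟨j, h⟩ => ⟨j - k, by simpa using h⟩⟩

theorem _root_.CyclicTriang.supp_sub_one (D m : ℕ) [NeZero m] (a : ℤ → ℤ) :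
    supp D m (fun j => a j - 1) = shiftDown (supp D m a) := by
  simp only [supp, shiftDown, Finset.image_image, Function.comp_def, residue_sub_one]

/-- The support determines the preimage in `ℤ`, and an increasing enumeration of it is free only in
the choice of origin. -/
theorem exists_shift (ha : IsCyclicSeq D m a) (hb : IsCyclicSeq D m b) (hD : 0 < D)
    (h : supp D m a = supp D m b) : ∃ k, b = fun j => a (j + k) := by
  obtain ⟨k, hk⟩ := (ha.residue_mem_supp hD (k := b 0)).1
    (by rw [h, hb.residue_mem_supp hD]; exact ⟨0, rfl⟩)
  refine ⟨k, strictMono_int_eq hb.strictMono (ha.shift k).strictMono (fun l => ?_) (by simp [hk])⟩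
  rw [← hb.residue_mem_supp hD, ← h, ha.residue_mem_supp hD]
  exact ⟨fun ⟨j, h⟩ => ⟨j - k, by simpa using h⟩, fun ⟨j, h⟩ => ⟨_, h⟩⟩

end IsCyclicSeq

/-- The periodic extension of a sequence of length `D`. -/
def periodicExtend (D m : ℕ) (c : ℕ → ℤ) (j : ℤ) : ℤ := c (j % D).toNat + m * (j / D)

theorem periodicExtend_natCast {D : ℕ} (m : ℕ) (c : ℕ → ℤ) {j : ℕ} (hj : j < D) :
    periodicExtend D m c j = c j := by
  rw [periodicExtend, Int.emod_eq_of_lt (by positivity) (by exact_mod_cast hj),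
    Int.ediv_eq_zero_of_lt (by positivity) (by exact_mod_cast hj)]
  simp

theorem periodicExtend_add_period {D : ℕ} (hD : 0 < D) (m : ℕ) (c : ℕ → ℤ) (j : ℤ) :
    periodicExtend D m c (j + D) = periodicExtend D m c j + m := by
  have hD' : (D : ℤ) ≠ 0 := by exact_mod_cast hD.ne'
  simp only [periodicExtend, Int.add_emod_right, Int.add_ediv_of_dvd_right (dvd_refl (D : ℤ)),
    Int.ediv_self hD']
  ring

/-- Used with `g = 1` for monotonicity and with `g = 2` for separation; `hc'` is the gap across the
end of a period. -/
theorem periodicExtend_gap {D m : ℕ} (hD : 0 < D) (c : ℕ → ℤ) (g : ℤ)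
    (hc : ∀ i, i + 1 < D → c i + g ≤ c (i + 1)) (hc' : c (D - 1) + g ≤ c 0 + m) (j : ℤ) :
    periodicExtend D m c j + g ≤ periodicExtend D m c (j + 1) := by
  have hD' : (0 : ℤ) < D := by exact_mod_cast hD
  have h1 := Int.emod_nonneg j hD'.ne'
  have h2 := Int.emod_lt_of_pos j hD'
  have h3 := Int.emod_add_mul_ediv j D
  by_cases h : j % D + 1 < D
  · have e1 : (j + 1) % D = j % D + 1 := by
      rw [Int.add_emod, ← Int.emod_eq_of_lt (by omega : 0 ≤ j % D + 1) h]
      simp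
    have e2 : (j + 1) / D = j / D := by
      rw [Int.ediv_eq_iff_of_pos hD']
      constructor <;> nlinarith
    have := hc (j % D).toNat (by omega)
    simp only [periodicExtend, e1, e2]
    rw [show (j % D + 1).toNat = (j % D).toNat + 1 by omega]
    linarith
  · have e0 : j % D = D - 1 := by omega
    have e2 : (j + 1) / D = j / D + 1 := by
      rw [Int.ediv_eq_iff_of_pos hD']
      constructor <;> nlinarith
    have e1 : (j + 1) % D = 0 := by
      have := Int.emod_add_mul_ediv (j + 1) D
      rw [e2] at this
      linarith
    simp only [periodicExtend, e1, e2, e0]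
    have : ((D : ℤ) - 1).toNat = D - 1 := by omega
    rw [this]
    simp only [Int.toNat_zero]
    linarith

theorem isCyclicSeq_periodicExtend {D m : ℕ} (hD : 0 < D) (c : ℕ → ℤ)
    (hc : ∀ i, i + 1 < D → c i < c (i + 1)) (hc' : c (D - 1) < c 0 + m) :
    IsCyclicSeq D m (periodicExtend D m c) where
  strictMono := strictMono_int_of_lt_succ fun j => by
    have := periodicExtend_gap hD c 1 (fun i hi => hc i hi) hc' j
    omega
  add_period := periodicExtend_add_period hD m c

theorem exists_isCyclicSeq {D m : ℕ} [NeZero m] (hD : 0 < D) (A : Finset (Fin m))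
    (hA : A.card = D) : ∃ a, IsCyclicSeq D m a ∧ supp D m a = A := by
  classical
  let f := A.orderEmbOfFin hA
  let c : ℕ → ℤ := fun i => if h : i < D then (f ⟨i, h⟩).val else 0
  have hc : IsCyclicSeq D m (periodicExtend D m c) := by
    refine isCyclicSeq_periodicExtend hD c (fun i hi => ?_) ?_
    · have hi' : i < D := by omega
      have : f ⟨i, hi'⟩ < f ⟨i + 1, hi⟩ := f.strictMono (by simp)
      simp only [c, hi, hi', dif_pos]
      exact_mod_cast this
    · have h1 := (f ⟨D - 1, by omega⟩).isLt
      have : D - 1 < D := by omega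
      simp only [c, hD, dif_pos, this]
      omega
  refine ⟨_, hc, ?_⟩
  refine Finset.eq_of_subset_of_card_le (fun v hv => ?_) (by rw [hc.card_supp, hA])
  simp only [supp, Finset.mem_image, Finset.mem_range] at hv
  obtain ⟨j, hj, rfl⟩ := hv
  rw [periodicExtend_natCast m c hj]
  simp only [c, hj, dif_pos, residue_val]
  exact A.orderEmbOfFin_mem hA _

/-! ### Intertwining -/

section intertwining

variable {d m : ℕ} [NeZero m]

/-- With the origin at `a 0`, one period of both sequences lies in `[a 0, a 0 + m)`, where the
shifted cyclic order is the order of the integers. -/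
theorem IsCyclicSeq.intertwining {a b : ℤ → ℤ} (ha : IsCyclicSeq (d + 1) m a)
    (h1 : ∀ j, a j < b j) (h2 : ∀ j, b j < a (j + 1)) :
    Intertwining d (supp (d + 1) m a) (supp (d + 1) m b) := by
  have hrange : ∀ c : ℤ → ℤ, Set.range (fun i : Fin (d + 1) => residue m (c i.val)) =
      (supp (d + 1) m c : Set (Fin m)) := by
    intro c
    ext v
    simp only [Set.mem_range, supp, Finset.coe_image, Set.mem_image, Finset.coe_range, Set.mem_Iio]
    exact ⟨fun ⟨i, h⟩ => ⟨i, i.isLt, h⟩, fun ⟨i, hi, h⟩ => ⟨⟨i, hi⟩, h⟩⟩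
  have hsub : ∀ k, a 0 ≤ k → k < a 0 + m →
      ((residue m k - residue m (a 0) : Fin m).val : ℤ) = k - a 0 := by
    intro k hk1 hk2
    rw [residue_sub_val_cast, Int.emod_eq_of_lt] <;> omega
  have hper := ha.add_period 0
  have A : ∀ j : ℤ, 0 ≤ j → j ≤ d → a 0 ≤ a j ∧ b j < a 0 + m := by
    intro j hj hj'
    refine ⟨ha.strictMono.monotone hj, (h2 j).trans_le ?_⟩
    rw [← hper]
    exact ha.strictMono.monotone (by push_cast; omega)
  refine ⟨residue m (a 0), _, _, hrange a, hrange b, fun i => ?_, fun i => ?_⟩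
  · have h := A i (by positivity) (by exact_mod_cast Nat.le_of_lt_succ i.isLt)
    have := h1 i
    rw [Fin.lt_def, ← Int.ofNat_lt, hsub _ h.1 (by omega), hsub _ (by omega) h.2]
    omega
  · have hi := i.isLt
    have h := A i (by positivity) (by omega)
    have h' := A ((i : ℤ) + 1) (by positivity) (by omega)
    have := h1 i
    have := h2 i
    have := h1 ((i : ℤ) + 1)
    simp only [Fin.val_castSucc, Fin.val_succ, Nat.cast_add, Nat.cast_one]
    rw [Fin.lt_def, ← Int.ofNat_lt, hsub _ (by omega) h.2, hsub _ h'.1 (by omega)]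
    omega

/-- Both sets are lifted from the same origin `l`, so that one indexing serves both sequences. -/
theorem Intertwining.exists_isCyclicSeq {A B : Finset (Fin m)} (h : Intertwining d A B) :
    ∃ a b, IsCyclicSeq (d + 1) m a ∧ IsCyclicSeq (d + 1) m b ∧ supp (d + 1) m a = A ∧
      supp (d + 1) m b = B ∧ (∀ j, a j < b j) ∧ ∀ j, b j < a (j + 1) := by
  obtain ⟨l, f, g, hf, hg, h1, h2⟩ := h
  let ext : (Fin (d + 1) → Fin m) → ℕ → ℤ := fun f i =>
    if h : i < d + 1 then ((f ⟨i, h⟩ - l).val : ℤ) + l.val else 0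
  have h3 : ∀ i j : ℕ, i < j → ∀ (hi : i < d + 1) (hj : j < d + 1),
      g ⟨i, hi⟩ - l < f ⟨j, hj⟩ - l := by
    intro i j hij hi
    induction j, hij using Nat.le_induction with
    | base => intro hj; exact h2 ⟨i, by omega⟩
    | succ j hj ih =>
      intro hj'
      exact (ih (by omega)).trans ((h1 ⟨j, by omega⟩).trans (h2 ⟨j, by omega⟩))
  have hext : ∀ f : Fin (d + 1) → Fin m, (∀ i j : ℕ, i < j → ∀ (hi : i < d + 1) (hj : j < d + 1),
      f ⟨i, hi⟩ - l < f ⟨j, hj⟩ - l) → ∃ c : ℤ → ℤ, IsCyclicSeq (d + 1) m c ∧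
        (supp (d + 1) m c : Set (Fin m)) = Set.range f ∧
        c = periodicExtend (d + 1) m (ext f) := by
    intro f hf
    have hc : IsCyclicSeq (d + 1) m (periodicExtend (d + 1) m (ext f)) := by
      refine isCyclicSeq_periodicExtend (by omega) _ (fun i hi => ?_) ?_
      · have hi' : i < d + 1 := by omega
        have := hf i (i + 1) (by omega) hi' hi
        simp only [ext, hi, hi', dif_pos]
        rw [Fin.lt_def, ← Int.ofNat_lt] at this
        omega
      · have h1 := (f ⟨d, by omega⟩ - l).isLt
        simp only [ext, add_tsub_cancel_right, lt_add_iff_pos_right, zero_lt_one, dif_pos,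
          Nat.zero_lt_succ]
        omega
    refine ⟨_, hc, ?_, rfl⟩
    have key : ∀ j (hj : j < d + 1),
        residue m (periodicExtend (d + 1) m (ext f) j) = f ⟨j, hj⟩ := by
      intro j hj
      rw [periodicExtend_natCast m _ hj]
      simp only [ext, hj, dif_pos]
      have : residue m (((f ⟨j, hj⟩ - l).val : ℤ) + l.val) - l = f ⟨j, hj⟩ - l := by
        conv_lhs => rw [← residue_val l]
        rw [residue_sub, residue_val l, add_sub_cancel_right, residue_val]
      open Fin.CommRing in exact sub_left_injective this
    ext v
    simp only [supp, Finset.coe_image, Set.mem_image, Finset.coe_range, Set.mem_Iio, Set.mem_range]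
    constructor
    · rintro ⟨j, hj, rfl⟩; exact ⟨⟨j, hj⟩, (key j hj).symm⟩
    · rintro ⟨j, rfl⟩; exact ⟨j, j.isLt, key j j.isLt⟩
  obtain ⟨a, ha, has, hae⟩ := hext f fun i j hij hi hj => (h1 _).trans (h3 i j hij hi hj)
  obtain ⟨b, hb, hbs, hbe⟩ := hext g fun i j hij hi hj => (h3 i j hij hi hj).trans (h1 _)
  refine ⟨a, b, ha, hb, by exact_mod_cast has.trans hf, by exact_mod_cast hbs.trans hg, ?_, ?_⟩
  · intro j
    rw [hae, hbe]
    simp only [periodicExtend]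
    have h := Int.emod_nonneg j (b := (d + 1 : ℕ)) (by positivity)
    have h' := Int.emod_lt_of_pos j (b := (d + 1 : ℕ)) (by positivity)
    have hlt : (j % (d + 1 : ℕ)).toNat < d + 1 := by omega
    simp only [ext, hlt, dif_pos]
    have := h1 ⟨_, hlt⟩
    rw [Fin.lt_def, ← Int.ofNat_lt] at this
    omega
  · have key : ∀ j : ℕ, j < d + 1 → b j < a (j + 1) := by
      intro j hj
      have hb0 : b j = ext g j := by rw [hbe, periodicExtend_natCast m _ hj]
      rw [hb0]
      by_cases hj' : j < d
      · have hj1 : j + 1 < d + 1 := by omega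
        have ha0 : a (j + 1) = ext f (j + 1) := by
          rw [hae, ← periodicExtend_natCast m (ext f) hj1, Nat.cast_add, Nat.cast_one]
        rw [ha0]
        simp only [ext, hj, dif_pos, hj1]
        have := h3 j (j + 1) (by omega) hj hj1
        rw [Fin.lt_def, ← Int.ofNat_lt] at this
        omega
      -- At the end of the period the next entry of `a` is its first entry plus `m`, and the lifted
      -- values of `b` stay below `l + m`.
      · have ha0 : a (j + 1) = ext f 0 + m := by
          rw [hae, show (j : ℤ) + 1 = (0 : ℕ) + (d + 1 : ℕ) by push_cast; omega,
            periodicExtend_add_period (by omega), periodicExtend_natCast m _ (by omega)]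
        rw [ha0]
        simp only [ext, hj, dif_pos, Nat.zero_lt_succ]
        have := (g ⟨j, hj⟩ - l).isLt
        omega
    intro j
    have h := Int.emod_nonneg j (b := (d + 1 : ℕ)) (by positivity)
    have h' := Int.emod_lt_of_pos j (b := (d + 1 : ℕ)) (by positivity)
    have := key (j % (d + 1 : ℕ)).toNat (by omega)
    rw [Int.toNat_of_nonneg h] at this
    have e : a (j + 1) = a (j % (d + 1 : ℕ) + 1) + m * (j / (d + 1 : ℕ)) := by
      rw [← ha.add_mul_period, add_right_comm, Int.emod_add_mul_ediv]
    rw [hb.add_mul_period' j, e]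
    simpa using this

/-- Start the cyclic reading one place later: `b j < a (j + 1) < b (j + 1)`. -/
theorem Intertwining.symm {A B : Finset (Fin m)} (h : Intertwining d A B) :
    Intertwining d B A := by
  obtain ⟨a, b, ha, hb, rfl, rfl, h1, h2⟩ := h.exists_isCyclicSeq
  have := hb.intertwining h2 (fun j => h1 (j + 1))
  rwa [ha.supp_shift (by omega)] at this

end intertwining

/-! ### Labelled deterministic transition systems with commuting steps -/

/-- There is a path from one state to another with the given list of labels. -/
inductive Run {ι σ : Type} (step : ι → σ → σ → Prop) : List ι → σ → σ → Prop
  | nil (s : σ) : Run step [] s s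
  | cons {i : ι} {w : List ι} {s u t : σ} : step i s u → Run step w u t → Run step (i :: w) s t

namespace Run

variable {ι σ : Type} {step : ι → σ → σ → Prop}

theorem append {w w' : List ι} {s t u : σ} (h : Run step w s t) (h' : Run step w' t u) :
    Run step (w ++ w') s u := by
  induction h with
  | nil s => exact h'
  | cons h1 _ ih => exact cons h1 (ih h')

theorem exists_seq {w : List ι} {s t : σ} (h : Run step w s t) :
    ∃ p : ℕ → σ, p 0 = s ∧ p w.length = t ∧
      ∀ r, r < w.length → ∃ i, step i (p r) (p (r + 1)) := by
  induction h with
  | nil s => exact ⟨fun _ => s, rfl, rfl, by simp⟩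
  | @cons i w s u t h1 _ ih =>
    obtain ⟨p, h0, hl, hp⟩ := ih
    refine ⟨fun r => Nat.casesOn r s p, rfl, hl, fun r hr => ?_⟩
    cases r with
    | zero => exact ⟨i, by simpa [h0] using h1⟩
    | succ r => exact hp r (by simpa using hr)

theorem of_seq (p : ℕ → σ) (l : ℕ → ι) (n : ℕ) (h : ∀ r < n, step (l r) (p r) (p (r + 1))) :
    Run step ((List.range n).map l) (p 0) (p n) := by
  induction n with
  | zero => exact nil _
  | succ n ih =>
    rw [List.range_succ, List.map_append]
    exact (ih fun r hr => h r (by omega)).append (cons (h n (by omega)) (nil _))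

end Run

/-- Steps are deterministic, and steps with distinct labels commute. -/
structure IsCommuting {ι σ : Type} (step : ι → σ → σ → Prop) : Prop where
  det : ∀ {i s t u}, step i s t → step i s u → t = u
  diamond : ∀ {i j s t u}, i ≠ j → step i s t → step j s u → ∃ v, step j t v ∧ step i u v

namespace IsCommuting

variable {ι σ : Type} [DecidableEq ι] {step : ι → σ → σ → Prop}

/-- Diamonds move the first occurrence of `j` to the front of the path; determinism identifies it
there with the given step. -/
theorem exchange (hc : IsCommuting step) {w : List ι} {j : ι} {s t u : σ} (h : Run step w s t)
    (hj : j ∈ w) (hs : step j s u) : Run step (w.erase j) u t := by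
  induction h generalizing u with
  | nil s => simp at hj
  | @cons i w s v t h1 h2 ih =>
    by_cases hij : i = j
    · subst hij
      rw [List.erase_cons_head, hc.det hs h1]
      exact h2
    · rw [List.erase_cons_tail (by simpa using hij)]
      obtain ⟨x, hx1, hx2⟩ := hc.diamond hij h1 hs
      exact .cons hx2 (ih (by simpa [Ne.symm hij] using hj) hx1)

/-- The endpoint depends only on the multiset of labels: exchange brings the first label of one path
to the front of the other. -/
theorem eq_of_perm (hc : IsCommuting step) {w w' : List ι} {s t t' : σ} (h : Run step w s t)
    (h' : Run step w' s t') (hw : w.Perm w') : t = t' := by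
  induction h' generalizing w with
  | nil s =>
    rw [List.perm_nil] at hw
    subst hw
    cases h
    rfl
  | @cons j w' s u t' h1 _ ih =>
    refine ih (hc.exchange h (hw.mem_iff.2 (by simp)) h1) ?_
    have := hw.erase j
    rwa [List.erase_cons_head] at this

/-- If paths that use every label once act as `F`, then paths that use every label `K` times act
as `F^[K]`. -/
theorem eq_iterate [Nonempty ι] (hc : IsCommuting step) {F : σ → σ}
    (hF : ∀ s, (∃ i t, step i s t) →
      (∃ w, (∀ i, w.count i = 1) ∧ Run step w s (F s)) ∧ ∃ i t, step i (F s) t)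
    {w : List ι} {s t : σ} {K : ℕ} (hw : ∀ i, w.count i = K) (h : Run step w s t) :
    t = F^[K] s := by
  have iter : ∀ K s, (∃ i t, step i s t) →
      ∃ w, (∀ i, w.count i = K) ∧ Run step w s (F^[K] s) := by
    intro K
    induction K with
    | zero => exact fun s _ => ⟨[], by simp, .nil s⟩
    | succ K ih =>
      intro s hs
      obtain ⟨⟨w, hw, hr⟩, hs'⟩ := hF s hs
      obtain ⟨w', hw', hr'⟩ := ih _ hs'
      exact ⟨w ++ w', fun i => by rw [List.count_append, hw, hw', add_comm], hr.append hr'⟩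
  -- The labels of the given path are a permutation of those of `K` concatenated rounds.
  have fin : (∃ i t, step i s t) → t = F^[K] s := fun hs => by
    obtain ⟨w', hw', hr'⟩ := iter K s hs
    exact hc.eq_of_perm h hr' (List.perm_iff_count.2 fun i => by rw [hw, hw'])
  cases h with
  -- Here `s` may have no outgoing step, but the empty path forces `K = 0`.
  | nil s =>
    have := hw (Classical.arbitrary ι)
    rw [List.count_nil] at this
    subst this
    rfl
  | cons h1 h2 => exact fin ⟨_, _, h1⟩

/-- By exchange, each step begins a closed round, and the rest of the round undoes it. -/
theorem exists_reverse (hc : IsCommuting step)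
    (hF : ∀ s, (∃ i t, step i s t) → ∃ w, (∀ i, w.count i = 1) ∧ Run step w s s)
    {w : List ι} {s t : σ} (h : Run step w s t) : ∃ v, Run step v t s := by
  induction h with
  | nil s => exact ⟨[], .nil s⟩
  | @cons i w s u t h1 _ ih =>
    obtain ⟨v, hv⟩ := ih
    obtain ⟨w0, hw0, hr⟩ := hF s ⟨_, _, h1⟩
    exact ⟨_, hv.append (hc.exchange hr (List.count_pos_iff.1 (by simp [hw0])) h1)⟩

end IsCommuting

/-! ### Cut quivers are acyclic -/

section cut

variable {d n : ℕ}

/-- `B = A + f_i`. -/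
def IsArrow (i : Fin (d + 1)) (A B : CutVertex d n) : Prop :=
  ∀ j, (B.1 j : ℤ) = (A.1 j : ℤ) + arrowVec d i j

open Classical in
/-- The steps along the arrows of `Q^{(d, n)}`, with a counter for the arrows in `C`. -/
def weightedStep (C : Set (CutVertex d n × CutVertex d n)) (i : Fin (d + 1))
    (s t : CutVertex d n × ℤ) : Prop :=
  IsArrow i s.1 t.1 ∧ t.2 = s.2 + if (s.1, t.1) ∈ C then 1 else 0

theorem arrowVec_apply (i j : Fin (d + 1)) :
    arrowVec d i j = (if j = i + 1 then 1 else 0) - if j = i then 1 else 0 := by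
  simp [arrowVec, Pi.single_apply]

theorem sum_arrowVec (i : Fin (d + 1)) : ∑ j, arrowVec d i j = 0 := by
  simp [arrowVec_apply]

theorem IsArrow.pos (hd : 1 ≤ d) {i : Fin (d + 1)} {A B : CutVertex d n} (h : IsArrow i A B) :
    1 ≤ A.1 i := by
  have := h i
  have hi : i ≠ i + 1 := by simp; omega
  rw [arrowVec_apply, if_neg hi, if_pos rfl] at this
  omega

theorem exists_isArrow (i : Fin (d + 1)) (A : CutVertex d n) (h : 1 ≤ A.1 i) :
    ∃ B, IsArrow i A B := by
  have hnn : ∀ j, 0 ≤ (A.1 j : ℤ) + arrowVec d i j := by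
    intro j
    rw [arrowVec_apply]
    by_cases hj : j = i
    · subst hj; rw [if_pos rfl]; split_ifs <;> omega
    · rw [if_neg hj]; split_ifs <;> omega
  refine ⟨⟨fun j => ((A.1 j : ℤ) + arrowVec d i j).toNat, ?_⟩, fun j => ?_⟩
  · have := A.2
    zify at this ⊢
    simp only [Int.toNat_of_nonneg (hnn _), Finset.sum_add_distrib, sum_arrowVec]
    linarith
  · exact Int.toNat_of_nonneg (hnn j)

theorem exists_weightedStep (C : Set (CutVertex d n × CutVertex d n)) (i : Fin (d + 1))
    (s : CutVertex d n × ℤ) (h : 1 ≤ s.1.1 i) : ∃ t, weightedStep C i s t := by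
  obtain ⟨B, hB⟩ := exists_isArrow i s.1 h
  classical exact ⟨(B, s.2 + if (s.1, B) ∈ C then 1 else 0), hB, rfl⟩

/-- Entry `j` is lowered by `f_j` and raised by `f_{j - 1}`. On a closed path this makes
neighbouring labels, hence all labels, equally frequent. -/
theorem Run.apply_eq {C : Set (CutVertex d n × CutVertex d n)} {w : List (Fin (d + 1))}
    {s t : CutVertex d n × ℤ} (h : Run (weightedStep C) w s t) (j : Fin (d + 1)) :
    (t.1.1 j : ℤ) = s.1.1 j + w.count (j - 1) - w.count j := by
  induction h with
  | nil s => simp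
  | @cons i w s u t h1 _ ih =>
    have := h1.1 j
    rw [arrowVec_apply] at this
    rw [ih, this, List.count_cons, List.count_cons]
    simp only [beq_iff_eq, eq_sub_iff_add_eq, eq_comm (a := j)]
    push_cast
    ring

theorem count_eq_of_closed {w : List (Fin (d + 1))}
    (h : ∀ j, w.count (j - 1) = w.count j) (j : Fin (d + 1)) : w.count j = w.count 0 := by
  induction j using Fin.induction with
  | zero => rfl
  | succ j ih =>
    rw [← ih, ← h]
    congr 1
    rw [sub_eq_iff_eq_add]
    simp

/-- Here `s` lies at `A + ∑ f_i` over `i ∈ I`. The missing labels can be used one at a time: if `k ∉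
I` and `k - 1 ∈ I`, then entry `k` has been raised and not lowered, so `f_k` applies. When all
labels are used, the path is back at `A`. -/
theorem exists_run_complement (hd : 1 ≤ d) (C : Set (CutVertex d n × CutVertex d n))
    (A : CutVertex d n) (N : ℕ) (I : Finset (Fin (d + 1))) (hI : I.Nonempty)
    (hN : I.card + N = d + 1) (s : CutVertex d n × ℤ)
    (hs : ∀ j, (s.1.1 j : ℤ) = A.1 j + (if j - 1 ∈ I then 1 else 0) - if j ∈ I then 1 else 0) :
    ∃ w k, (∀ i, w.count i = if i ∈ I then 0 else 1) ∧ Run (weightedStep C) w s (A, k) := by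
  induction N generalizing I s with
  | zero =>
    have : I = Finset.univ := by
      rw [← Finset.card_eq_iff_eq_univ, Fintype.card_fin]; omega
    subst this
    refine ⟨[], s.2, by simp, ?_⟩
    have : s = (A, s.2) := by
      ext j
      · have := hs j
        simp at this
        exact this
      · rfl
    rw [← this]
    exact .nil s
  | succ N ih =>
    -- A nonempty set of labels that is closed under the cyclic successor contains all labels.
    obtain ⟨k, hk, hk'⟩ : ∃ k, k ∉ I ∧ k - 1 ∈ I := by
      by_contra! hcon
      obtain ⟨i, hi⟩ := hI
      have : ∀ r : Fin (d + 1), i + r ∈ I := by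
        intro r
        induction r using Fin.induction with
        | zero => simpa using hi
        | succ r ih =>
          by_contra h
          refine hcon _ h ?_
          convert ih using 1
          rw [sub_eq_iff_eq_add, add_assoc]
          simp
      have : I = Finset.univ := by
        ext j; simpa using this (j - i)
      rw [this, Finset.card_univ, Fintype.card_fin] at hN
      omega
    have hsk := hs k
    rw [if_pos hk', if_neg hk] at hsk
    obtain ⟨t, ht⟩ := exists_weightedStep C k s (by omega)
    have hk1 : k ≠ k - 1 := by
      intro h
      have : k + 1 = k := by rw [eq_sub_iff_add_eq] at h; exact h
      simp at this
      omega
    obtain ⟨w, q, hw, hr⟩ := ih (insert k I) (Finset.insert_nonempty _ _)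
      (by rw [Finset.card_insert_of_notMem hk]; omega) t (fun j => by
        have h1 := ht.1 j
        rw [arrowVec_apply, hs] at h1
        rw [h1]
        simp only [Finset.mem_insert, ← sub_eq_iff_eq_add]
        by_cases hj : j = k
        · subst hj
          simp [hk, hk1.symm, hk']
        · by_cases hj' : j - 1 = k
          · simp [hj, hj', hk]
            ring
          · simp [hj, hj'])
    refine ⟨k :: w, q, fun i => ?_, .cons ht hr⟩
    rw [List.count_cons, hw]
    by_cases hi : i = k
    · subst hi; simp [hk]
    · simp [hi, Ne.symm hi]

theorem Run.add_weight {C : Set (CutVertex d n × CutVertex d n)} {w : List (Fin (d + 1))}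
    {s t : CutVertex d n × ℤ} (h : Run (weightedStep C) w s t) (c : ℤ) :
    Run (weightedStep C) w (s.1, s.2 + c) (t.1, t.2 + c) := by
  induction h with
  | nil s => exact .nil _
  | @cons i w s u t h1 _ ih =>
    refine .cons (u := (u.1, u.2 + c)) ⟨h1.1, ?_⟩ ih
    rw [h1.2]
    ring

/-- A closed path with every label once has length `d + 1`, so the cut condition gives exactly one
increment of the counter. -/
theorem IsCut.run_weight {C : Set (CutVertex d n × CutVertex d n)} (hC : IsCut C)
    {w : List (Fin (d + 1))} (hw : ∀ i, w.count i = 1) {A : CutVertex d n} {k k' : ℤ}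
    (h : Run (weightedStep C) w (A, k) (A, k')) : k' = k + 1 := by
  classical
  have hlen : w.length = d + 1 := by
    have : w.Perm (List.finRange (d + 1)) := List.perm_iff_count.2 fun i => by
      rw [hw, List.count_eq_one_of_mem (List.nodup_finRange _) (List.mem_finRange _)]
    rw [this.length_eq, List.length_finRange]
  obtain ⟨p, h0, h1, hp⟩ := h.exists_seq
  rw [hlen] at h1 hp
  let c : Fin (d + 1) → CutVertex d n := fun i => (p i).1
  have hc : ∀ i : Fin (d + 1), c (i + 1) = (p (i.val + 1)).1 := by
    intro i
    simp only [c]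
    by_cases hi : i = Fin.last d
    · subst hi
      simp [h0, h1]
    · rw [Fin.val_add_one_of_lt (Fin.lt_last_iff_ne_last.2 hi)]
  have hsum : ∀ r, r ≤ d + 1 → (p r).2 = k + ∑ i ∈ Finset.range r,
      if ((p i).1, (p (i + 1)).1) ∈ C then (1 : ℤ) else 0 := by
    intro r hr
    induction r with
    | zero => simp [h0]
    | succ r ih =>
      obtain ⟨i, hi⟩ := hp r (by omega)
      rw [Finset.sum_range_succ, ← add_assoc, ← ih (by omega)]
      exact hi.2
  obtain ⟨i, hi, hi'⟩ := hC.existsUnique c fun i => by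
    obtain ⟨l, hl⟩ := hp i i.isLt
    exact ⟨l, by rw [hc]; exact hl.1⟩
  have := hsum (d + 1) le_rfl
  rw [h1] at this
  simp only at this
  rw [this, Finset.sum_range fun i => if ((p i).1, (p (i + 1)).1) ∈ C then (1 : ℤ) else 0,
    Finset.sum_eq_single i]
  · rw [hc] at hi
    exact congrArg (k + ·) (if_pos hi)
  · intro j _ hj
    refine if_neg fun hj' => hj (hi' j ?_)
    simp only [hc]
    exact hj'
  · simp

/-- The two orders of a pair of steps reach the same vertex. Completed by the same path, both become
closed rounds, which raise the counter by one; so the counters agree already after the two steps. -/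
theorem IsCut.isCommuting (hd : 1 ≤ d) {C : Set (CutVertex d n × CutVertex d n)} (hC : IsCut C) :
    IsCommuting (weightedStep C) where
  det := by
    rintro i s t u ⟨h1, h2⟩ ⟨h3, h4⟩
    have : t.1 = u.1 := by
      ext j
      have := h1 j
      have := h3 j
      omega
    ext1
    · exact this
    · rw [h2, h4, this]
  diamond := by
    intro i j s t u hij hi hj
    have e : ∀ i j : Fin (d + 1), i ≠ j → ∀ s t u, weightedStep C i s t → weightedStep C j s u →
        ∃ v, weightedStep C j t v := by
      intro i j hij s t u hi hj
      refine exists_weightedStep C j t ?_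
      have h1 := hi.1 j
      have := hj.1.pos hd
      rw [arrowVec_apply, if_neg (Ne.symm hij)] at h1
      split_ifs at h1 <;> omega
    obtain ⟨v, hv⟩ := e i j hij s t u hi hj
    obtain ⟨v', hv'⟩ := e j i hij.symm s u t hj hi
    have hvv : v.1 = v'.1 := by
      ext l
      have := hi.1 l
      have := hv.1 l
      have := hj.1 l
      have := hv'.1 l
      omega
    have base : ∀ i j : Fin (d + 1), i ≠ j → ∀ s t v, weightedStep C i s t → weightedStep C j t v →
      ∀ l, (v.1.1 l : ℤ) = s.1.1 l + (if l - 1 ∈ ({i, j} : Finset (Fin (d + 1))) then 1 else 0) -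
        if l ∈ ({i, j} : Finset (Fin (d + 1))) then 1 else 0 := by
      intro i j hij s t v hi hv l
      rw [hv.1 l, hi.1 l, arrowVec_apply, arrowVec_apply]
      simp only [Finset.mem_insert, Finset.mem_singleton, sub_eq_iff_eq_add]
      by_cases h1 : l = i + 1 <;> by_cases h2 : l = j + 1 <;> by_cases h3 : l = i <;>
        by_cases h4 : l = j <;> simp [h1, h2, h3, h4] <;> grind
    have hcomm : v = v' := by
      obtain ⟨w, k, hw, hr⟩ := exists_run_complement hd C s.1 (d - 1) {i, j} (by simp)
        (by rw [Finset.card_pair hij]; omega) v (base i j hij s t v hi hv)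
      have hcount : ∀ i' j', i' ≠ j' → ({i', j'} : Finset (Fin (d + 1))) = {i, j} →
          ∀ l, (i' :: j' :: w).count l = 1 := by
        intro i' j' hij' he l
        have hl := hw l
        rw [← he] at hl
        rw [List.count_cons, List.count_cons, hl]
        simp only [Finset.mem_insert, Finset.mem_singleton, beq_iff_eq]
        split_ifs <;> grind
      have e1 := hC.run_weight (hcount i j hij rfl) (.cons hi (.cons hv hr))
      have e2 := hC.run_weight (hcount j i hij.symm (Finset.pair_comm _ _))
        -- The completing path starts from `v`; a shift of its counter makes it start from `v'`.
        (.cons hj (.cons hv' (hr.add_weight (v'.2 - v.2) |> fun h => by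
          have : v' = (v.1, v.2 + (v'.2 - v.2)) := by rw [hvv]; ext <;> simp
          rw [this]; exact h)))
      ext1
      · exact hvv
      · linarith
    exact ⟨v, hv, hcomm ▸ hv'⟩

/-- A cut quiver has no oriented cycles. -/
theorem IsCut.acyclic (hd : 1 ≤ d) {C : Set (CutVertex d n × CutVertex d n)} (hC : IsCut C) :
    ¬ HasOrientedCycle (cutQuiver C) := by
  rintro ⟨A, hA⟩
  have key : ∀ B, Relation.TransGen (cutQuiver C).Adj A B →
      ∃ w, w ≠ [] ∧ Run (weightedStep C) w (A, 0) (B, 0) := by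
    have single : ∀ {B D : CutVertex d n}, (cutQuiver C).Adj B D →
        ∃ i, Run (weightedStep C) [i] (B, 0) (D, 0) := by
      rintro B D ⟨⟨i, hi⟩, hn⟩
      exact ⟨i, .cons (u := (D, 0)) ⟨hi, by simp [hn]⟩ (.nil _)⟩
    intro B hB
    induction hB with
    | single h =>
      obtain ⟨i, hi⟩ := single h
      exact ⟨_, by simp, hi⟩
    | tail _ h ih =>
      obtain ⟨w, hw, hr⟩ := ih
      obtain ⟨i, hi⟩ := single h
      exact ⟨_, by simp, hr.append hi⟩
  obtain ⟨w, hw, hr⟩ := key A hA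
  have hcount : ∀ j, w.count j = w.count 0 := count_eq_of_closed fun j => by
    have := hr.apply_eq j
    simp only at this
    omega
  -- A full round fixes the vertex and adds one to the counter; an oriented cycle amounts to
  -- `w.count 0` rounds with counter zero.
  have := (hC.isCommuting hd).eq_iterate (F := fun s => (s.1, s.2 + 1)) (fun s => by
    rintro ⟨p, t, hp⟩
    refine ⟨?_, p, (t.1, t.2 + 1), hp.1, by rw [hp.2]; ring⟩
    obtain ⟨v, k, hv, hr⟩ := exists_run_complement hd C s.1 d {p} (by simp)
      (by rw [Finset.card_singleton]; omega) t (fun l => by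
        rw [hp.1 l, arrowVec_apply]
        simp only [Finset.mem_singleton, sub_eq_iff_eq_add]
        ring)
    have hcount : ∀ l, (p :: v).count l = 1 := fun l => by
      rw [List.count_cons, hv]
      simp only [beq_iff_eq, Finset.mem_singleton]
      split_ifs <;> grind
    have := hC.run_weight hcount (.cons hp hr)
    exact ⟨_, hcount, this ▸ .cons hp hr⟩) hcount hr
  have hit : ∀ K : ℕ, ∀ s : CutVertex d n × ℤ,
      ((fun s : CutVertex d n × ℤ => (s.1, s.2 + 1))^[K] s).2 = s.2 + K := by
    intro K
    induction K with
    | zero => simp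
    | succ K ih => intro s; rw [Function.iterate_succ_apply, ih]; push_cast; ring
  have h0 := congrArg Prod.snd this
  rw [hit] at h0
  obtain ⟨i, w', rfl⟩ := List.exists_cons_of_ne_nil hw
  have := hcount i
  simp only [List.count_cons_self] at this
  simp only at h0
  omega

end cut

/-! ### Affine dependences of points of the moment curve -/

section dependence

variable {m : ℕ} {t : Fin m → ℝ}

/-- The total weight is zero, so some weight has the sign opposite to `z i₀`. The least such index
is taken to control all signs before it. -/
theorem exists_first_opposite {z : Fin m → ℝ} (hz : ∑ i, z i = 0) {i₀ : Fin m} (h₀ : z i₀ ≠ 0)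
    (hmin : ∀ i < i₀, z i = 0) :
    ∃ i₁, i₀ < i₁ ∧ z i₀ * z i₁ < 0 ∧ ∀ i < i₁, 0 ≤ z i₀ * z i := by
  have hex : {i | z i₀ * z i < 0}.Nonempty := by
    by_contra hcon
    have hcon' : ∀ i, 0 ≤ z i₀ * z i := fun i => by
      by_contra! h
      exact hcon ⟨i, h⟩
    have h' : ∑ i, z i₀ * z i = 0 := by rw [← Finset.mul_sum, hz, mul_zero]
    have := (Finset.sum_eq_zero_iff_of_nonneg fun i _ => hcon' i).1 h' i₀ (Finset.mem_univ _)
    exact h₀ (by simpa using this)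
  obtain ⟨i₁, hi₁, hi₁min⟩ := WellFounded.has_min (wellFounded_lt (α := Fin m)) _ hex
  refine ⟨i₁, ?_, hi₁, fun i hi => ?_⟩
  · by_contra! h
    have hi₁ : z i₀ * z i₁ < 0 := hi₁
    rcases h.lt_or_eq with h | h
    · rw [hmin _ h] at hi₁; simp at hi₁
    · rw [h] at hi₁; nlinarith [mul_self_nonneg (z i₀)]
  · by_contra! h
    exact hi₁min i h hi

/-- A nonzero weight on the real line with vanishing moments up to order `N` has at least `N + 1`
changes of sign. -/
theorem exists_alternating (ht : StrictMono t) (N : ℕ) (z : Fin m → ℝ)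
    (hz : ∀ k ≤ N, ∑ i, z i * t i ^ k = 0) (i₀ : Fin m) (h₀ : z i₀ ≠ 0)
    (hmin : ∀ i < i₀, z i = 0) :
    ∃ j : ℕ → Fin m, j 0 = i₀ ∧ (∀ k ≤ N, j k < j (k + 1)) ∧
      ∀ k ≤ N, z (j k) * z (j (k + 1)) < 0 := by
  induction N generalizing z with
  | zero =>
    obtain ⟨i₁, h01, hi₁, -⟩ := exists_first_opposite (by simpa using hz 0 le_rfl) h₀ hmin
    refine ⟨fun k => if k = 0 then i₀ else i₁, rfl, fun k hk => ?_, fun k hk => ?_⟩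
    · obtain rfl : k = 0 := by omega
      simpa using h01
    · obtain rfl : k = 0 := by omega
      simpa using hi₁
  | succ N ih =>
    obtain ⟨i₁, h01, hi₁, hi₁min⟩ :=
      exists_first_opposite (by simpa using hz 0 (by omega)) h₀ hmin
    -- The factor `t i - r` uses up one moment and removes the first change of sign: `r` separates
    -- `t i₁` from all earlier parameters.
    obtain ⟨r, hr, hr'⟩ : ∃ r, r < t i₁ ∧ ∀ i < i₁, t i < r := by
      have hpos : 0 < i₁.val := by rw [Fin.lt_def] at h01; omega
      have hlt := ht (show (⟨i₁.val - 1, by omega⟩ : Fin m) < i₁ by rw [Fin.lt_def]; simp; omega)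
      obtain ⟨r, h1, h2⟩ := exists_between hlt
      refine ⟨r, h2, fun i hi => (ht.monotone ?_).trans_lt h1⟩
      rw [Fin.lt_def] at hi
      rw [Fin.le_def]
      simp only
      omega
    have hge : ∀ i, i₁ ≤ i → 0 < t i - r := fun i hi => by linarith [ht.monotone hi]
    have hlt : ∀ i, i < i₁ → t i - r < 0 := fun i hi => by linarith [hr' i hi]
    obtain ⟨j, hj0, hjm, hjs⟩ := ih (fun i => z i * (t i - r)) (fun k hk => by
        have h1 := hz (k + 1) (by omega)
        have h2 := hz k (by omega)
        have : ∑ i, z i * (t i - r) * t i ^ k =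
            ∑ i, z i * t i ^ (k + 1) - r * ∑ i, z i * t i ^ k := by
          rw [Finset.mul_sum, ← Finset.sum_sub_distrib]
          exact Finset.sum_congr rfl fun i _ => by ring
        rw [this, h1, h2]; ring) (mul_ne_zero h₀ (hlt _ h01).ne)
        (fun i hi => by simp [hmin i hi])
    have hj1s := hjs 0 (by omega)
    simp only [hj0, zero_add] at hj1s
    have hp : 0 < z i₀ * z (j 1) * (t (j 1) - r) := by
      by_contra! hcon
      nlinarith [mul_nonneg_of_nonpos_of_nonpos hcon (hlt _ h01).le]
    -- Up to and including `i₁`, no modified weight has the sign opposite to the one at `i₀`.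
    have hj1 : i₁ < j 1 := by
      by_contra! hcon
      rcases hcon.lt_or_eq with h | h
      · nlinarith [mul_nonneg (hi₁min _ h) (by linarith [hlt _ h] : 0 ≤ -(t (j 1) - r))]
      · rw [h] at hp
        nlinarith [hge _ le_rfl]
    have hjge : ∀ k, k ≤ N → i₁ < j (k + 1) := by
      intro k hk
      induction k with
      | zero => exact hj1
      | succ k ih => exact (ih (by omega)).trans (hjm _ hk)
    have hpos : 0 < z i₀ * z (j 1) := pos_of_mul_pos_left hp (hge _ hj1.le).le
    -- The removed change of sign is restored by inserting `i₁` between `i₀` and `j 1`.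
    refine ⟨fun k => if k = 0 then i₀ else if k = 1 then i₁ else j (k - 1), rfl, fun k hk => ?_,
      fun k hk => ?_⟩
    · rcases k with _ | _ | k
      · simpa using h01
      · simpa using hj1
      · simpa using hjm (k + 1) (by omega)
    · rcases k with _ | _ | k
      · simpa using hi₁
      · simp only [zero_add, one_ne_zero, if_false, if_true, Nat.reduceAdd, OfNat.ofNat_ne_zero,
          OfNat.ofNat_ne_one, Nat.add_one_sub_one]
        by_contra! h
        have h3 : 0 ≤ z i₁ * z (j 1) * (z i₀ * z i₀) := mul_nonneg h (mul_self_nonneg _)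
        nlinarith [mul_pos_of_neg_of_neg hi₁ (neg_neg_of_pos hpos)]
      · have h1 := hjs (k + 1) (by omega)
        have h2 := hge _ (hjge k (by omega)).le
        have h3 := hge _ (hjge (k + 1) (by omega)).le
        simp only [Nat.add_eq_zero_iff, one_ne_zero, and_false, if_false, Nat.add_eq_right,
          Nat.add_one_sub_one]
        have h4 : 0 < (t (j (k + 1)) - r) * (t (j (k + 1 + 1)) - r) := mul_pos h2 h3
        by_contra! h
        nlinarith [mul_nonneg h h4.le]

theorem exists_alternating_of_ne_zero (ht : StrictMono t) {N : ℕ} {z : Fin m → ℝ}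
    (hz : ∀ k ≤ N, ∑ i, z i * t i ^ k = 0) (h : z ≠ 0) :
    ∃ j : ℕ → Fin m, (∀ k ≤ N, j k < j (k + 1)) ∧ ∀ k ≤ N, z (j k) * z (j (k + 1)) < 0 := by
  have hne : {i | z i ≠ 0}.Nonempty := by
    by_contra hcon
    exact h (funext fun i => by_contra fun hi => hcon ⟨i, hi⟩)
  obtain ⟨i, hi, himin⟩ := WellFounded.has_min (wellFounded_lt (α := Fin m)) _ hne
  obtain ⟨j, -, h1, h2⟩ := exists_alternating ht N z hz i hi fun l hl => by
    by_contra hn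
    exact himin l hn hl
  exact ⟨j, h1, h2⟩

/-- `N + 1` changes of sign need `N + 2` points of the support. This gives the affine independence
of points of the moment curve. -/
theorem eq_zero_of_card_le (ht : StrictMono t) {N : ℕ} {z : Fin m → ℝ}
    (hz : ∀ k ≤ N, ∑ i, z i * t i ^ k = 0) {F : Finset (Fin m)} (hF : F.card ≤ N + 1)
    (hzF : ∀ i ∉ F, z i = 0) : z = 0 := by
  by_contra h
  obtain ⟨j, hj1, hj2⟩ := exists_alternating_of_ne_zero ht hz h
  have hmono : ∀ a b, a < b → b ≤ N + 1 → j a < j b := by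
    intro a b hab
    induction b, hab using Nat.le_induction with
    | base => intro hb; exact hj1 _ (by omega)
    | succ b hb ih => intro hb'; exact (ih (by omega)).trans (hj1 _ (by omega))
  have hsub : (Finset.range (N + 2)).image j ⊆ F := by
    intro i hi
    obtain ⟨k, hk, rfl⟩ := Finset.mem_image.1 hi
    rw [Finset.mem_range] at hk
    by_contra hn
    have h0 := hzF _ hn
    rcases Nat.lt_or_ge k (N + 1) with hk' | hk'
    · have := hj2 k (by omega)
      rw [h0] at this; simp at this
    · have := hj2 N le_rfl
      rw [show N + 1 = k by omega, h0] at this; simp at this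
  have := Finset.card_le_card hsub
  rw [Finset.card_image_of_injOn, Finset.card_range] at this
  · omega
  · intro a ha b hb hab
    simp only [Finset.coe_range, Set.mem_Iio] at ha hb
    rcases lt_trichotomy a b with h | h | h
    · exact absurd hab (hmono a b h (by omega)).ne
    · exact h
    · exact absurd hab (hmono b a h (by omega)).ne'

/-- There are more unknowns than the `N + 1` linear equations. -/
theorem exists_dependence_on (t : Fin m → ℝ) {N : ℕ} {F : Finset (Fin m)} (hF : N + 1 < F.card) :
    ∃ z : Fin m → ℝ, z ≠ 0 ∧ (∀ i ∉ F, z i = 0) ∧ ∀ k ≤ N, ∑ i, z i * t i ^ k = 0 := by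
  classical
  let L : (F → ℝ) →ₗ[ℝ] (Fin (N + 1) → ℝ) :=
    { toFun := fun w k => ∑ i : F, w i * t i ^ k.val
      map_add' := fun w w' => by
        funext k; simp [add_mul, Finset.sum_add_distrib]
      map_smul' := fun c w => by
        funext k; simp [mul_assoc, Finset.mul_sum] }
  have hker : LinearMap.ker L ≠ ⊥ := LinearMap.ker_ne_bot_of_finrank_lt (by simpa using hF)
  obtain ⟨w, hw, hw0⟩ := (Submodule.ne_bot_iff _).1 hker
  refine ⟨fun i => if h : i ∈ F then w ⟨i, h⟩ else 0, fun h => hw0 (funext fun i => ?_),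
    fun i hi => dif_neg hi, fun k hk => ?_⟩
  · have := congrFun h i
    simpa using this
  · have := congrFun (LinearMap.mem_ker.1 hw) ⟨k, by omega⟩
    simp only [L, LinearMap.coe_mk, AddHom.coe_mk, Pi.zero_apply] at this
    refine Eq.trans ?_ this
    rw [← Finset.sum_subset (Finset.subset_univ F), ← Finset.sum_coe_sort F]
    · exact Finset.sum_congr rfl fun i _ => by simp
    · intro i _ hi
      simp [hi]

/-! ### Radon partitions as intertwining pairs -/

variable [NeZero m] {d : ℕ}

theorem intertwining_of_alternating {j : ℕ → Fin m} (hj : ∀ k ≤ 2 * d, j k < j (k + 1)) :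
    Intertwining d ((Finset.range (d + 1)).image fun i => j (2 * i))
      ((Finset.range (d + 1)).image fun i => j (2 * i + 1)) := by
  have hr : ∀ f : ℕ → Fin m, Set.range (fun i : Fin (d + 1) => f i.val) =
      (((Finset.range (d + 1)).image f : Finset (Fin m)) : Set (Fin m)) := by
    intro f
    ext v
    simp only [Set.mem_range, Finset.coe_image, Set.mem_image, Finset.coe_range, Set.mem_Iio]
    exact ⟨fun ⟨i, h⟩ => ⟨i, i.isLt, h⟩, fun ⟨i, hi, h⟩ => ⟨⟨i, hi⟩, h⟩⟩
  refine ⟨0, _, _, hr fun i => j (2 * i), hr fun i => j (2 * i + 1), fun i => ?_, fun i => ?_⟩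
  · have := hj (2 * i) (by have := i.isLt; omega)
    open Fin.CommRing in simpa using this
  · have := hj (2 * i + 1) (by have := i.isLt; omega)
    rw [show 2 * i.val + 1 + 1 = 2 * (i.val + 1) by ring] at this
    open Fin.CommRing in simpa using this

/-- Radon partitions of points of the moment curve are intertwining. -/
theorem exists_intertwining_of_dependence (ht : StrictMono t) {z : Fin m → ℝ}
    (hz : ∀ k ≤ 2 * d, ∑ i, z i * t i ^ k = 0) (h : z ≠ 0) :
    ∃ A B, Intertwining d A B ∧ (∀ i ∈ A, 0 < z i) ∧ ∀ i ∈ B, z i < 0 := by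
  obtain ⟨j, hj, hs⟩ := exists_alternating_of_ne_zero ht hz h
  have hI := intertwining_of_alternating hj
  have hsign : ∀ i, i ≤ d → 0 < z (j 0) * z (j (2 * i)) ∧ z (j 0) * z (j (2 * i + 1)) < 0 := by
    have step : ∀ a b c : ℝ, 0 < a * b → b * c < 0 → a * c < 0 := fun a b c h1 h2 => by
      by_contra! h
      have hb : 0 < b * b := mul_self_pos.2 (by rintro rfl; simp at h1)
      nlinarith [mul_nonneg h hb.le, mul_pos_of_neg_of_neg h2 (neg_neg_of_pos h1)]
    have step' : ∀ a b c : ℝ, a * b < 0 → b * c < 0 → 0 < a * c := fun a b c h1 h2 => by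
      have := step (-a) b c (by linarith) h2
      linarith
    intro i hi
    induction i with
    | zero =>
      have h0 := hs 0 (by omega)
      refine ⟨mul_self_pos.2 ?_, h0⟩
      intro h
      rw [h] at h0
      simp at h0
    | succ i ih =>
      obtain ⟨h1, h2⟩ := ih (by omega)
      have h3 := step' _ _ _ h2 (hs (2 * i + 1) (by omega))
      exact ⟨h3, step _ _ _ h3 (hs (2 * i + 2) (by omega))⟩
  have h00 := (hsign 0 (by omega)).1
  simp only [mul_zero] at h00
  rcases lt_or_ge 0 (z (j 0)) with hp | hp
  · refine ⟨_, _, hI, fun i hi => ?_, fun i hi => ?_⟩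
    · obtain ⟨k, hk, rfl⟩ := Finset.mem_image.1 hi
      rw [Finset.mem_range] at hk
      exact (pos_iff_pos_of_mul_pos (hsign k (by omega)).1).1 hp
    · obtain ⟨k, hk, rfl⟩ := Finset.mem_image.1 hi
      rw [Finset.mem_range] at hk
      exact neg_of_mul_neg_right (hsign k (by omega)).2 hp.le
  · have hp : z (j 0) < 0 := lt_of_le_of_ne hp fun h => by rw [h] at h00; simp at h00
    refine ⟨_, _, hI.symm, fun i hi => ?_, fun i hi => ?_⟩
    · obtain ⟨k, hk, rfl⟩ := Finset.mem_image.1 hi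
      rw [Finset.mem_range] at hk
      have := (hsign k (by omega)).2
      by_contra! h
      nlinarith [mul_nonneg_of_nonpos_of_nonpos hp.le h]
    · obtain ⟨k, hk, rfl⟩ := Finset.mem_image.1 hi
      rw [Finset.mem_range] at hk
      have := (hsign k (by omega)).1
      by_contra! h
      nlinarith [mul_nonpos_of_nonpos_of_nonneg hp.le h]

theorem Intertwining.card_left {A B : Finset (Fin m)} (h : Intertwining d A B) :
    A.card = d + 1 := by
  obtain ⟨a, b, ha, hb, rfl, rfl, -, -⟩ := h.exists_isCyclicSeq
  exact ha.card_supp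

theorem Intertwining.card_right {A B : Finset (Fin m)} (h : Intertwining d A B) :
    B.card = d + 1 := h.symm.card_left

theorem Intertwining.disjoint {A B : Finset (Fin m)} (h : Intertwining d A B) :
    Disjoint A B := by
  obtain ⟨a, b, ha, hb, rfl, rfl, h1, h2⟩ := h.exists_isCyclicSeq
  rw [Finset.disjoint_left]
  intro v hv hv'
  obtain ⟨i, rfl⟩ := (ha.mem_supp (by omega)).1 hv
  obtain ⟨j, hj⟩ := (hb.residue_mem_supp (by omega)).1 hv'
  have hij : i ≤ j ∨ j + 1 ≤ i := by omega
  rcases hij with hij | hij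
  · have := ha.strictMono.monotone hij
    have := h1 j
    omega
  · have := ha.strictMono.monotone hij
    have := h2 j
    omega

theorem Intertwining.card_union {A B : Finset (Fin m)} (h : Intertwining d A B) :
    (A ∪ B).card = 2 * d + 2 := by
  rw [Finset.card_union_of_disjoint h.disjoint, h.card_left, h.card_right]; ring

/-- The elements of a set split in at most one way into two intertwining halves. -/
theorem Intertwining.eq_or_eq {A B A' B' : Finset (Fin m)} (h : Intertwining d A B)
    (h' : Intertwining d A' B') (hu : A' ∪ B' = A ∪ B) : A' = A ∨ A' = B := by
  -- The merged sequence alternates between the halves. Two merged sequences with the same support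
  -- differ by an index shift, whose parity decides which half is which.
  have merge : ∀ a b : ℤ → ℤ, IsCyclicSeq (d + 1) m a → IsCyclicSeq (d + 1) m b →
      (∀ j, a j < b j) → (∀ j, b j < a (j + 1)) → ∃ c : ℤ → ℤ, IsCyclicSeq (2 * (d + 1)) m c ∧
        supp (2 * (d + 1)) m c = supp (d + 1) m a ∪ supp (d + 1) m b ∧
        (∀ j, c (2 * j) = a j) ∧ ∀ j, c (2 * j + 1) = b j := by
    intro a b ha hb h1 h2
    let c : ℤ → ℤ := fun j => if Even j then a (j / 2) else b (j / 2)
    have ce : ∀ j, c (2 * j) = a j := fun j => by simp [c]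
    have co : ∀ j, c (2 * j + 1) = b j := fun j => by
      simp only [c, Int.not_even_two_mul_add_one, if_false]
      congr 1
      omega
    have hc : IsCyclicSeq (2 * (d + 1)) m c := by
      refine ⟨strictMono_int_of_lt_succ fun j => ?_, fun j => ?_⟩
      · rcases Int.even_or_odd' j with ⟨k, rfl | rfl⟩
        · rw [ce, co]; exact h1 k
        · rw [co, show 2 * k + 1 + 1 = 2 * (k + 1) by ring, ce]; exact h2 k
      · rcases Int.even_or_odd' j with ⟨k, rfl | rfl⟩
        · rw [show 2 * k + ((2 * (d + 1) : ℕ) : ℤ) = 2 * (k + (d + 1 : ℕ)) by push_cast; ring,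
            ce, ce, ha.add_period]
        · rw [show 2 * k + 1 + ((2 * (d + 1) : ℕ) : ℤ) = 2 * (k + (d + 1 : ℕ)) + 1 by
            push_cast; ring, co, co, hb.add_period]
    refine ⟨c, hc, ?_, ce, co⟩
    ext v
    rw [Finset.mem_union, hc.mem_supp (by omega), ha.mem_supp (by omega), hb.mem_supp (by omega)]
    constructor
    · rintro ⟨j, rfl⟩
      rcases Int.even_or_odd' j with ⟨k, rfl | rfl⟩
      · exact Or.inl ⟨k, by rw [ce]⟩
      · exact Or.inr ⟨k, by rw [co]⟩
    · rintro (⟨k, rfl⟩ | ⟨k, rfl⟩)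
      · exact ⟨2 * k, by rw [ce]⟩
      · exact ⟨2 * k + 1, by rw [co]⟩
  obtain ⟨a, b, ha, hb, rfl, rfl, h1, h2⟩ := h.exists_isCyclicSeq
  obtain ⟨a', b', ha', hb', rfl, rfl, h1', h2'⟩ := h'.exists_isCyclicSeq
  obtain ⟨c, hc, hcs, ce, co⟩ := merge a b ha hb h1 h2
  obtain ⟨c', hc', hcs', ce', co'⟩ := merge a' b' ha' hb' h1' h2'
  obtain ⟨k, rfl⟩ := hc.exists_shift hc' (by omega) (by rw [hcs, hcs', hu])
  rcases Int.even_or_odd' k with ⟨q, rfl | rfl⟩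
  · left
    rw [← ha.supp_shift (by omega) q]
    congr 1
    funext j
    rw [← ce', ← ce]
    exact congrArg c (by ring)
  · right
    rw [← hb.supp_shift (by omega) q]
    congr 1
    funext j
    rw [← ce', ← co]
    exact congrArg c (by ring)

/-- Any `2 d + 2` points carry a dependence. Alternation makes its support all of `A ∪ B` and its
signs an intertwining splitting, which is `(A, B)` or `(B, A)` by uniqueness; in the second case
negate. -/
theorem Intertwining.exists_dependence (ht : StrictMono t) {A B : Finset (Fin m)}
    (h : Intertwining d A B) : ∃ z : Fin m → ℝ, (∀ k ≤ 2 * d, ∑ i, z i * t i ^ k = 0) ∧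
      (∀ i ∈ A, 0 < z i) ∧ (∀ i ∈ B, z i < 0) ∧ ∀ i, i ∉ A → i ∉ B → z i = 0 := by
  obtain ⟨z, hz0, hzF, hz⟩ := exists_dependence_on t (N := 2 * d) (F := A ∪ B)
    (by rw [h.card_union]; omega)
  obtain ⟨A', B', h', hA', hB'⟩ := exists_intertwining_of_dependence ht hz hz0
  have hu : A' ∪ B' = A ∪ B := by
    refine Finset.eq_of_subset_of_card_le ?_ (by rw [h.card_union, h'.card_union])
    refine Finset.union_subset ?_ ?_
    · intro i hi
      by_contra hn
      exact (hA' i hi).ne' (hzF i hn)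
    · intro i hi
      by_contra hn
      exact (hB' i hi).ne (hzF i hn)
  have hB : ∀ X Y X' Y' : Finset (Fin m), Intertwining d X Y → Intertwining d X' Y' →
      X' ∪ Y' = X ∪ Y → X' = X → Y' = Y := by
    intro X Y X' Y' h h' hu hX
    ext i
    have : i ∈ X' ∪ Y' ↔ i ∈ X ∪ Y := by rw [hu]
    have h1 : i ∈ X → i ∉ Y := fun hi => Finset.disjoint_left.1 h.disjoint hi
    have h2 : i ∈ X' → i ∉ Y' := fun hi => Finset.disjoint_left.1 h'.disjoint hi
    subst hX
    simp only [Finset.mem_union] at this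
    tauto
  rcases h.eq_or_eq h' hu with he | he
  · have he' := hB _ _ _ _ h h' hu he
    subst he he'
    exact ⟨z, hz, hA', hB', fun i h1 h2 => hzF i (by simp [h1, h2])⟩
  · have he' := hB _ _ _ _ h.symm h' (hu.trans (Finset.union_comm _ _)) he
    subst he he'
    refine ⟨-z, fun k hk => ?_, fun i hi => ?_, fun i hi => ?_, fun i h1 h2 => ?_⟩
    · simp [hz k hk]
    · simpa using hB' i hi
    · simpa using hA' i hi
    · simpa using hzF i (by simp [h1, h2])

end dependence

/-! ### Simplices of a triangulation -/

section geometry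

variable {m : ℕ} {t : Fin m → ℝ} {δ : ℕ}

/-- `w` is a system of convex coefficients with support in `A`. -/
structure IsConvexWeight (A : Finset (Fin m)) (w : Fin m → ℝ) : Prop where
  nonneg : ∀ i, 0 ≤ w i
  eq_zero : ∀ i ∉ A, w i = 0
  sum_eq : ∑ i, w i = 1

theorem mem_realisation_iff {A : Finset (Fin m)} {x : Fin δ → ℝ} :
    x ∈ realisation δ t A ↔
      ∃ w, IsConvexWeight A w ∧ ∑ i, w i • momentPoint δ (t i) = x := by
  classical
  constructor
  · intro hx
    refine convexHull_min (s := (fun i => momentPoint δ (t i)) '' (A : Set (Fin m)))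
      (t := {x | ∃ w, IsConvexWeight A w ∧ ∑ i, w i • momentPoint δ (t i) = x}) ?_ ?_ hx
    · rintro _ ⟨i, hi, rfl⟩
      refine ⟨Pi.single i 1, ⟨fun j => ?_, fun j hj => ?_, by simp⟩, ?_⟩
      · by_cases h : j = i
        · subst h; simp
        · simp [h]
      · exact Pi.single_eq_of_ne (by rintro rfl; exact hj hi) _
      · rw [Finset.sum_eq_single i]
        · simp
        · intro j _ hj; simp [hj]
        · simp
    · rintro _ ⟨w, hw, rfl⟩ _ ⟨w', hw', rfl⟩ a b ha hb hab
      refine ⟨fun i => a * w i + b * w' i, ⟨fun i => ?_, fun i hi => ?_, ?_⟩, ?_⟩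
      · exact add_nonneg (mul_nonneg ha (hw.nonneg i)) (mul_nonneg hb (hw'.nonneg i))
      · rw [hw.eq_zero i hi, hw'.eq_zero i hi]; simp
      · rw [Finset.sum_add_distrib, ← Finset.mul_sum, ← Finset.mul_sum, hw.sum_eq, hw'.sum_eq]
        simpa using hab
      · simp only [add_smul, mul_smul, Finset.sum_add_distrib, Finset.smul_sum]
  · rintro ⟨w, hw, rfl⟩
    rw [← Finset.sum_subset (Finset.subset_univ A)]
    · refine (convex_convexHull ℝ _).sum_mem (fun i _ => hw.nonneg i) ?_ fun i hi =>
        subset_convexHull ℝ _ ⟨i, hi, rfl⟩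
      rw [← hw.sum_eq]
      exact Finset.sum_subset (Finset.subset_univ A) fun i _ hi => hw.eq_zero i hi
    · intro i _ hi
      rw [hw.eq_zero i hi, zero_smul]

theorem cyclicPolytope_eq : cyclicPolytope δ t = realisation δ t Finset.univ := by
  simp [cyclicPolytope, realisation]

theorem realisation_mono {A B : Finset (Fin m)} (h : A ⊆ B) :
    realisation δ t A ⊆ realisation δ t B :=
  convexHull_mono (Set.image_mono (by exact_mod_cast h))

theorem isClosed_realisation (A : Finset (Fin m)) : IsClosed (realisation δ t A) :=
  ((A.finite_toSet.image _).isCompact_convexHull ℝ).isClosed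

theorem moments_eq_zero_of_sub {w w' : Fin m → ℝ} (h : ∑ i, w i = ∑ i, w' i)
    (h' : ∑ i, w i • momentPoint δ (t i) = ∑ i, w' i • momentPoint δ (t i)) :
    ∀ k ≤ δ, ∑ i, (w - w') i * t i ^ k = 0 := by
  intro k hk
  simp only [Pi.sub_apply, sub_mul, Finset.sum_sub_distrib]
  cases k with
  | zero => simp [h]
  | succ k =>
    have := congrFun h' ⟨k, hk⟩
    simp only [Finset.sum_apply, Pi.smul_apply, momentPoint, smul_eq_mul] at this
    rw [this, sub_self]

theorem moments_smul {z : Fin m → ℝ} (hz : ∀ k ≤ δ, ∑ i, z i * t i ^ k = 0) :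
    ∑ i, z i • momentPoint δ (t i) = 0 := by
  funext k
  simpa [momentPoint] using hz (k + 1) k.isLt

theorem affineIndependent_momentPoint (ht : StrictMono t) {F : Finset (Fin m)}
    (hF : F.card ≤ δ + 1) : AffineIndependent ℝ fun i : F => momentPoint δ (t i) := by
  classical
  rw [affineIndependent_iff]
  intro s w hw hw' i hi
  let z : Fin m → ℝ := fun j => if h : j ∈ F then (if ⟨j, h⟩ ∈ s then w ⟨j, h⟩ else 0) else 0
  have hsum : ∀ (M : Type) [AddCommGroup M] [Module ℝ M] (f : Fin m → M),
      ∑ j, z j • f j = ∑ j ∈ s, w j • f j := by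
    intro M _ _ f
    rw [← Finset.sum_subset (Finset.subset_univ F), ← Finset.sum_coe_sort F]
    · rw [← Finset.sum_subset (Finset.subset_univ s)]
      · exact Finset.sum_congr rfl fun j hj => by simp [z, hj]
      · intro j _ hj; simp [z, hj]
    · intro j _ hj; simp [z, hj]
  have h1 : ∑ j, z j = 0 := by
    have := hsum ℝ fun _ => 1
    simpa [hw] using this
  have h2 : ∑ j, z j • momentPoint δ (t j) = 0 := by rw [hsum, hw']
  have hz : z = 0 := by
    refine eq_zero_of_card_le ht (N := δ) (fun k hk => ?_) hF fun j hj => dif_neg hj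
    have := moments_eq_zero_of_sub (t := t) (w := z) (w' := 0) (by simpa using h1) (by simpa using h2) k hk
    simpa using this
  have := congrFun hz i
  simpa [z, hi] using this

theorem vectorSpan_eq_top (ht : StrictMono t) {F : Finset (Fin m)} (hF : δ + 1 ≤ F.card) :
    vectorSpan ℝ ((fun i => momentPoint δ (t i)) '' (F : Set (Fin m))) = ⊤ := by
  obtain ⟨G, hG, hGc⟩ := Finset.exists_subset_card_eq hF
  have hle : vectorSpan ℝ ((fun i => momentPoint δ (t i)) '' (G : Set (Fin m))) ≤
      vectorSpan ℝ ((fun i => momentPoint δ (t i)) '' (F : Set (Fin m))) :=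
    vectorSpan_mono ℝ (Set.image_mono (by exact_mod_cast hG))
  refine top_unique (le_trans (le_of_eq ?_) hle)
  have := (affineIndependent_momentPoint ht hGc.le).vectorSpan_eq_top_of_card_eq_finrank_add_one
    (by simp [hGc])
  rw [← this]
  congr 1
  ext x
  simp

/-- The differences of the points span `ℝ ^ δ`. This excludes hyperplanes through too many points of
the moment curve. -/
theorem eq_zero_of_const (ht : StrictMono t) {F : Finset (Fin m)} (hF : δ + 1 ≤ F.card)
    (l : (Fin δ → ℝ) →ₗ[ℝ] ℝ) (c : ℝ) (hl : ∀ i ∈ F, l (momentPoint δ (t i)) = c) : l = 0 := by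
  have : vectorSpan ℝ ((fun i => momentPoint δ (t i)) '' (F : Set (Fin m))) ≤
      LinearMap.ker l := by
    rw [vectorSpan, Submodule.span_le]
    rintro _ ⟨_, ⟨i, hi, rfl⟩, _, ⟨j, hj, rfl⟩, rfl⟩
    simp [hl i hi, hl j hj]
  rw [vectorSpan_eq_top ht hF, top_le_iff, LinearMap.ker_eq_top] at this
  exact this

theorem interior_realisation_nonempty (ht : StrictMono t) {S : Finset (Fin m)}
    (hS : δ + 1 ≤ S.card) : (interior (realisation δ t S)).Nonempty := by
  rw [realisation, interior_convexHull_nonempty_iff_affineSpan_eq_top,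
    AffineSubspace.affineSpan_eq_top_iff_vectorSpan_eq_top_of_nonempty]
  · exact vectorSpan_eq_top ht hS
  · have : S.Nonempty := Finset.card_pos.1 (by omega)
    simpa using this

/-! ### Crossings in triangulations -/

variable {d : ℕ} {T : Finset (Finset (Fin m))}

theorem IsTriangulation.exists_mem (hT : IsTriangulation (2 * d) t T) {A : Finset (Fin m)}
    {w : Fin m → ℝ} (hw : IsConvexWeight A w) :
    ∃ S ∈ T, ∑ i, w i • momentPoint (2 * d) (t i) ∈ realisation (2 * d) t S := by
  have : ∑ i, w i • momentPoint (2 * d) (t i) ∈ cyclicPolytope (2 * d) t := by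
    rw [cyclicPolytope_eq]
    exact realisation_mono (Finset.subset_univ A) (mem_realisation_iff.2 ⟨w, hw, rfl⟩)
  rw [← hT.union_eq] at this
  simpa using this

theorem isConvexWeight_uniform {A : Finset (Fin m)} (hA : A.Nonempty) :
    IsConvexWeight A fun i => if i ∈ A then (A.card : ℝ)⁻¹ else 0 where
  nonneg i := by split_ifs <;> positivity
  eq_zero i hi := if_neg hi
  sum_eq := by
    have : (A.card : ℝ) ≠ 0 := by exact_mod_cast (Finset.card_pos.2 hA).ne'
    simp [this]

variable [NeZero m]

/-- Two presentations of the same point as a convex combination differ by an intertwining pair. -/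
theorem eq_or_exists_intertwining (ht : StrictMono t) {A B : Finset (Fin m)} {w w' : Fin m → ℝ}
    (hw : IsConvexWeight A w) (hw' : IsConvexWeight B w')
    (h : ∑ i, w i • momentPoint (2 * d) (t i) = ∑ i, w' i • momentPoint (2 * d) (t i)) :
    w = w' ∨ ∃ Z ⊆ A, ∃ C ⊆ B, Intertwining d Z C := by
  by_cases hz : w - w' = 0
  · exact Or.inl (sub_eq_zero.1 hz)
  · right
    -- Where `w - w'` is positive, so is `w`, as `w' ≥ 0`; this puts `Z` into `A`, and likewise `C`
    -- into `B`.
    obtain ⟨Z, C, hI, hZ, hC⟩ := exists_intertwining_of_dependence ht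
      (moments_eq_zero_of_sub (by rw [hw.sum_eq, hw'.sum_eq]) h) hz
    refine ⟨Z, fun i hi => ?_, C, fun i hi => ?_, hI⟩
    · by_contra hn
      have h1 := hZ i hi
      have h2 := hw'.nonneg i
      rw [Pi.sub_apply, hw.eq_zero i hn] at h1
      linarith
    · by_contra hn
      have h1 := hC i hi
      have h2 := hw.nonneg i
      rw [Pi.sub_apply, hw'.eq_zero i hn] at h1
      linarith

/-- One simplex has too few vertices to contain both halves. For distinct simplices, evaluate the
dependence on `A ∪ B` at an affine functional that separates their interiors: all terms have the
same sign, so the `2 d + 2` points lie on the separating hyperplane, which is impossible. -/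
theorem IsTriangulation.not_intertwining (ht : StrictMono t) (hT : IsTriangulation (2 * d) t T)
    {S S' : Finset (Fin m)} (hS : S ∈ T) (hS' : S' ∈ T) {A B : Finset (Fin m)} (hA : A ⊆ S)
    (hB : B ⊆ S') : ¬ Intertwining d A B := by
  intro hI
  have hne : S ≠ S' := by
    rintro rfl
    have := Finset.card_le_card (Finset.union_subset hA hB)
    rw [hI.card_union, hT.card_eq S hS] at this
    omega
  obtain ⟨l, u, hl, hl'⟩ := geometric_hahn_banach_open_open
    (convex_convexHull ℝ _).interior isOpen_interior (convex_convexHull ℝ _).interior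
    isOpen_interior (hT.disjoint_interiors S hS S' hS' hne)
  have hint : ∀ X ∈ T, (interior (realisation (2 * d) t X)).Nonempty := fun X hX =>
    interior_realisation_nonempty ht (hT.card_eq X hX).ge
  have hcl : ∀ X ∈ T, realisation (2 * d) t X ⊆ closure (interior (realisation (2 * d) t X)) :=
    fun X hX => by
      have hc : Convex ℝ (realisation (2 * d) t X) := convex_convexHull ℝ _
      rw [hc.closure_interior_eq_closure_of_nonempty_interior (hint X hX)]
      exact subset_closure
  have hle : ∀ x ∈ realisation (2 * d) t S, l x ≤ u := fun x hx =>
    closure_minimal (fun y hy => (hl y hy).le) (isClosed_le l.continuous continuous_const)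
      (hcl S hS hx)
  have hge : ∀ x ∈ realisation (2 * d) t S', u ≤ l x := fun x hx =>
    closure_minimal (fun y hy => (hl' y hy).le) (isClosed_le continuous_const l.continuous)
      (hcl S' hS' hx)
  obtain ⟨z, hz, hzA, hzB, hz0⟩ := hI.exists_dependence ht
  have hsum : ∑ i, z i * (l (momentPoint (2 * d) (t i)) - u) = 0 := by
    have h1 := congrArg l (moments_smul hz)
    have h2 := hz 0 (by omega)
    simp only [map_sum, map_smul, smul_eq_mul, map_zero] at h1
    simp only [pow_zero, mul_one] at h2
    simp only [mul_sub, Finset.sum_sub_distrib, ← Finset.sum_mul, h1, h2]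
    simp
  have hmem : ∀ (X : Finset (Fin m)), ∀ i ∈ X, momentPoint (2 * d) (t i) ∈ realisation (2 * d) t X :=
    fun X i hi => subset_convexHull ℝ _ ⟨i, hi, rfl⟩
  have hterm : ∀ i, z i * (l (momentPoint (2 * d) (t i)) - u) ≤ 0 := by
    intro i
    by_cases hiA : i ∈ A
    · exact mul_nonpos_of_nonneg_of_nonpos (hzA i hiA).le
        (by linarith [hle _ (hmem S i (hA hiA))])
    · by_cases hiB : i ∈ B
      · exact mul_nonpos_of_nonpos_of_nonneg (hzB i hiB).le
          (by linarith [hge _ (hmem S' i (hB hiB))])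
      · simp [hz0 i hiA hiB]
  have heq : ∀ i ∈ A ∪ B, l (momentPoint (2 * d) (t i)) = u := by
    intro i hi
    have h1 := (Finset.sum_eq_zero_iff_of_nonpos fun i _ => hterm i).1 hsum i (Finset.mem_univ i)
    have h2 : z i ≠ 0 := by
      rcases Finset.mem_union.1 hi with hi | hi
      · exact (hzA i hi).ne'
      · exact (hzB i hi).ne
    linarith [(mul_eq_zero.1 h1).resolve_left h2]
  have hl0 := eq_zero_of_const ht (δ := 2 * d) (F := A ∪ B) (by rw [hI.card_union]; omega)
    l.toLinearMap u heq
  have hl0' : ∀ x, l x = 0 := fun x => LinearMap.congr_fun hl0 x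
  obtain ⟨x, hx⟩ := hint S hS
  obtain ⟨y, hy⟩ := hint S' hS'
  have h1 := hl x hx
  have h2 := hl' y hy
  rw [hl0'] at h1 h2
  linarith

/-- A simplex that intertwines with another one does not lie in a facet. -/
theorem Intertwining.not_subset_facet (ht : StrictMono t) {A B : Finset (Fin m)}
    (hI : Intertwining d A B) {F : Set (Fin (2 * d) → ℝ)} (hF : IsFacet (2 * d) t F) :
    ¬ realisation (2 * d) t A ⊆ F := by
  intro hAF
  have hmem : ∀ i ∈ A, momentPoint (2 * d) (t i) ∈ F := fun i hi =>
    hAF (subset_convexHull ℝ _ ⟨i, hi, rfl⟩)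
  have hC : ∀ i, momentPoint (2 * d) (t i) ∈ cyclicPolytope (2 * d) t := fun i =>
    subset_convexHull ℝ _ ⟨i, rfl⟩
  obtain ⟨a, ha⟩ : A.Nonempty := Finset.card_pos.1 (by rw [hI.card_left]; omega)
  obtain ⟨l, rfl⟩ := hF.1 ⟨_, hmem a ha⟩
  set u := l (momentPoint (2 * d) (t a)) with hu
  have hle : ∀ i, l (momentPoint (2 * d) (t i)) ≤ u := fun i => (hmem a ha).2 _ (hC i)
  have hAu : ∀ i ∈ A, l (momentPoint (2 * d) (t i)) = u := fun i hi =>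
    le_antisymm (hle i) ((hmem i hi).2 _ (hC a))
  obtain ⟨z, hz, hzA, hzB, hz0⟩ := hI.exists_dependence ht
  have hsum : ∑ i, z i * (l (momentPoint (2 * d) (t i)) - u) = 0 := by
    have h1 := congrArg l (moments_smul hz)
    have h2 := hz 0 (by omega)
    simp only [map_sum, map_smul, smul_eq_mul, map_zero] at h1
    simp only [pow_zero, mul_one] at h2
    simp only [mul_sub, Finset.sum_sub_distrib, ← Finset.sum_mul, h1, h2]
    simp
  -- The functional is maximal on `A`, so only the terms of `B` remain; as their sum is zero, it is
  -- maximal on `B` too, and the face would have full dimension.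
  have hterm : ∀ i, 0 ≤ z i * (l (momentPoint (2 * d) (t i)) - u) := by
    intro i
    by_cases hiA : i ∈ A
    · simp [hAu i hiA]
    · by_cases hiB : i ∈ B
      · exact mul_nonneg_of_nonpos_of_nonpos (hzB i hiB).le (by linarith [hle i])
      · simp [hz0 i hiA hiB]
  have heq : ∀ i ∈ A ∪ B, l (momentPoint (2 * d) (t i)) = u := by
    intro i hi
    rcases Finset.mem_union.1 hi with hi | hi
    · exact hAu i hi
    · have h1 := (Finset.sum_eq_zero_iff_of_nonneg fun i _ => hterm i).1 hsum i (Finset.mem_univ i)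
      linarith [(mul_eq_zero.1 h1).resolve_left (hzB i hi).ne]
  have hspan : vectorSpan ℝ {x ∈ cyclicPolytope (2 * d) t | ∀ y ∈ cyclicPolytope (2 * d) t,
      l y ≤ l x} = ⊤ := by
    refine top_unique ?_
    rw [← vectorSpan_eq_top ht (δ := 2 * d) (F := A ∪ B) (by rw [hI.card_union]; omega)]
    refine vectorSpan_mono ℝ ?_
    rintro _ ⟨i, hi, rfl⟩
    refine ⟨hC i, fun y hy => ?_⟩
    simp only
    rw [heq i hi]
    exact (hmem a ha).2 y hy
  have := hF.2
  rw [hspan, finrank_top, Module.finrank_fin_fun] at this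
  omega

/-- Each `d`-simplex is contained in a simplex of `T` or intertwines with a simplex of `T`. -/
theorem IsTriangulation.subset_or_intertwining (ht : StrictMono t)
    (hT : IsTriangulation (2 * d) t T) {A : Finset (Fin m)} (hA : A.card = d + 1) :
    ∃ S ∈ T, A ⊆ S ∨ ∃ C ⊆ S, Intertwining d A C := by
  have hne : A.Nonempty := Finset.card_pos.1 (by omega)
  -- `S` is a simplex that contains the barycentre of `A`.
  obtain ⟨S, hS, hx⟩ := hT.exists_mem (isConvexWeight_uniform hne)
  obtain ⟨w', hw', h⟩ := mem_realisation_iff.1 hx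
  refine ⟨S, hS, ?_⟩
  rcases eq_or_exists_intertwining ht (isConvexWeight_uniform hne) hw' h.symm with he | he
  · left
    intro i hi
    by_contra hn
    have h1 := congrFun he i
    rw [hw'.eq_zero i hn] at h1
    simp only [hi, if_true, inv_eq_zero, Nat.cast_eq_zero] at h1
    omega
  · obtain ⟨Z, hZ, C, hC, hI⟩ := he
    refine Or.inr ⟨C, hC, ?_⟩
    rwa [Finset.eq_of_subset_of_card_le hZ (by rw [hI.card_left, hA])] at hI

/-- The simplices of `T` near a simplex of `T` in the direction of a vertex. -/
theorem IsTriangulation.exists_near (ht : StrictMono t) (hT : IsTriangulation (2 * d) t T)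
    {A S₀ : Finset (Fin m)} (hA : A.card = d + 1) (hS₀ : S₀ ∈ T) (hAS : A ⊆ S₀) {v : Fin m}
    (hv : v ∉ A) : ∃ S ∈ T, A ⊆ S ∧ (v ∈ S ∨ ∃ Z ⊆ insert v A, v ∈ Z ∧ ∃ C ⊆ S,
      Intertwining d Z C) := by
  classical
  have hne : A.Nonempty := Finset.card_pos.1 (by omega)
  have hun := isConvexWeight_uniform hne
  set w : Fin m → ℝ := fun i => if i ∈ A then (A.card : ℝ)⁻¹ else 0 with hwdef
  -- Weights of the point at ratio `ε` on the segment from the barycentre of `A` to the vertex `v`.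
  let p : ℝ → Fin m → ℝ := fun ε i => (1 - ε) * w i + ε * if i = v then 1 else 0
  have hp : ∀ ε ∈ Set.Ioo (0 : ℝ) 1, IsConvexWeight (insert v A) (p ε) := by
    rintro ε ⟨h0, h1⟩
    refine ⟨fun i => ?_, fun i hi => ?_, ?_⟩
    · refine add_nonneg (mul_nonneg (by linarith) (hun.nonneg i)) (mul_nonneg h0.le ?_)
      split_ifs <;> norm_num
    · simp only [Finset.mem_insert, not_or] at hi
      simp [p, hi.1, hun.eq_zero i hi.2]
    · simp only [p, Finset.sum_add_distrib, ← Finset.mul_sum, hun.sum_eq]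
      simp
  let y : ℝ → Fin (2 * d) → ℝ := fun ε => ∑ i, p ε i • momentPoint (2 * d) (t i)
  have hy : Continuous y := by
    refine continuous_finsetSum _ fun i _ => ?_
    have : Continuous fun ε => p ε i := by fun_prop
    exact this.smul continuous_const
  -- As `T` is finite, one simplex contains points of the segment arbitrarily close to the
  -- barycentre, hence the barycentre itself.
  obtain ⟨S, hS, hfr⟩ : ∃ S ∈ T, ∃ᶠ ε in nhdsWithin (0 : ℝ) (Set.Ioi 0),
      y ε ∈ realisation (2 * d) t S := by
    by_contra! hcon
    have h1 : ∀ᶠ ε in nhdsWithin (0 : ℝ) (Set.Ioi 0), ∀ S ∈ T,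
        y ε ∉ realisation (2 * d) t S := by
      rw [Filter.eventually_all_finset]
      exact hcon
    have h2 : ∀ᶠ ε in nhdsWithin (0 : ℝ) (Set.Ioi 0), ε ∈ Set.Ioo (0 : ℝ) 1 :=
      Ioo_mem_nhdsGT one_pos
    obtain ⟨ε, h3, h4⟩ := (h1.and h2).exists
    obtain ⟨S, hS, hx⟩ := hT.exists_mem (hp ε h4)
    exact h3 S hS hx
  have hy0 : y 0 ∈ realisation (2 * d) t S := by
    refine (isClosed_realisation S).mem_of_frequently_of_tendsto hfr ?_
    exact (hy.tendsto 0).mono_left nhdsWithin_le_nhds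
  have hAS' : A ⊆ S := by
    obtain ⟨w', hw', h⟩ := mem_realisation_iff.1 hy0
    have h0 : ∑ i, w i • momentPoint (2 * d) (t i) = y 0 := by simp [y, p]
    rcases eq_or_exists_intertwining ht hun hw' (h0.trans h.symm) with he | ⟨Z, hZ, C, hC, hI⟩
    · intro i hi
      by_contra hn
      have h1 := congrFun he i
      rw [hw'.eq_zero i hn] at h1
      simp only [hwdef, hi, if_true, inv_eq_zero, Nat.cast_eq_zero] at h1
      omega
    · exact absurd hI (hT.not_intertwining ht hS₀ hS (hZ.trans hAS) hC)
  refine ⟨S, hS, hAS', ?_⟩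
  obtain ⟨ε, hε, hε'⟩ := (hfr.and_eventually (Ioo_mem_nhdsGT one_pos)).exists
  obtain ⟨w', hw', h⟩ := mem_realisation_iff.1 hε
  rcases eq_or_exists_intertwining ht (hp ε hε') hw' h.symm with he | ⟨Z, hZ, C, hC, hI⟩
  · left
    by_contra hn
    have h1 := congrFun he v
    rw [hw'.eq_zero v hn] at h1
    simp only [p, hun.eq_zero v hv] at h1
    have := hε'.1
    simp at h1
    linarith
  · right
    refine ⟨Z, hZ, ?_, C, hC, hI⟩
    -- If `v ∉ Z`, then `Z ⊆ A ⊆ S₀` and `C ⊆ S` would intertwine inside `T`.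
    by_contra hn
    have hZA : Z ⊆ A := fun i hi => by
      rcases Finset.mem_insert.1 (hZ hi) with rfl | h
      · exact absurd hi hn
      · exact h
    exact hT.not_intertwining ht hS₀ hS (hZA.trans hAS) hC hI

end geometry

/-! ### Facets of cyclic polytopes -/

/-- At most `k` points of an interval of length `N ≥ 2 k` can be covered by `k` disjoint pairs of
neighbours. -/
theorem exists_disjoint_pairs (N k : ℕ) (A : Finset ℕ) (hA : A ⊆ Finset.range N)
    (hk : A.card ≤ k) (hN : 2 * k ≤ N) :
    ∃ P : Finset ℕ, P.card = k ∧ (∀ c ∈ P, c + 1 < N) ∧ (∀ c ∈ P, c + 1 ∉ P) ∧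
      ∀ a ∈ A, a ∈ P ∨ ∃ c ∈ P, a = c + 1 := by
  induction N using Nat.strong_induction_on generalizing k A with
  | _ N ih =>
    rcases hN.eq_or_lt with hN' | hN'
    · refine ⟨(Finset.range k).image (2 * ·), ?_, ?_, ?_, ?_⟩
      · rw [Finset.card_image_of_injective _ (fun a b h => by simpa using h), Finset.card_range]
      · simp only [Finset.mem_image, Finset.mem_range]
        rintro _ ⟨c, hc, rfl⟩
        omega
      · simp only [Finset.mem_image, Finset.mem_range]
        rintro _ ⟨c, hc, rfl⟩ ⟨c', hc', h⟩
        omega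
      · intro a ha
        have := Finset.mem_range.1 (hA ha)
        simp only [Finset.mem_image, Finset.mem_range]
        rcases Nat.even_or_odd' a with ⟨c, hc | hc⟩
        · exact Or.inl ⟨c, by omega, hc.symm⟩
        · exact Or.inr ⟨2 * c, ⟨c, by omega, rfl⟩, hc⟩
    -- There is spare room, so the last point is either covered by the pair `(N - 2, N - 1)` or
    -- dropped.
    · by_cases hlast : N - 1 ∈ A
      · have hkpos : 0 < k := (Finset.card_pos.2 ⟨_, hlast⟩).trans_le hk
        obtain ⟨P, hPc, hP1, hP2, hP3⟩ := ih (N - 2) (by omega) (k - 1) (A.filter (· < N - 2))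
          (fun a ha => Finset.mem_range.2 (Finset.mem_filter.1 ha).2) (by
            have : A.filter (· < N - 2) ⊆ A.erase (N - 1) := fun a ha => by
              obtain ⟨h1, h2⟩ := Finset.mem_filter.1 ha
              exact Finset.mem_erase.2 ⟨by omega, h1⟩
            have := Finset.card_le_card this
            rw [Finset.card_erase_of_mem hlast] at this
            omega) (by omega)
        have hnew : N - 2 ∉ P := fun h => by have := hP1 _ h; omega
        refine ⟨insert (N - 2) P, by rw [Finset.card_insert_of_notMem hnew]; omega, ?_, ?_, ?_⟩
        · intro c hc
          rcases Finset.mem_insert.1 hc with rfl | hc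
          · omega
          · have := hP1 c hc; omega
        · intro c hc hc'
          rcases Finset.mem_insert.1 hc with rfl | hc <;>
            rcases Finset.mem_insert.1 hc' with h | hc'
          · omega
          · have := hP1 _ hc'; omega
          · have := hP1 _ hc; omega
          · exact hP2 c hc hc'
        · intro a ha
          have := Finset.mem_range.1 (hA ha)
          by_cases ha2 : a < N - 2
          · rcases hP3 a (Finset.mem_filter.2 ⟨ha, ha2⟩) with h | ⟨c, hc, h⟩
            · exact Or.inl (Finset.mem_insert_of_mem h)
            · exact Or.inr ⟨c, Finset.mem_insert_of_mem hc, h⟩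
          · by_cases ha3 : a = N - 2
            · exact Or.inl (by simp [ha3])
            · exact Or.inr ⟨N - 2, by simp, by omega⟩
      · obtain ⟨P, hPc, hP1, hP2, hP3⟩ := ih (N - 1) (by omega) k A (fun a ha => by
            have h1 := Finset.mem_range.1 (hA ha)
            have : a ≠ N - 1 := by rintro rfl; exact hlast ha
            rw [Finset.mem_range]; omega) hk (by omega)
        exact ⟨P, hPc, fun c hc => by have := hP1 c hc; omega, hP2, hP3⟩

section facet

variable {m : ℕ} {t : Fin m → ℝ} {d : ℕ}

open Polynomial in
-- On the moment curve, polynomials of degree at most `2 d` are affine functionals. One that is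
-- nonnegative at all parameters supports the polytope, and `2 d` zeros give that many affinely
-- independent points in the face.
theorem isFacet_of_polynomial (ht : StrictMono t) (hd : 1 ≤ d) {q : ℝ[X]} (hq : q.natDegree ≤ 2 * d)
    (hpos : ∀ i, 0 ≤ q.eval (t i)) {G : Finset (Fin m)} (hG : G.card = 2 * d)
    (hzero : ∀ i ∈ G, q.eval (t i) = 0) (hne : ∃ i, q.eval (t i) ≠ 0) :
    ∃ F, IsFacet (2 * d) t F ∧ ∀ i ∈ G, momentPoint (2 * d) (t i) ∈ F := by
  -- Exposed faces are sets of maxima, so the sign is reversed; the constant coefficient becomes the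
  -- maximum.
  let l' : (Fin (2 * d) → ℝ) →ₗ[ℝ] ℝ :=
    ∑ k : Fin (2 * d), (-q.coeff (k + 1)) • LinearMap.proj k
  let l : (Fin (2 * d) → ℝ) →L[ℝ] ℝ := LinearMap.toContinuousLinearMap l'
  have hl : ∀ i, l (momentPoint (2 * d) (t i)) = q.coeff 0 - q.eval (t i) := by
    intro i
    have h1 : l (momentPoint (2 * d) (t i)) = l' (momentPoint (2 * d) (t i)) := rfl
    rw [h1, eval_eq_sum_range' (Nat.lt_succ_of_le hq), Finset.sum_range_succ', Finset.sum_range]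
    simp [l', momentPoint]
  have hC : ∀ i, momentPoint (2 * d) (t i) ∈ cyclicPolytope (2 * d) t := fun i =>
    subset_convexHull ℝ _ ⟨i, rfl⟩
  have hle : ∀ y ∈ cyclicPolytope (2 * d) t, l y ≤ q.coeff 0 := by
    intro y hy
    refine convexHull_min (t := {y | l y ≤ q.coeff 0}) ?_ ?_ hy
    · rintro _ ⟨i, rfl⟩
      have := hpos i
      simp only [Set.mem_ofPred_eq, hl]
      linarith
    · exact convex_halfSpace_le l.isLinear _
  have hGF : ∀ i ∈ G, momentPoint (2 * d) (t i) ∈ l.toExposed (cyclicPolytope (2 * d) t) := by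
    intro i hi
    refine ⟨hC i, fun y hy => ?_⟩
    rw [hl, hzero i hi, sub_zero]
    exact hle y hy
  obtain ⟨g, hg⟩ : G.Nonempty := Finset.card_pos.1 (by omega)
  refine ⟨_, ⟨ContinuousLinearMap.toExposed.isExposed (l := l), ?_⟩, hGF⟩
  have hl0 : l' ≠ 0 := by
    intro h
    obtain ⟨i, hi⟩ := hne
    have h1 := hl i
    have h2 := hl g
    have h3 : ∀ x, l x = 0 := fun x => LinearMap.congr_fun h x
    rw [h3] at h1 h2
    rw [hzero g hg] at h2
    exact hi (by linarith)
  have hker : Module.finrank ℝ (LinearMap.ker l') + 1 = 2 * d := by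
    have := Module.Dual.finrank_ker_add_one_of_ne_zero (f := l') hl0
    rwa [Module.finrank_fin_fun] at this
  refine le_antisymm ?_ ?_
  · refine (Nat.add_le_add_right (Submodule.finrank_mono ?_) 1).trans hker.le
    rw [vectorSpan, Submodule.span_le]
    rintro _ ⟨x, hx, y, hy, rfl⟩
    have h1 := hx.2 y hy.1
    have h2 := hy.2 x hx.1
    have h3 : l' (x - y) = 0 := by
      rw [map_sub, sub_eq_zero]
      exact le_antisymm h2 h1
    exact h3
  · have h1 := (affineIndependent_momentPoint (δ := 2 * d) ht (F := G) (by omega)).finrank_vectorSpan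
      (n := 2 * d - 1) (by rw [Fintype.card_coe]; omega)
    have h2 : 2 * d = (2 * d - 1) + 1 := by omega
    rw [← h1] at h2
    refine h2.le.trans (Nat.add_le_add_right (Submodule.finrank_mono (vectorSpan_mono ℝ ?_)) 1)
    rintro _ ⟨i, rfl⟩
    exact hGF i i.2

variable [NeZero m]

open Polynomial in
-- No parameter lies strictly between two neighbours, so the quadratic with these roots is
-- nonnegative at all parameters. For the pair of the last and the first parameter its sign is
-- reversed.
theorem exists_pair_polynomial (ht : StrictMono t) (c : Fin m) :
    ∃ q : ℝ[X], q.natDegree ≤ 2 ∧ (∀ i, 0 ≤ q.eval (t i)) ∧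
      ∀ i, q.eval (t i) = 0 ↔ i = c ∨ i = c + 1 := by
  have hdeg : ∀ a b : ℝ, ((X - C a) * (X - C b)).natDegree ≤ 2 := fun a b => by
    refine natDegree_mul_le.trans ?_
    simp
  by_cases hc : c.val + 1 < m
  · have hcv : (c + 1).val = c.val + 1 := Fin.val_add_one_of_lt' hc
    refine ⟨_, hdeg (t c) (t (c + 1)), fun i => ?_, fun i => ?_⟩
    · simp only [eval_mul, eval_sub, eval_X, eval_C]
      rcases le_or_gt i c with h | h
      · have h' : i ≤ c + 1 := by rw [Fin.le_def] at h ⊢; omega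
        exact mul_nonneg_of_nonpos_of_nonpos (by linarith [ht.monotone h])
          (by linarith [ht.monotone h'])
      · have h' : c + 1 ≤ i := by rw [Fin.lt_def] at h; rw [Fin.le_def]; omega
        exact mul_nonneg (by linarith [ht.monotone h.le]) (by linarith [ht.monotone h'])
    · simp only [eval_mul, eval_sub, eval_X, eval_C, mul_eq_zero, sub_eq_zero,
        ht.injective.eq_iff]
  · have hc0 : c + 1 = 0 := by
      have h := residue_add_one (m := m) c.val
      rw [residue_val] at h
      rw [← h, ← residue_zero, residue_eq_iff]
      have := c.isLt
      exact ⟨1, by omega⟩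
    refine ⟨(X - C (t 0)) * (C (t c) - X), ?_, fun i => ?_, fun i => ?_⟩
    · have : (X - C (t 0)) * (C (t c) - X) = -((X - C (t 0)) * (X - C (t c))) := by ring
      rw [this, natDegree_neg]
      exact hdeg _ _
    · simp only [eval_mul, eval_sub, eval_X, eval_C]
      have h1 : (0 : Fin m) ≤ i := Fin.zero_le i
      have h2 : i ≤ c := by rw [Fin.le_def]; have := i.isLt; omega
      exact mul_nonneg (by linarith [ht.monotone h1]) (by linarith [ht.monotone h2])
    · simp only [eval_mul, eval_sub, eval_X, eval_C, mul_eq_zero, sub_eq_zero,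
        ht.injective.eq_iff, hc0]
      rw [or_comm, eq_comm (a := c)]

/-- A `d`-simplex with two cyclically adjacent vertices lies in a facet. -/
theorem exists_facet_of_adjacent (ht : StrictMono t) (hd : 1 ≤ d) (hm : 2 * d + 1 ≤ m)
    {A : Finset (Fin m)} (hA : A.card = d + 1) {x : Fin m} (hx : x ∈ A) (hx' : x + 1 ∈ A) :
    ∃ F, IsFacet (2 * d) t F ∧ realisation (2 * d) t A ⊆ F := by
  classical
  -- The labels are rotated so that `x` and `x + 1` take the last positions, `m - 2` and `m - 1`.
  let f : ℕ → Fin m := fun p => residue m (x.val + 2 + p)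
  have hf : ∀ p < m, ∀ p' < m, f p = f p' → p = p' := by
    intro p hp p' hp' h
    have h1 := residue_eq_iff.1 h
    rw [show (x.val + 2 + p : ℤ) - (x.val + 2 + p') = p - p' by ring] at h1
    have := Int.eq_zero_of_abs_lt_dvd h1 (by rw [abs_lt]; omega)
    omega
  have hfs : ∀ p, f (p + 1) = f p + 1 := by
    intro p
    simp only [f]
    rw [← residue_add_one]
    push_cast
    ring_nf
  have hfx : f (m - 2) = x := by
    conv_rhs => rw [← residue_val x]
    simp only [f]
    rw [residue_eq_iff]
    exact ⟨1, by omega⟩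
  have hfx' : f (m - 1) = x + 1 := by
    rw [← hfx, ← hfs]; congr 1; omega
  have hfsurj : ∀ y, ∃ p < m, f p = y := by
    intro y
    have : (Finset.range m).image f = Finset.univ := by
      rw [← Finset.card_eq_iff_eq_univ, Finset.card_image_of_injOn, Finset.card_range,
        Fintype.card_fin]
      intro p hp p' hp' h
      exact hf p (by simpa using hp) p' (by simpa using hp') h
    have hy := Finset.mem_univ y
    rw [← this] at hy
    simpa using hy
  -- The other `d - 1` vertices are covered by `d - 1` disjoint neighbour pairs; with the pair `x, x
  -- + 1` this is a facet by Gale's criterion.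
  obtain ⟨P, hPc, hP1, hP2, hP3⟩ := exists_disjoint_pairs (m - 2) (d - 1)
    ((Finset.range (m - 2)).filter fun p => f p ∈ A) (Finset.filter_subset _ _) (by
      have hsub : (insert (m - 1) (insert (m - 2)
          ((Finset.range (m - 2)).filter fun p => f p ∈ A))).image f ⊆ A := by
        intro y hy
        obtain ⟨p, hp, rfl⟩ := Finset.mem_image.1 hy
        simp only [Finset.mem_insert, Finset.mem_filter, Finset.mem_range] at hp
        rcases hp with rfl | rfl | hp
        · rwa [hfx']
        · rwa [hfx]
        · exact hp.2
      have h1 := Finset.card_le_card hsub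
      rw [Finset.card_image_of_injOn, Finset.card_insert_of_notMem, Finset.card_insert_of_notMem,
        hA] at h1
      · omega
      · simp
      · simp; omega
      · intro p hp p' hp' h
        simp only [Finset.coe_insert, Finset.coe_filter, Finset.mem_range, Set.mem_insert_iff,
          Set.mem_ofPred_eq] at hp hp'
        exact hf p (by omega) p' (by omega) h) (by omega)
  let P' := insert (m - 2) P
  have hnew : m - 2 ∉ P := fun h => by have := hP1 _ h; omega
  have hP'c : P'.card = d := by rw [Finset.card_insert_of_notMem hnew]; omega
  have hP'1 : ∀ c ∈ P', c + 1 < m := by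
    intro c hc
    rcases Finset.mem_insert.1 hc with rfl | hc
    · omega
    · have := hP1 c hc; omega
  have hP'2 : ∀ c ∈ P', c + 1 ∉ P' := by
    intro c hc hc'
    rcases Finset.mem_insert.1 hc with rfl | hc <;> rcases Finset.mem_insert.1 hc' with h | hc'
    · omega
    · have := hP1 _ hc'; omega
    · have := hP1 _ hc; omega
    · exact hP2 c hc hc'
  let U := P' ∪ P'.image (· + 1)
  have hUm : ∀ p ∈ U, p < m := by
    intro p hp
    rcases Finset.mem_union.1 hp with hp | hp
    · have := hP'1 p hp; omega
    · obtain ⟨c, hc, rfl⟩ := Finset.mem_image.1 hp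
      exact hP'1 c hc
  have hUc : U.card = 2 * d := by
    rw [Finset.card_union_of_disjoint, Finset.card_image_of_injective _ (add_left_injective 1), hP'c]
    · ring
    · rw [Finset.disjoint_left]
      intro p hp hp'
      obtain ⟨c, hc, rfl⟩ := Finset.mem_image.1 hp'
      exact hP'2 c hc hp
  choose q hq1 hq2 hq3 using exists_pair_polynomial ht
  have hGc : (U.image f).card = 2 * d := by
    rw [Finset.card_image_of_injOn, hUc]
    intro p hp p' hp' h
    exact hf p (hUm p hp) p' (hUm p' hp') h
  have hzero : ∀ i, (∏ c ∈ P', q (f c)).eval (t i) = 0 ↔ i ∈ U.image f := by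
    intro i
    rw [Polynomial.eval_prod, Finset.prod_eq_zero_iff]
    simp only [hq3, Finset.mem_image, U, Finset.mem_union]
    constructor
    · rintro ⟨c, hc, h | h⟩
      · exact ⟨c, Or.inl hc, h.symm⟩
      · exact ⟨c + 1, Or.inr ⟨c, hc, rfl⟩, by rw [hfs, h]⟩
    · rintro ⟨p, hp | ⟨c, hc, rfl⟩, rfl⟩
      · exact ⟨p, hp, Or.inl rfl⟩
      · exact ⟨c, hc, Or.inr (hfs c)⟩
  obtain ⟨F, hF, hGF⟩ := isFacet_of_polynomial ht hd (q := ∏ c ∈ P', q (f c)) (by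
      refine (Polynomial.natDegree_prod_le _ _).trans ?_
      refine (Finset.sum_le_card_nsmul _ _ 2 fun c _ => hq1 _).trans ?_
      rw [hP'c, smul_eq_mul, mul_comm]) (fun i => by
      rw [Polynomial.eval_prod]
      exact Finset.prod_nonneg fun c _ => hq2 _ _) hGc (fun i hi => (hzero i).2 hi) (by
      by_contra! hcon
      have : U.image f = Finset.univ := by
        ext i; simp only [Finset.mem_univ, iff_true]; exact (hzero i).1 (hcon i)
      rw [this, Finset.card_univ, Fintype.card_fin] at hGc
      omega)
  refine ⟨F, hF, ?_⟩
  have hconv : Convex ℝ F := hF.1.convex (convex_convexHull ℝ _)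
  refine convexHull_min ?_ hconv
  rintro _ ⟨i, hi, rfl⟩
  refine hGF i ?_
  obtain ⟨p, hp, rfl⟩ := hfsurj i
  refine Finset.mem_image_of_mem f ?_
  by_cases hp2 : p < m - 2
  · rcases hP3 p (by simp [hp2]; exact hi) with h | ⟨c, hc, rfl⟩
    · simp [U, P', h]
    · exact Finset.mem_union_right _ (Finset.mem_image_of_mem _ (Finset.mem_insert_of_mem hc))
  · by_cases hp3 : p = m - 2
    · simp [U, P', hp3]
    · exact Finset.mem_union_right _ (Finset.mem_image.2 ⟨m - 2, by simp [P'], by omega⟩)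

end facet

/-! ### Separated sequences and arcs -/

/-- A periodic sequence that enumerates a subset of `ℤ / m` without adjacent elements. -/
structure IsSep (D m : ℕ) (a : ℤ → ℤ) : Prop where
  add_period : ∀ j, a (j + D) = a j + m
  two_le : ∀ j, a j + 2 ≤ a (j + 1)

/-- The indicator of a residue class of indices. -/
def bump {D : ℕ} (k : ZMod D) (j : ℤ) : ℤ := if (j : ZMod D) = k then 1 else 0

section bump

variable {D : ℕ}

theorem bump_add_period (k : ZMod D) (j : ℤ) : bump k (j + D) = bump k j := by
  simp [bump]

theorem bump_nonneg (k : ZMod D) (j : ℤ) : 0 ≤ bump k j := by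
  unfold bump; split_ifs <;> norm_num

theorem bump_le_one (k : ZMod D) (j : ℤ) : bump k j ≤ 1 := by
  unfold bump; split_ifs <;> norm_num

theorem bump_cases (k : ZMod D) (j : ℤ) : ((j : ZMod D) = k ∧ bump k j = 1) ∨
    ((j : ZMod D) ≠ k ∧ bump k j = 0) := by
  unfold bump; split_ifs with h <;> simp [h]

theorem cast_add_one_ne (hD : 2 ≤ D) (j : ℤ) : ((j + 1 : ℤ) : ZMod D) ≠ (j : ZMod D) := by
  have : Fact (1 < D) := ⟨hD⟩
  simp

end bump

namespace IsSep

variable {D m : ℕ} {a b : ℤ → ℤ}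

theorem isCyclicSeq (ha : IsSep D m a) : IsCyclicSeq D m a :=
  ⟨strictMono_int_of_lt_succ fun j => by have := ha.two_le j; omega, ha.add_period⟩

theorem add_const (ha : IsSep D m a) (c : ℤ) : IsSep D m fun j => a j + c :=
  ⟨fun j => by rw [ha.add_period]; ring, fun j => by have := ha.two_le j; omega⟩

theorem shift (ha : IsSep D m a) (k : ℤ) : IsSep D m fun j => a (j + k) :=
  ⟨fun j => by rw [← ha.add_period]; congr 1; ring, fun j => by
    have := ha.two_le (j + k); rwa [add_right_comm] at this⟩

theorem of_interleaved (ha : IsCyclicSeq D m a) (h1 : ∀ j, a j < b j) (h2 : ∀ j, b j < a (j + 1)) :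
    IsSep D m a :=
  ⟨ha.add_period, fun j => by have := h1 j; have := h2 j; omega⟩

variable [NeZero m]

theorem succ_notMem (ha : IsSep D m a) (hD : 0 < D) {x : Fin m} (hx : x ∈ supp D m a) :
    x + 1 ∉ supp D m a := by
  obtain ⟨j, rfl⟩ := (ha.isCyclicSeq.mem_supp hD).1 hx
  rw [← residue_add_one, ha.isCyclicSeq.residue_mem_supp hD]
  rintro ⟨k, hk⟩
  have h1 : j < k := ha.isCyclicSeq.strictMono.lt_iff_lt.1 (by omega)
  have h2 := ha.isCyclicSeq.strictMono.monotone (show j + 1 ≤ k by omega)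
  have := ha.two_le j
  omega

theorem of_succ_notMem (ha : IsCyclicSeq D m a) (hD : 0 < D)
    (h : ∀ x ∈ supp D m a, x + 1 ∉ supp D m a) : IsSep D m a := by
  refine ⟨ha.add_period, fun j => ?_⟩
  have h1 := ha.strictMono (show j < j + 1 by omega)
  by_contra hlt
  have h2 := h _ ((ha.residue_mem_supp hD).2 ⟨j, rfl⟩)
  rw [← residue_add_one, ha.residue_mem_supp hD] at h2
  exact h2 ⟨j + 1, by omega⟩

end IsSep

theorem Intertwining.succ_notMem {d m : ℕ} [NeZero m] {A B : Finset (Fin m)}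
    (h : Intertwining d A B) {x : Fin m} (hx : x ∈ A) : x + 1 ∉ A := by
  obtain ⟨a, b, ha, hb, rfl, rfl, h1, h2⟩ := h.exists_isCyclicSeq
  exact (IsSep.of_interleaved ha h1 h2).succ_notMem (by omega) hx

section arcs

variable {d m : ℕ} [NeZero m] {t : Fin m → ℝ} {T : Finset (Finset (Fin m))}

theorem exists_isSep {D : ℕ} (hD : 0 < D) {A : Finset (Fin m)} (hA : A.card = D)
    (h : ∀ x ∈ A, x + 1 ∉ A) : ∃ a, IsSep D m a ∧ supp D m a = A := by
  obtain ⟨a, ha, rfl⟩ := exists_isCyclicSeq hD A hA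
  exact ⟨a, IsSep.of_succ_notMem ha hD h, rfl⟩

/-- A separated simplex intertwines with its translate by one, so it lies in no facet; adjacent
vertices give a facet. -/
theorem isArc_iff (ht : StrictMono t) (hd : 1 ≤ d) (hm : 2 * d + 1 ≤ m) {A : Finset (Fin m)} :
    IsArc d t T A ↔ (A.card = d + 1 ∧ ∃ S ∈ T, A ⊆ S) ∧ ∀ x ∈ A, x + 1 ∉ A := by
  refine and_congr_right fun h => ⟨fun hF x hx hx' => hF ?_, fun hs => ?_⟩
  · exact exists_facet_of_adjacent ht hd hm h.1 hx hx'
  · rintro ⟨F, hF, hAF⟩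
    obtain ⟨a, ha, rfl⟩ := exists_isSep (by omega) h.1 hs
    exact (ha.isCyclicSeq.intertwining (b := fun j => a j + 1) (fun j => by simp)
      (fun j => by have := ha.two_le j; omega)).not_subset_facet ht hF hAF

/-- A periodic sequence that enumerates a `d`-arc of `T`. -/
structure IsArcSeq (d : ℕ) (T : Finset (Finset (Fin m))) (a : ℤ → ℤ) : Prop where
  isSep : IsSep (d + 1) m a
  exists_mem : ∃ S ∈ T, supp (d + 1) m a ⊆ S

namespace IsArcSeq

variable {a b : ℤ → ℤ}

theorem isCyclicSeq (ha : IsArcSeq d T a) : IsCyclicSeq (d + 1) m a := ha.isSep.isCyclicSeq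

theorem shift (ha : IsArcSeq d T a) (k : ℤ) : IsArcSeq d T fun j => a (j + k) :=
  ⟨ha.isSep.shift k, by rw [ha.isCyclicSeq.supp_shift (by omega)]; exact ha.exists_mem⟩

theorem isArc (ht : StrictMono t) (hd : 1 ≤ d) (hm : 2 * d + 1 ≤ m) (ha : IsArcSeq d T a) :
    IsArc d t T (supp (d + 1) m a) :=
  (isArc_iff ht hd hm).2 ⟨⟨ha.isCyclicSeq.card_supp, ha.exists_mem⟩,
    fun _ hx => ha.isSep.succ_notMem (by omega) hx⟩

/-- Arcs of a triangulation are not intertwining. -/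
theorem not_interleaved (ht : StrictMono t) (hT : IsTriangulation (2 * d) t T)
    (ha : IsArcSeq d T a) (hb : IsArcSeq d T b) (h1 : ∀ j, a j < b j) :
    ¬ ∀ j, b j < a (j + 1) := by
  intro h2
  obtain ⟨S, hS, hAS⟩ := ha.exists_mem
  obtain ⟨S', hS', hBS⟩ := hb.exists_mem
  exact hT.not_intertwining ht hS hS' hAS hBS (ha.isCyclicSeq.intertwining h1 h2)

end IsArcSeq

theorem exists_isArcSeq (ht : StrictMono t) (hd : 1 ≤ d) (hm : 2 * d + 1 ≤ m)
    {A : Finset (Fin m)} (hA : IsArc d t T A) : ∃ a, IsArcSeq d T a ∧ supp (d + 1) m a = A := by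
  obtain ⟨⟨h1, h2⟩, h3⟩ := (isArc_iff ht hd hm).1 hA
  obtain ⟨a, ha, rfl⟩ := exists_isSep (by omega) h1 h3
  exact ⟨a, ⟨ha, h2⟩, rfl⟩

/-- A separated `(d + 1)`-simplex of `T` is interior. -/
theorem isInteriorSimplex_of_isSep (ht : StrictMono t) (hd : 1 ≤ d) (hm : 2 * d + 1 ≤ m)
    {x : ℤ → ℤ} (hx : IsSep (d + 2) m x) {S : Finset (Fin m)} (hS : S ∈ T)
    (hxS : supp (d + 2) m x ⊆ S) : IsInteriorSimplex d t T (supp (d + 2) m x) := by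
  refine ⟨⟨hx.isCyclicSeq.card_supp, S, hS, hxS⟩, fun v hv => (isArc_iff ht hd hm).2 ⟨⟨?_, S, hS,
    (Finset.erase_subset _ _).trans hxS⟩, fun y hy hy' => ?_⟩⟩
  · rw [Finset.card_erase_of_mem hv, hx.isCyclicSeq.card_supp]; omega
  · exact hx.succ_notMem (by omega) (Finset.mem_of_mem_erase hy) (Finset.mem_of_mem_erase hy')

/-- Moving an entry of an arc up by one gives an arc, or all other entries of it, or some of them,
can be moved down by one, if `T` has no interior `(d + 1)`-simplices. -/
theorem IsArcSeq.bump_or (ht : StrictMono t) (hd : 1 ≤ d) (hm : 2 * d + 1 ≤ m)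
    (hT : IsTriangulation (2 * d) t T) (hint : ¬ ∃ A, IsInteriorSimplex d t T A)
    {a : ℤ → ℤ} (ha : IsArcSeq d T a) {k : ZMod (d + 1)}
    (hak : IsSep (d + 1) m fun j => a j + bump k j) :
    (IsArcSeq d T fun j => a j + bump k j) ∨ ∀ b, IsSep (d + 1) m b →
      (∀ j, a j - 1 ≤ b j ∧ b j ≤ a j) → (∀ j : ℤ, (j : ZMod (d + 1)) = k → b j = a j) →
      IsArcSeq d T b := by
  obtain ⟨i, rfl⟩ : ∃ i : ℤ, (i : ZMod (d + 1)) = k := ZMod.intCast_surjective k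
  have hac := ha.isCyclicSeq
  have hakc := hak.isCyclicSeq
  have hii : bump (i : ZMod (d + 1)) i = 1 := by simp [bump]
  obtain ⟨S₀, hS₀, hAS₀⟩ := ha.exists_mem
  have hsupp : supp (d + 1) m (fun j => a j + bump (i : ZMod (d + 1)) j) ⊆
      insert (residue m (a i + 1)) (supp (d + 1) m a) := by
    intro x hx
    obtain ⟨j, rfl⟩ := (hakc.mem_supp (by omega)).1 hx
    rcases bump_cases (i : ZMod (d + 1)) j with ⟨h1, h2⟩ | ⟨h1, h2⟩
    · rw [h2]
      obtain ⟨q, hq⟩ := (ZMod.intCast_eq_intCast_iff_dvd_sub i j (d + 1)).1 h1.symm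
      rw [show j = i + (d + 1 : ℕ) * q by linear_combination hq, hac.add_mul_period]
      refine Finset.mem_insert.2 (Or.inl (residue_eq_iff.2 ⟨q, by ring⟩))
    · rw [h2, add_zero]
      exact Finset.mem_insert_of_mem ((hac.residue_mem_supp (by omega)).2 ⟨j, rfl⟩)
  have hnotMem : residue m (a i + 1) ∉ supp (d + 1) m a := by
    rw [residue_add_one]
    exact ha.isSep.succ_notMem (by omega) ((hac.residue_mem_supp (by omega)).2 ⟨i, rfl⟩)
  -- The candidate is a simplex of `T` on `A` near the direction of the new vertex `a i + 1`. If it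
  -- contains this vertex, then `a + e_i` is an arc.
  obtain ⟨S, hS, hAS, h | ⟨Z, hZ, hvZ, C, hC, hI⟩⟩ :=
    hT.exists_near ht hac.card_supp hS₀ hAS₀ hnotMem
  · exact Or.inl ⟨hak, S, hS, hsupp.trans (Finset.insert_subset h hAS)⟩
  right
  have hiZ : residue m (a i) ∉ Z := fun hn =>
    hI.succ_notMem hn (by rwa [← residue_add_one])
  -- `Z` contains `a i + 1` and hence not its neighbour `a i`, so it consists of the other entries
  -- of `a` and `a i + 1`.
  have hZeq : Z = supp (d + 1) m (fun j => a j + bump (i : ZMod (d + 1)) j) := by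
    symm
    refine Finset.eq_of_subset_of_card_le (fun x hx => ?_)
      (by rw [hI.card_left, hakc.card_supp])
    by_contra hxZ
    have h1 : Z ⊆ (insert (residue m (a i + 1)) (supp (d + 1) m a)).erase (residue m (a i)) :=
      fun y hy => Finset.mem_erase.2 ⟨fun h => hiZ (h ▸ hy), hZ hy⟩
    have h2 : residue m (a i) ∈ insert (residue m (a i + 1)) (supp (d + 1) m a) :=
      Finset.mem_insert_of_mem ((hac.residue_mem_supp (by omega)).2 ⟨i, rfl⟩)
    have h3 := Finset.eq_of_subset_of_card_le h1 (by
      rw [Finset.card_erase_of_mem h2, Finset.card_insert_of_notMem hnotMem, hac.card_supp,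
        hI.card_left]; omega)
    rw [h3] at hxZ
    refine hxZ (Finset.mem_erase.2 ⟨?_, hsupp hx⟩)
    rintro rfl
    have := hak.succ_notMem (by omega) hx
    rw [← residue_add_one] at this
    exact this ((hakc.residue_mem_supp (by omega)).2 ⟨i, by rw [hii]⟩)
  subst hZeq
  obtain ⟨z, c, hz, hc, hzs, rfl, h1, h2⟩ := hI.exists_isCyclicSeq
  obtain ⟨q, hq⟩ := hz.exists_shift hakc (by omega) hzs
  obtain ⟨c, hc, hCS, h1, h2⟩ : ∃ c, IsCyclicSeq (d + 1) m c ∧ supp (d + 1) m c ⊆ S ∧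
      (∀ j, a j + bump (i : ZMod (d + 1)) j < c j) ∧
      ∀ j, c j < a (j + 1) + bump (i : ZMod (d + 1)) (j + 1) := by
    refine ⟨fun j => c (j + q), hc.shift q, by rwa [hc.supp_shift (by omega)], fun j => ?_,
      fun j => ?_⟩
    · have := congrFun hq j
      rw [this]
      exact h1 _
    · have := congrFun hq (j + 1)
      rw [this, add_right_comm]
      exact h2 _
  have hcsep : IsSep (d + 1) m c := by
    refine IsSep.of_interleaved (b := fun j => a (j + 1) + bump (i : ZMod (d + 1)) (j + 1)) hc h2
      fun j => h1 (j + 1)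
  have hcongr : ∀ j : ℤ, ∃ r s : ℤ, 0 ≤ r ∧ r < d + 1 ∧ j = i + r + (d + 1 : ℕ) * s := by
    intro j
    have hpos : (0 : ℤ) < (d + 1 : ℕ) := by positivity
    exact ⟨(j - i) % (d + 1 : ℕ), (j - i) / (d + 1 : ℕ), Int.emod_nonneg _ hpos.ne', by
      have := Int.emod_lt_of_pos (j - i) hpos; push_cast at this ⊢; exact this, by
      have := Int.emod_add_mul_ediv (j - i) (d + 1 : ℕ); linarith⟩
  have hbump : ∀ r : ℤ, 0 < r → r < d + 1 → bump (i : ZMod (d + 1)) (i + r) = 0 := by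
    intro r hr hr'
    rcases bump_cases (i : ZMod (d + 1)) (i + r) with ⟨h, -⟩ | ⟨-, h⟩
    · have := Int.le_of_dvd (by simpa using hr)
        ((ZMod.intCast_eq_intCast_iff_dvd_sub i (i + r) (d + 1)).1 h.symm)
      push_cast at this
      omega
    · exact h
  -- The interlacing of `a + e_i` and `c` allows `c (i - 1) ≤ a i`. If this were strict, `a` itself
  -- would be interlaced with `c`, and both lie in `S`.
  have hci : c (i - 1) = a i := by
    have hlt := h2 (i - 1)
    rw [sub_add_cancel, hii] at hlt
    by_contra hne
    refine hT.not_intertwining ht hS hS hAS hCS (hac.intertwining (b := c) (fun j => ?_) fun j => ?_)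
    · have := h1 j; have := bump_nonneg (i : ZMod (d + 1)) j; omega
    · have := h2 j
      obtain ⟨r, s, hr0, hr, he⟩ := hcongr (j + 1)
      rcases hr0.eq_or_lt with rfl | hr0
      · rw [show j = i - 1 + (d + 1 : ℕ) * s by linarith, hc.add_mul_period,
          show i - 1 + (d + 1 : ℕ) * s + 1 = i + (d + 1 : ℕ) * s by ring, hac.add_mul_period]
        omega
      · have hb := hbump r hr0 hr
        rw [he] at this
        have e : bump (i : ZMod (d + 1)) (i + r + (d + 1 : ℕ) * s) =
            bump (i : ZMod (d + 1)) (i + r) := by simp [bump]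
        rw [e, hb] at this
        rw [he]
        omega
  -- A wider gap below `a (i + r)` would give an interior simplex in `S`.
  have hcr : ∀ r : ℤ, 0 < r → r < d + 1 → c (i + r - 1) = a (i + r) - 1 := by
    intro r hr0 hr
    have hlt := h2 (i + r - 1)
    rw [sub_add_cancel, hbump r hr0 hr] at hlt
    by_contra hne
    obtain ⟨r, rfl⟩ := Int.eq_ofNat_of_zero_le hr0.le
    -- The `d + 2` entries `c (i - 1), …, c (i + r - 1), a (i + r), …, a (i + d)`. The junction is
    -- separated as `c (i + r - 1) ≤ a (i + r) - 2`, and the end of the period as `c (i - 1) = a i`.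
    let x : ℕ → ℤ := fun p => if p ≤ r then c (i + p - 1) else a (i + p - 1)
    have hx : IsSep (d + 2) m (periodicExtend (d + 2) m x) := by
      refine ⟨periodicExtend_add_period (by omega) m x, periodicExtend_gap (by omega) x 2
        (fun p hp => ?_) ?_⟩
      · have e1 := hcsep.two_le (i + p - 1)
        have e2 := ha.isSep.two_le (i + p - 1)
        rw [sub_add_cancel] at e1 e2
        simp only [x]
        push_cast
        rw [show i + ((p : ℤ) + 1) - 1 = i + p by ring]
        rcases lt_trichotomy p r with h | rfl | h
        · rw [if_pos h.le, if_pos (by omega)]; exact e1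
        · rw [if_pos le_rfl, if_neg (by omega)]
          omega
        · rw [if_neg (by omega), if_neg (by omega)]; exact e2
      · simp only [x, Nat.zero_le, if_true, Nat.cast_zero, add_zero, hci]
        rw [if_neg (by omega), ← hac.add_period, show i + ((d + 2 - 1 : ℕ) : ℤ) - 1 = i + d by
          push_cast; omega]
        have := ha.isSep.two_le (i + d)
        push_cast
        rwa [← add_assoc]
    refine hint ⟨_, isInteriorSimplex_of_isSep ht hd hm hx hS fun y hy => ?_⟩
    simp only [supp, Finset.mem_image, Finset.mem_range] at hy
    obtain ⟨p, hp, rfl⟩ := hy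
    rw [periodicExtend_natCast m x hp]
    simp only [x]
    split_ifs
    · exact hCS ((hc.residue_mem_supp (by omega)).2 ⟨_, rfl⟩)
    · exact hAS ((hac.residue_mem_supp (by omega)).2 ⟨_, rfl⟩)
  intro b hb hab hbi
  refine ⟨hb, S, hS, fun y hy => ?_⟩
  obtain ⟨j, rfl⟩ := (hb.isCyclicSeq.mem_supp (by omega)).1 hy
  by_cases hj : b j = a j
  · rw [hj]
    exact hAS ((hac.residue_mem_supp (by omega)).2 ⟨j, rfl⟩)
  · obtain ⟨r, s, hr0, hr, he⟩ := hcongr j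
    have hr0 : 0 < r := by
      refine lt_of_le_of_ne hr0 ?_
      rintro rfl
      exact hj (hbi j (by rw [he]; simp))
    -- `S` contains each entry of `a` and, away from the class of `i`, also each entry lowered by
    -- one.
    have : b j = c (i + r - 1 + (d + 1 : ℕ) * s) := by
      rw [hc.add_mul_period, hcr r hr0 hr]
      have := hab j
      have e : a j = a (i + r) + m * s := by rw [he, hac.add_mul_period]
      omega
    rw [this]
    exact hCS ((hc.residue_mem_supp (by omega)).2 ⟨_, rfl⟩)

end arcs

/-! ### Interior simplices give oriented cycles -/

theorem exists_sign_change {f : ℤ → ℤ} (hf : ∀ k, f k + 1 ≤ f (k + 1)) :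
    ∃ k, f k ≤ 0 ∧ 0 < f (k + 1) := by
  have hmono : StrictMono f := strictMono_int_of_lt_succ fun k => by have := hf k; omega
  have hup : ∀ i : ℕ, f 0 + i ≤ f i := by
    intro i
    induction i with
    | zero => simp
    | succ i ih => have := hf i; push_cast; omega
  have hdown : ∀ i : ℕ, f (-i) ≤ f 0 - i := by
    intro i
    induction i with
    | zero => simp
    | succ i ih =>
      have := hf (-(i + 1 : ℕ))
      rw [show -((i + 1 : ℕ) : ℤ) + 1 = -i by push_cast; ring] at this
      push_cast at *
      omega
  obtain ⟨k, hk, hkmax⟩ := Int.exists_greatest_of_bdd (P := fun k => f k ≤ 0)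
    ⟨(f 0).natAbs, fun z hz => by
      by_contra! h
      have := hmono h
      have := hup (f 0).natAbs
      omega⟩ ⟨-((f 0).natAbs : ℤ), by have := hdown (f 0).natAbs; omega⟩
  refine ⟨k, hk, ?_⟩
  by_contra! h
  have := hkmax _ h
  omega

section cycles

variable {d m : ℕ} [NeZero m] {t : Fin m → ℝ} {T : Finset (Finset (Fin m))} {a b : ℤ → ℤ}

/-- In sequences, `(A - 1) ≀ B` becomes `a j ≤ b j ≤ a (j + 1) - 2`;
`Intertwining.exists_of_shiftDown` is the converse. -/
theorem intertwining_shiftDown (ha : IsCyclicSeq (d + 1) m a) (h1 : ∀ j, a j ≤ b j)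
    (h2 : ∀ j, b j + 2 ≤ a (j + 1)) :
    Intertwining d (shiftDown (supp (d + 1) m a)) (supp (d + 1) m b) := by
  rw [← supp_sub_one]
  exact (ha.add_const (-1)).intertwining (fun j => by have := h1 j; omega)
    (fun j => by have := h2 j; omega)

theorem Intertwining.exists_of_shiftDown (ha : IsCyclicSeq (d + 1) m a) {B : Finset (Fin m)}
    (h : Intertwining d (shiftDown (supp (d + 1) m a)) B) :
    ∃ b, IsCyclicSeq (d + 1) m b ∧ supp (d + 1) m b = B ∧ (∀ j, a j ≤ b j) ∧
      ∀ j, b j + 2 ≤ a (j + 1) := by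
  obtain ⟨a', b, ha', hb, hs, rfl, h1, h2⟩ := h.exists_isCyclicSeq
  rw [← supp_sub_one] at hs
  obtain ⟨k, hk⟩ := ha'.exists_shift (ha.add_const (-1)) (by omega) hs
  have hk' : ∀ j, a j - 1 = a' (j + k) := fun j => congrFun hk j
  refine ⟨_, hb.shift k, hb.supp_shift (by omega) k, fun j => ?_, fun j => ?_⟩
  · have := hk' j; have := h1 (j + k); omega
  · have h := hk' (j + 1)
    rw [add_right_comm] at h
    have := h2 (j + k)
    omega

theorem IsArcSeq.of_isArc (ht : StrictMono t) (hd : 1 ≤ d) (hm : 2 * d + 1 ≤ m)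
    (ha : IsCyclicSeq (d + 1) m a) (h : IsArc d t T (supp (d + 1) m a)) : IsArcSeq d T a := by
  obtain ⟨⟨-, h2⟩, h3⟩ := (isArc_iff ht hd hm).1 h
  exact ⟨IsSep.of_succ_notMem ha (by omega) h3, h2⟩

/-- The relation `(A - 1) ≀ B` refines to a path of the quiver. -/
theorem transGen_of_le (ht : StrictMono t) (hd : 1 ≤ d) (hm : 2 * d + 1 ≤ m)
    (hT : IsTriangulation (2 * d) t T) (N : ℕ) (ha : IsArcSeq d T a) (hb : IsArcSeq d T b)
    (h1 : ∀ j, a j ≤ b j) (h2 : ∀ j, b j + 2 ≤ a (j + 1))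
    (hne : supp (d + 1) m a ≠ supp (d + 1) m b)
    (hN : ∑ j ∈ Finset.range (d + 1), (b j - a j) ≤ N) :
    Relation.TransGen (triangulationQuiver d t T).Adj
      ⟨_, ha.isArc ht hd hm⟩ ⟨_, hb.isArc ht hd hm⟩ := by
  induction N using Nat.strong_induction_on generalizing a b with
  | _ N ih =>
    have hI := intertwining_shiftDown ha.isCyclicSeq h1 h2
    by_cases hadj : (triangulationQuiver d t T).Adj
      ⟨_, ha.isArc ht hd hm⟩ ⟨_, hb.isArc ht hd hm⟩
    · exact .single hadj
    · obtain ⟨A', hA1, hA2, hA3, hA4⟩ : ∃ A' : {A : Finset (Fin m) // IsArc d t T A},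
          A' ≠ ⟨_, ha.isArc ht hd hm⟩ ∧ A' ≠ ⟨_, hb.isArc ht hd hm⟩ ∧
          Intertwining d (shiftDown (supp (d + 1) m a)) A'.1 ∧
          Intertwining d (shiftDown A'.1) (supp (d + 1) m b) := by
        by_contra hcon
        exact hadj ⟨fun h => hne (congrArg Subtype.val h), hI, hcon⟩
      obtain ⟨A', hA'⟩ := A'
      obtain ⟨a', ha', rfl, h3, h4⟩ := hA3.exists_of_shiftDown ha.isCyclicSeq
      have ha'' := IsArcSeq.of_isArc ht hd hm ha' hA'
      obtain ⟨b', hb', hbs, h5, h6⟩ := hA4.exists_of_shiftDown ha'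
      obtain ⟨k, rfl⟩ := hb.isCyclicSeq.exists_shift hb' (by omega) hbs.symm
      replace h5 : ∀ j, a' j ≤ b (j + k) := h5
      replace h6 : ∀ j, b (j + k) + 2 ≤ a' (j + 1) := h6
      have hmono := hb.isCyclicSeq.strictMono.monotone
      -- The enumerations of `B` relative to `a` and to `a'` might differ by a shift. A negative one
      -- contradicts the order, and a positive one makes the arcs `A'` and `B` intertwine.
      obtain rfl : k = 0 := by
        rcases lt_trichotomy k 0 with hk | hk | hk
        · have e1 := h5 0
          have e2 := hmono (show 0 + k ≤ -1 by omega)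
          have e3 := h2 (-1)
          have e4 := h3 0
          simp only [neg_add_cancel] at e3
          omega
        · exact hk
        · refine absurd ?_ (ha''.not_interleaved ht hT (hb.shift k) fun j => ?_)
          · intro j; have := h6 j; omega
          · have e1 := hmono (show j + 1 ≤ j + k by omega)
            have e2 := h1 (j + 1)
            have e3 := h4 j
            omega
      simp only [add_zero] at h5 h6
      have hpos : ∀ {x y : ℤ → ℤ}, (∀ j, x j ≤ y j) → supp (d + 1) m x ≠ supp (d + 1) m y →
          0 < ∑ j ∈ Finset.range (d + 1), (y j - x j) := by
        intro x y hxy hne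
        refine lt_of_le_of_ne (Finset.sum_nonneg fun j _ => sub_nonneg.2 (hxy j)) fun h => hne ?_
        have := (Finset.sum_eq_zero_iff_of_nonneg fun (j : ℕ) _ => sub_nonneg.2 (hxy j)).1 h.symm
        refine Finset.image_congr fun j hj => ?_
        have := this j (by simpa using hj)
        exact congrArg (residue m) (by omega)
      have hn1 : supp (d + 1) m a ≠ supp (d + 1) m a' := fun h => hA1 (Subtype.ext h.symm)
      have hn2 : supp (d + 1) m a' ≠ supp (d + 1) m b := fun h => hA2 (Subtype.ext h)
      have hp1 := hpos h3 hn1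
      have hp2 := hpos h5 hn2
      -- The distance splits into two positive parts, so the induction applies to both.
      have hsum : ∑ j ∈ Finset.range (d + 1), (b j - a j) =
          ∑ j ∈ Finset.range (d + 1), (a' j - a j) + ∑ j ∈ Finset.range (d + 1), (b j - a' j) := by
        rw [← Finset.sum_add_distrib]
        exact Finset.sum_congr rfl fun j _ => by ring
      have r1 := ih (N - 1) (by omega) ha ha'' h3 h4 hn1 (by omega)
      have r2 := ih (N - 1) (by omega) ha'' hb h5 h6 hn2 (by omega)
      exact r1.trans r2

/-- `X` has at least three vertices, so two adjacent ones would survive in some facet, which is an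
arc. -/
theorem IsInteriorSimplex.succ_notMem (ht : StrictMono t) (hd : 1 ≤ d) (hm : 2 * d + 1 ≤ m)
    {X : Finset (Fin m)} (hX : IsInteriorSimplex d t T X) {x : Fin m} (hx : x ∈ X) : x + 1 ∉ X := by
  intro hx'
  obtain ⟨u, hu, hu'⟩ : ∃ u ∈ X, u ∉ ({x, x + 1} : Finset (Fin m)) := by
    refine Finset.exists_mem_notMem_of_card_lt_card ?_
    have h1 := hX.1.1
    have := Finset.card_le_two (a := x) (b := x + 1)
    omega
  simp only [Finset.mem_insert, Finset.mem_singleton, not_or] at hu'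
  exact ((isArc_iff ht hd hm).1 (hX.2 u hu)).2 x (Finset.mem_erase.2 ⟨Ne.symm hu'.1, hx⟩)
    (Finset.mem_erase.2 ⟨Ne.symm hu'.2, hx'⟩)

/-- Take for `w` the cyclic predecessor of `v` in `X`. Moving the entry `w` of `X \ v` up to `v`
gives `X \ w`, and `v` stays at distance at least two from the next entry. -/
theorem IsInteriorSimplex.exists_transGen (ht : StrictMono t) (hd : 1 ≤ d) (hm : 2 * d + 1 ≤ m)
    (hT : IsTriangulation (2 * d) t T) {X : Finset (Fin m)} (hX : IsInteriorSimplex d t T X)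
    {v : Fin m} (hv : v ∈ X) : ∃ (w : Fin m) (hw : w ∈ X),
      Relation.TransGen (triangulationQuiver d t T).Adj
        ⟨X.erase v, hX.2 v hv⟩ ⟨X.erase w, hX.2 w hw⟩ := by
  obtain ⟨a, ha, hav⟩ := exists_isArcSeq ht hd hm (hX.2 v hv)
  obtain ⟨j₀, h1, h2⟩ : ∃ j₀, a j₀ < v.val ∧ (v.val : ℤ) < a (j₀ + 1) := by
    have hac := ha.isCyclicSeq
    have hvn : ∀ j, a j ≠ v.val := by
      intro j hj
      have := (hac.residue_mem_supp (by omega)).2 ⟨j, hj⟩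
      rw [residue_val, hav] at this
      exact Finset.notMem_erase v X this
    obtain ⟨j, hj, hj'⟩ := exists_sign_change (f := fun j => a j - v.val) fun k => by
      have := ha.isSep.two_le k
      omega
    exact ⟨j, lt_of_le_of_ne (by omega) (hvn j), by omega⟩
  have hshift := ha.shift j₀
  have hav' := ha.isCyclicSeq.supp_shift (m := m) (by omega) j₀
  rw [hav] at hav'
  obtain ⟨a, ha, hav, h1, h2⟩ : ∃ a, IsArcSeq d T a ∧ supp (d + 1) m a = X.erase v ∧
      a 0 < v.val ∧ (v.val : ℤ) < a 1 :=
    ⟨_, hshift, hav', by simpa using h1, by simpa [add_comm] using h2⟩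
  have hac := ha.isCyclicSeq
  have hmemX : ∀ j, residue m (a j) ∈ X := fun j => Finset.mem_of_mem_erase
    (hav ▸ (hac.residue_mem_supp (by omega)).2 ⟨j, rfl⟩)
  -- The class of index 0, which enumerates `w`, is moved up to `v`.
  let b : ℤ → ℤ := fun j => a j + (v.val - a 0) * bump (0 : ZMod (d + 1)) j
  have hzero : ∀ j : ℤ, (j : ZMod (d + 1)) = 0 →
      ∃ q, b j = v.val + m * q ∧ a j = a 0 + m * q ∧ a (j + 1) = a 1 + m * q := by
    intro j hj
    obtain ⟨q, hq⟩ := (ZMod.intCast_zmod_eq_zero_iff_dvd j (d + 1)).1 hj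
    have e1 : a j = a 0 + m * q := by rw [← hac.add_mul_period, hq, zero_add]
    have e2 : a (j + 1) = a 1 + m * q := by rw [← hac.add_mul_period, hq, add_comm]
    refine ⟨q, ?_, e1, e2⟩
    simp only [b, bump, hj, if_true, e1]
    ring
  have hv1 : (v.val : ℤ) + 2 ≤ a 1 := by
    by_contra! h
    have hx := hX.succ_notMem ht hd hm hv
    have := hmemX 1
    rw [show a 1 = v.val + 1 by omega, residue_add_one, residue_val] at this
    exact hx this
  have hab : ∀ j, a j ≤ b j := fun j => by
    have := mul_nonneg (sub_nonneg.2 h1.le) (bump_nonneg (0 : ZMod (d + 1)) j)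
    simp only [b]
    omega
  have hba : ∀ j, b j + 2 ≤ a (j + 1) := fun j => by
    rcases bump_cases (0 : ZMod (d + 1)) j with ⟨hj, -⟩ | ⟨-, hj⟩
    · obtain ⟨q, e1, e2, e3⟩ := hzero j hj
      omega
    · have := ha.isSep.two_le j
      simp only [b, hj]
      omega
  have hbc : IsCyclicSeq (d + 1) m b := by
    refine ⟨strictMono_int_of_lt_succ fun j => ?_, fun j => ?_⟩
    · have := hba j; have := hab (j + 1); omega
    · simp only [b, hac.add_period, bump_add_period]; ring
  have hw := hmemX 0
  have hne : residue m (a 0) ≠ v := fun h => by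
    have := (hac.residue_mem_supp (m := m) (D := d + 1) (by omega)).2 ⟨0, rfl⟩
    rw [hav, h] at this
    exact Finset.notMem_erase v X this
  have hbs : supp (d + 1) m b = X.erase (residue m (a 0)) := by
    refine Finset.eq_of_subset_of_card_le (fun x hx => ?_)
      (by rw [hbc.card_supp, Finset.card_erase_of_mem hw, hX.1.1]; omega)
    obtain ⟨j, rfl⟩ := (hbc.mem_supp (by omega)).1 hx
    rcases bump_cases (0 : ZMod (d + 1)) j with ⟨hj, -⟩ | ⟨hj, hj'⟩
    · obtain ⟨q, e1, -, -⟩ := hzero j hj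
      have : residue m (b j) = v := by
        conv_rhs => rw [← residue_val v]
        rw [residue_eq_iff]
        exact ⟨q, by rw [e1]; ring⟩
      rw [this]
      exact Finset.mem_erase.2 ⟨hne.symm, hv⟩
    · have e : b j = a j := by simp only [b, hj']; ring
      rw [e]
      refine Finset.mem_erase.2 ⟨fun h => hj ?_, hmemX j⟩
      obtain ⟨q, hq⟩ := residue_eq_iff.1 h
      have : a j = a (0 + (d + 1 : ℕ) * q) := by rw [hac.add_mul_period]; linarith
      rw [hac.strictMono.injective this, ZMod.intCast_zmod_eq_zero_iff_dvd]
      exact ⟨q, by ring⟩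
  have hbA := IsArcSeq.of_isArc (T := T) ht hd hm hbc (hbs ▸ hX.2 _ hw)
  have := transGen_of_le ht hd hm hT (∑ j ∈ Finset.range (d + 1), (b j - a j)).toNat ha hbA hab hba
    (fun h => by
      rw [hav, hbs] at h
      have : v ∈ X.erase (residue m (a 0)) := Finset.mem_erase.2 ⟨hne.symm, hv⟩
      rw [← h] at this
      exact Finset.notMem_erase v X this) (Int.self_le_toNat _)
  refine ⟨residue m (a 0), hw, ?_⟩
  convert this using 2
  · exact hav.symm
  · exact hbs.symm

/-- Without cycles, reachability between the finitely many arcs is well-founded, but no facet of `X`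
is minimal: each of them reaches another. -/
theorem IsInteriorSimplex.hasOrientedCycle (ht : StrictMono t) (hd : 1 ≤ d) (hm : 2 * d + 1 ≤ m)
    (hT : IsTriangulation (2 * d) t T) {X : Finset (Fin m)} (hX : IsInteriorSimplex d t T X) :
    HasOrientedCycle (triangulationQuiver d t T) := by
  by_contra hcon
  let r : {A : Finset (Fin m) // IsArc d t T A} → {A : Finset (Fin m) // IsArc d t T A} → Prop :=
    fun A B => Relation.TransGen (triangulationQuiver d t T).Adj B A
  have : IsTrans _ r := ⟨fun _ _ _ h h' => h'.trans h⟩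
  have : Std.Irrefl r := ⟨fun A hA => hcon ⟨A, hA⟩⟩
  have hwf : WellFounded r := Finite.wellFounded_of_trans_of_irrefl r
  obtain ⟨v, hv⟩ : X.Nonempty := Finset.card_pos.1 (by rw [hX.1.1]; omega)
  obtain ⟨_, ⟨v, hv, rfl⟩, hmin⟩ := hwf.has_min
    {A | ∃ (v : Fin m) (hv : v ∈ X), A = ⟨X.erase v, hX.2 v hv⟩} ⟨_, v, hv, rfl⟩
  obtain ⟨w, hw, h⟩ := hX.exists_transGen ht hd hm hT hv
  exact hmin _ ⟨w, hw, rfl⟩ h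

end cycles

/-! ### Slices -/

section slices

variable {d m : ℕ} {a b : ℤ → ℤ}

theorem exists_eq_add_mul {D : ℕ} {i j : ℤ} (h : (j : ZMod D) = (i : ZMod D)) :
    ∃ q : ℤ, j = i + D * q := by
  obtain ⟨q, hq⟩ := (ZMod.intCast_eq_intCast_iff_dvd_sub i j D).1 h.symm
  exact ⟨q, by linear_combination hq⟩

/-- Any two comparable separated sequences are joined by a path of unit steps. -/
theorem IsSep.le_induction {D : ℕ} (hD : 0 < D) (ha : IsSep D m a) (hb : IsSep D m b)
    (hab : ∀ j, a j ≤ b j) {Q : (ℤ → ℤ) → Prop} (hQ : Q a)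
    (hbump : ∀ (c : ℤ → ℤ) (k : ZMod D), IsSep D m c → (∀ j, a j ≤ c j) →
      IsSep D m (fun j => c j + bump k j) → (∀ j, c j + bump k j ≤ b j) → Q c →
      Q fun j => c j + bump k j)
    (hone : ∀ c : ℤ → ℤ, IsSep D m c → (∀ j, a j ≤ c j) → (∀ j, c j + 1 ≤ b j) → Q c →
      Q fun j => c j + 1) : Q b := by
  have key : ∀ (N : ℕ) (c : ℤ → ℤ), IsSep D m c → (∀ j, a j ≤ c j) → (∀ j, c j ≤ b j) →
      ∑ j ∈ Finset.range D, (b j - c j) ≤ N → Q c → Q b := by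
    intro N
    induction N using Nat.strong_induction_on with
    | _ N ih =>
      intro c hc hac hcb hN hQc
      have hmono : ∀ c' : ℤ → ℤ, IsSep D m c' → (∀ j, c j ≤ c' j) → (∀ j, c' j ≤ b j) →
          (∃ j, c j < c' j) → Q c' → Q b := by
        rintro c' hc' h1 h2 ⟨j, hj⟩ hQ'
        obtain ⟨r, hr⟩ : ∃ r ∈ Finset.range D, c (r : ℕ) < c' (r : ℕ) := by
          have hD' : (0 : ℤ) < D := by exact_mod_cast hD
          have e1 := Int.emod_nonneg j hD'.ne'
          have e2 := Int.emod_lt_of_pos j hD'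
          refine ⟨(j % D).toNat, Finset.mem_range.2 (by omega), ?_⟩
          rw [Int.toNat_of_nonneg e1]
          rw [hc.isCyclicSeq.add_mul_period', hc'.isCyclicSeq.add_mul_period'] at hj
          omega
        have hlt : ∑ j ∈ Finset.range D, (b j - c' j) < ∑ j ∈ Finset.range D, (b j - c j) :=
          Finset.sum_lt_sum (fun j _ => by have := h1 j; omega) ⟨r, hr.1, by omega⟩
        have hnn : 0 ≤ ∑ j ∈ Finset.range D, (b j - c' j) :=
          Finset.sum_nonneg fun j _ => by have := h2 j; omega
        exact ih (N - 1) (by omega) c' hc' (fun j => (hac j).trans (h1 j)) h2 (by omega) hQ'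
      by_cases hstep : ∃ k : ZMod D, IsSep D m (fun j => c j + bump k j) ∧
          ∀ j, c j + bump k j ≤ b j
      · obtain ⟨k, hk, hkb⟩ := hstep
        obtain ⟨i, rfl⟩ := ZMod.intCast_surjective k
        exact hmono _ hk (fun j => by have := bump_nonneg (i : ZMod D) j; omega) hkb
          ⟨i, by simp [bump]⟩ (hbump c _ hc hac hk hkb hQc)
      · by_cases heq : ∃ j, c j < b j
        -- If `c j < b j` but `c (j + 1) = b (j + 1)`, then separation of `b` leaves room to raise
        -- `c j`. So without a unit step every entry is below its target, and all can be raised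
        -- together.
        · have hall : ∀ j, c j < b j → c (j + 1) < b (j + 1) := by
            intro j hj
            by_contra hj'
            refine hstep ⟨(j : ZMod D), ⟨fun l => ?_, fun l => ?_⟩, fun l => ?_⟩
            · rw [hc.add_period, bump_add_period]; ring
            · have h1 := hc.two_le l
              have h2 := bump_nonneg (j : ZMod D) (l + 1)
              rcases bump_cases (j : ZMod D) l with ⟨h, h'⟩ | ⟨h, h'⟩
              · obtain ⟨q, rfl⟩ := exists_eq_add_mul h
                have h3 := hb.two_le j
                rw [h', add_right_comm j, hc.isCyclicSeq.add_mul_period,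
                  hc.isCyclicSeq.add_mul_period] at *
                omega
              · omega
            · rcases bump_cases (j : ZMod D) l with ⟨h, h'⟩ | ⟨h, h'⟩
              · obtain ⟨q, rfl⟩ := exists_eq_add_mul h
                rw [h', hc.isCyclicSeq.add_mul_period, hb.isCyclicSeq.add_mul_period]
                omega
              · rw [h', add_zero]; exact hcb l
          obtain ⟨j, hj⟩ := heq
          have hge : ∀ i : ℕ, c (j + i) < b (j + i) := by
            intro i
            induction i with
            | zero => simpa using hj
            | succ i ih => have := hall _ ih; push_cast; rwa [← add_assoc]
          have hlt : ∀ l, c l < b l := by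
            intro l
            -- The multiple of `D` makes the offset nonnegative without changing the residue class
            -- of `l`.
            have h1 := hge (l - j + D * |l - j|).toNat
            have h2 : 0 ≤ l - j + D * |l - j| := by
              have h3 : (1 : ℤ) ≤ D := by exact_mod_cast hD
              have h4 := abs_nonneg (l - j)
              have h5 := neg_abs_le (l - j)
              nlinarith
            rw [Int.toNat_of_nonneg h2, show j + (l - j + D * |l - j|) = l + D * |l - j| by ring,
              hc.isCyclicSeq.add_mul_period, hb.isCyclicSeq.add_mul_period] at h1
            omega
          exact hmono _ (hc.add_const 1) (fun j => by omega) (fun j => hlt j) ⟨0, by omega⟩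
            (hone c hc hac (fun j => hlt j) hQc)
        · push Not at heq
          have : c = b := funext fun j => le_antisymm (hcb j) (heq j)
          rwa [← this]
  exact key _ a ha (fun _ => le_rfl) hab (Int.self_le_toNat _) hQ

/-- The properties of the arcs of a triangulation without interior simplices that make them a
slice. -/
structure IsSliceFamily (d m : ℕ) (P : (ℤ → ℤ) → Prop) : Prop where
  isSep : ∀ {a}, P a → IsSep (d + 1) m a
  not_interleaved : ∀ {a b}, P a → P b → (∀ j, a j < b j) → ¬ ∀ j, b j < a (j + 1)
  bump_or : ∀ {a} {k : ZMod (d + 1)}, P a → IsSep (d + 1) m (fun j => a j + bump k j) →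
    (P fun j => a j + bump k j) ∨ ∀ b, IsSep (d + 1) m b →
      (∀ j, a j - 1 ≤ b j ∧ b j ≤ a j) → (∀ j : ℤ, (j : ZMod (d + 1)) = k → b j = a j) → P b

/-- A step of the quiver, up to translation. -/
def sliceStep (P : (ℤ → ℤ) → Prop) {D : ℕ} (k : ZMod D) (a b : ℤ → ℤ) : Prop :=
  P a ∧ P b ∧ ((b = fun j => a j + bump k j) ∨ b = fun j => a j + bump k j - 1)

namespace IsSliceFamily

variable {P : (ℤ → ℤ) → Prop}

theorem not_add_one (hP : IsSliceFamily d m P) (ha : P a) : ¬ P fun j => a j + 1 := fun h =>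
  hP.not_interleaved ha h (fun j => by omega) fun j => by have := (hP.isSep ha).two_le j; omega

theorem eq_of_add_const (hP : IsSliceFamily d m P) {f : ℤ → ℤ} {p q : ℤ} (hp : P fun j => f j - p)
    (hq : P fun j => f j - q) (h : |p - q| ≤ 1) : p = q := by
  rw [abs_le] at h
  by_contra hne
  rcases lt_or_gt_of_ne hne with h' | h'
  · refine hP.not_add_one hq ?_
    convert hp using 2
    omega
  · refine hP.not_add_one hp ?_
    convert hq using 2
    omega

theorem sliceStep_iff {D : ℕ} {k : ZMod D} : sliceStep P k a b ↔ P a ∧ P b ∧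
    ∃ p : ℤ, 0 ≤ p ∧ p ≤ 1 ∧ b = fun j => a j + bump k j - p := by
  refine and_congr_right fun _ => and_congr_right fun _ => ⟨?_, ?_⟩
  · rintro (rfl | rfl)
    · exact ⟨0, le_rfl, zero_le_one, by simp⟩
    · exact ⟨1, zero_le_one, le_rfl, rfl⟩
  · rintro ⟨p, h0, h1, rfl⟩
    obtain rfl | rfl : p = 0 ∨ p = 1 := by omega
    · exact Or.inl (by simp)
    · exact Or.inr rfl

theorem isSep_bump (hP : IsSliceFamily d m P) {k : ZMod (d + 1)} (h : sliceStep P k a b) :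
    IsSep (d + 1) m fun j => a j + bump k j := by
  obtain ⟨-, hb, p, -, -, rfl⟩ := sliceStep_iff.1 h
  have := (hP.isSep hb).add_const p
  simpa using this

theorem exists_step (hP : IsSliceFamily d m P) {k : ZMod (d + 1)} (ha : P a)
    (h : IsSep (d + 1) m fun j => a j + bump k j) : ∃ b, sliceStep P k a b := by
  rcases hP.bump_or ha h with h' | h'
  · exact ⟨_, ha, h', Or.inl rfl⟩
  · refine ⟨_, ha, h' _ (h.add_const (-1)) (fun j => ?_) (fun j hj => ?_), Or.inr rfl⟩
    · have := bump_nonneg k j; have := bump_le_one k j; omega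
    · simp [bump, hj]

theorem isSep_bump_bump {i j : ZMod (d + 1)} (hij : i ≠ j) (ha : IsSep (d + 1) m a)
    (hi : IsSep (d + 1) m fun l => a l + bump i l) (hj : IsSep (d + 1) m fun l => a l + bump j l) :
    IsSep (d + 1) m fun l => a l + bump i l + bump j l := by
  refine ⟨fun l => ?_, fun l => ?_⟩
  · rw [ha.add_period, bump_add_period, bump_add_period]; ring
  · have h1 := ha.two_le l
    have h2 := hi.two_le l
    have h3 := hj.two_le l
    have h4 := bump_nonneg i (l + 1)
    have h5 := bump_nonneg j (l + 1)
    rcases bump_cases i l with ⟨h, h'⟩ | ⟨h, h'⟩ <;> rcases bump_cases j l with ⟨g, g'⟩ | ⟨g, g'⟩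
    · exact absurd (h.symm.trans g) hij
    · omega
    · omega
    · omega

/-- The two sequences would interlace. This excludes that the two sides of a diamond differ by a
translation by two. -/
theorem not_isSep_pair (hP : IsSliceFamily d m P) (hd : 1 ≤ d) {i j : ZMod (d + 1)} (hij : i ≠ j)
    (ha : IsSep (d + 1) m a) (hi : IsSep (d + 1) m fun l => a l + bump i l)
    (hj : IsSep (d + 1) m fun l => a l + bump j l) (h1 : P fun l => a l + bump j l - 1) :
    ¬ P fun l => a l + bump i l + bump j l := by
  refine fun h2 => hP.not_interleaved h1 h2 (fun l => ?_) fun l => ?_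
  · have := bump_nonneg i l
    omega
  · have e1 := ha.two_le l
    have e2 := hi.two_le l
    have e3 := hj.two_le l
    have e4 := bump_nonneg j (l + 1)
    have hne := cast_add_one_ne (D := d + 1) (by omega) l
    rcases bump_cases i l with ⟨h, h'⟩ | ⟨h, h'⟩ <;> rcases bump_cases j l with ⟨g, g'⟩ | ⟨g, g'⟩
    · exact absurd (h.symm.trans g) hij
    · have : bump i (l + 1) = 0 := if_neg (h ▸ hne)
      omega
    · omega
    · omega

/-- A step is determined up to a translation by 0 or 1. Members of `P` cannot be translates by one,
which gives determinism; in a diamond a difference of two must also be excluded. -/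
theorem isCommuting (hP : IsSliceFamily d m P) (hd : 1 ≤ d) :
    IsCommuting (sliceStep P (D := d + 1)) where
  det := by
    intro k s t u h1 h2
    obtain ⟨-, ht, p, hp0, hp1, rfl⟩ := sliceStep_iff.1 h1
    obtain ⟨-, hu, q, hq0, hq1, rfl⟩ := sliceStep_iff.1 h2
    rw [hP.eq_of_add_const ht hu (by rw [abs_le]; omega)]
  diamond := by
    intro i j s t u hij hst hsu
    have hs := hP.isSep hst.1
    have hsi := hP.isSep_bump hst
    have hsj := hP.isSep_bump hsu
    have hsij := isSep_bump_bump hij hs hsi hsj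
    obtain ⟨-, ht, p, hp0, hp1, rfl⟩ := sliceStep_iff.1 hst
    obtain ⟨-, hu, q, hq0, hq1, rfl⟩ := sliceStep_iff.1 hsu
    obtain ⟨v, hv⟩ := hP.exists_step (k := j) ht (by
      convert hsij.add_const (-p) using 2; ring)
    obtain ⟨v', hv'⟩ := hP.exists_step (k := i) hu (by
      convert hsij.add_const (-q) using 2; ring)
    refine ⟨v, hv, ?_⟩
    obtain ⟨-, hPv, p', hp0', hp1', rfl⟩ := sliceStep_iff.1 hv
    obtain ⟨-, hPv', q', hq0', hq1', rfl⟩ := sliceStep_iff.1 hv'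
    have e1 : (fun l => s l + bump i l - p + bump j l - p') =
        fun l => s l + bump i l + bump j l - (p + p') := by funext l; ring
    have e2 : (fun l => s l + bump j l - q + bump i l - q') =
        fun l => s l + bump i l + bump j l - (q + q') := by funext l; ring
    have heq : p + p' = q + q' := by
      have f1 := hPv
      have f2 := hPv'
      rw [e1] at f1
      rw [e2] at f2
      by_cases habs : |p + p' - (q + q')| ≤ 1
      · exact hP.eq_of_add_const f1 f2 habs
      · have : (p = 0 ∧ p' = 0 ∧ q = 1 ∧ q' = 1) ∨ (p = 1 ∧ p' = 1 ∧ q = 0 ∧ q' = 0) := by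
          rw [abs_le] at habs
          omega
        rcases this with ⟨rfl, rfl, rfl, rfl⟩ | ⟨rfl, rfl, rfl, rfl⟩
        · exact absurd (by simpa using f1) (hP.not_isSep_pair hd hij hs hsi hsj hu)
        · refine absurd ?_ (hP.not_isSep_pair hd hij.symm hs hsj hsi ht)
          convert f2 using 2
          ring
    rw [e1, heq, ← e2]
    exact hv'

/-- Raise the entries `i, i - 1, …, i - d` in turn, where each one makes room for the next. The last
sequence `a + 1` is not in `P`, so there is a first failure. From there on the second alternative of
`bump_or` puts all remaining sequences, lowered by one, into `P`, and the run ends at `a`. -/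
theorem exists_full_run (hP : IsSliceFamily d m P) (hd : 1 ≤ d) {k : ZMod (d + 1)} (ha : P a)
    (hk : IsSep (d + 1) m fun j => a j + bump k j) :
    ∃ w : List (ZMod (d + 1)), (∀ i, w.count i = 1) ∧ Run (sliceStep P) w a a := by
  classical
  obtain ⟨i, rfl⟩ := ZMod.intCast_surjective k
  have hD : (0 : ℤ) < (d + 1 : ℕ) := by positivity
  have hsep := hP.isSep ha
  -- The sequence after `r` entries have been raised.
  let A : ℕ → ℤ → ℤ := fun r j => a j + if (i - j) % (d + 1 : ℕ) < r then 1 else 0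
  have hA0 : A 0 = a := by
    funext j
    have := Int.emod_nonneg (i - j) hD.ne'
    simp only [A]
    rw [if_neg (by push_cast at *; omega), add_zero]
  have hAD : A (d + 1) = fun j => a j + 1 := by
    funext j
    have := Int.emod_lt_of_pos (i - j) hD
    simp only [A]
    rw [if_pos this]
  have hcast : ∀ (r : ℕ) (j : ℤ), r < d + 1 →
      ((i - j) % (d + 1 : ℕ) = r ↔ (j : ZMod (d + 1)) = i - r) := by
    intro r j hr
    have e : ((r : ℤ)) % (d + 1 : ℕ) = r :=
      Int.emod_eq_of_lt (by positivity) (by exact_mod_cast hr)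
    have h1 := ZMod.intCast_eq_intCast_iff' (i - j) r (d + 1)
    rw [e] at h1
    rw [← h1]
    push_cast
    constructor
    · intro h; rw [← h]; ring
    · intro h; rw [h]; ring
  have hAsucc : ∀ r < d + 1, A (r + 1) = fun j => A r j + bump ((i - r : ZMod (d + 1))) j := by
    intro r hr
    funext j
    have := hcast r j hr
    simp only [A, bump, ← this]
    push_cast
    split_ifs <;> omega
  have hAsep : ∀ r, IsSep (d + 1) m (A r) := by
    intro r
    refine ⟨fun j => ?_, fun j => ?_⟩
    · simp only [A, hsep.add_period]
      rw [← sub_sub, Int.sub_emod_right]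
      ring
    · have h0 := hsep.two_le j
      have h1 := hk.two_le j
      have hne := cast_add_one_ne (D := d + 1) (by omega) j
      have hx := Int.emod_nonneg (i - j) hD.ne'
      have hx1 := Int.emod_lt_of_pos (i - j) hD
      simp only [A]
      rcases bump_cases (i : ZMod (d + 1)) j with ⟨h, h'⟩ | ⟨h, h'⟩
      · have : bump (i : ZMod (d + 1)) (j + 1) = 0 := if_neg (h ▸ hne)
        split_ifs <;> omega
      · have hx0 : (i - j) % (d + 1 : ℕ) ≠ 0 := fun h0 => h (by
          have := (hcast 0 j (by omega)).1 (by simpa using h0)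
          simpa using this)
        have hx' : (i - (j + 1)) % (d + 1 : ℕ) = (i - j) % (d + 1 : ℕ) - 1 := by
          rw [← sub_sub, Int.sub_emod, Int.emod_eq_of_lt (a := 1) (by norm_num)
            (by push_cast; omega)]
          exact Int.emod_eq_of_lt (by omega) (by omega)
        rw [hx']
        split_ifs <;> omega
  have hex : ∃ r, ¬ P (A r) := ⟨d + 1, by rw [hAD]; exact hP.not_add_one ha⟩
  obtain ⟨r₀, hr₀, hmin⟩ : ∃ r₀, ¬ P (A r₀) ∧ ∀ r < r₀, P (A r) :=
    ⟨Nat.find hex, Nat.find_spec hex, fun r hr => not_not.1 (Nat.find_min hex hr)⟩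
  have hr₀D : r₀ ≤ d + 1 := by
    by_contra! h
    have := hmin _ h
    rw [hAD] at this
    exact hP.not_add_one ha this
  obtain ⟨ρ, rfl⟩ : ∃ ρ, r₀ = ρ + 1 := by
    refine Nat.exists_eq_succ_of_ne_zero ?_
    rintro rfl
    rw [hA0] at hr₀
    exact hr₀ ha
  have hright := (hP.bump_or (k := (i - ρ : ZMod (d + 1))) (hmin ρ (by omega)) (by
    rw [← hAsucc ρ (by omega)]; exact hAsep _)).resolve_left (by
    rwa [← hAsucc ρ (by omega)])
  have hafter : ∀ r, ρ + 1 ≤ r → r ≤ d + 1 → P fun j => A r j - 1 := by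
    intro r hr hr'
    refine hright _ ((hAsep r).add_const (-1)) (fun j => ?_) fun j hj => ?_
    · simp only [A]
      split_ifs <;> omega
    · have := (hcast ρ j (by omega)).2 hj
      simp only [A, this]
      split_ifs <;> omega
  let p : ℕ → ℤ → ℤ := fun r => if r < ρ + 1 then A r else fun j => A r j - 1
  have hrun := Run.of_seq (step := sliceStep P (D := d + 1)) p (fun r => (i - r : ZMod (d + 1)))
    (d + 1) (fun r hr => by
      simp only [p]
      by_cases h1 : r + 1 < ρ + 1
      · rw [if_pos h1, if_pos (by omega)]
        exact ⟨hmin _ (by omega), hmin _ h1, Or.inl (hAsucc r hr)⟩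
      · rw [if_neg h1]
        by_cases h2 : r < ρ + 1
        · rw [if_pos h2]
          exact ⟨hmin _ h2, hafter _ (by omega) (by omega), Or.inr (by rw [hAsucc r hr])⟩
        · rw [if_neg h2]
          refine ⟨hafter _ (by omega) (by omega), hafter _ (by omega) (by omega), Or.inl ?_⟩
          rw [hAsucc r hr]
          funext j
          ring)
  have hp0 : p 0 = a := by simp only [p]; rw [if_pos (by omega), hA0]
  have hpD : p (d + 1) = a := by
    simp only [p]; rw [if_neg (by omega), hAD]; simp
  rw [hp0, hpD] at hrun
  refine ⟨_, fun l => List.count_eq_one_of_mem ?_ ?_, hrun⟩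
  · refine List.Nodup.map_on (fun r hr r' hr' h => ?_) List.nodup_range
    rw [List.mem_range] at hr hr'
    have h' := (ZMod.natCast_eq_natCast_iff' r r' (d + 1)).1 (sub_right_injective h)
    rwa [Nat.mod_eq_of_lt hr, Nat.mod_eq_of_lt hr'] at h'
  · refine List.mem_map.2 ⟨((i : ZMod (d + 1)) - l).val, List.mem_range.2 (ZMod.val_lt _), ?_⟩
    rw [ZMod.natCast_zmod_val]
    ring

theorem run_apply {D : ℕ} {w : List (ZMod D)} (h : Run (sliceStep P) w a b) :
    ∃ q : ℤ, ∀ j : ℤ, b j = a j + w.count (j : ZMod D) - q := by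
  induction h with
  | nil s => exact ⟨0, by simp⟩
  | @cons k w s u t h1 _ ih =>
    obtain ⟨q, hq⟩ := ih
    obtain ⟨-, -, p, -, -, rfl⟩ := sliceStep_iff.1 h1
    refine ⟨q + p, fun j => ?_⟩
    rw [hq, List.count_cons]
    simp only [bump, beq_iff_eq, eq_comm (a := k)]
    push_cast
    ring

/-- There is a height function whose zero level is a slice in `P`. -/
theorem exists_height (hP : IsSliceFamily d m P) (hd : 1 ≤ d) {a₀ : ℤ → ℤ} (h₀ : P a₀) :
    ∃ h : (ℤ → ℤ) → ℤ, (∀ a, IsSep (d + 1) m a → h a = 0 → P a) ∧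
      (∀ a c, IsSep (d + 1) m a → h (fun j => a j + c) = h a + c) ∧
      ∀ a (k : ZMod (d + 1)), IsSep (d + 1) m a → IsSep (d + 1) m (fun j => a j + bump k j) →
        h a ≤ h (fun j => a j + bump k j) ∧ h (fun j => a j + bump k j) ≤ h a + 1 := by
  classical
  -- The slice: all sequences that are reached from `a₀`.
  let S : Set (ℤ → ℤ) := {b | ∃ w, Run (sliceStep P (D := d + 1)) w a₀ b}
  have hcomm := hP.isCommuting hd
  have hfull : ∀ s, (∃ (k : ZMod (d + 1)) (t : ℤ → ℤ), sliceStep P k s t) →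
      ∃ w : List (ZMod (d + 1)), (∀ i, w.count i = 1) ∧ Run (sliceStep P) w s s := by
    rintro s ⟨k, t, hst⟩
    exact hP.exists_full_run hd hst.1 (hP.isSep_bump hst)
  have hSP : ∀ b ∈ S, P b := by
    rintro b ⟨w, hw⟩
    have : ∀ {w : List (ZMod (d + 1))} {s t : ℤ → ℤ}, Run (sliceStep P) w s t → P s → P t := by
      intro w s t h
      induction h with
      | nil s => exact id
      | cons h1 _ ih => exact fun _ => ih h1.2.1
    exact this hw h₀
  have hstep : ∀ (b c : ℤ → ℤ) (k : ZMod (d + 1)), b ∈ S → sliceStep P k b c → c ∈ S := by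
    rintro b c k ⟨w, hw⟩ h
    exact ⟨_, hw.append (.cons h (.nil c))⟩
  -- A path from `b` to a translate of `b` uses all labels equally often, and full rounds return to
  -- their start.
  have huniq : ∀ (b : ℤ → ℤ) (c : ℤ), b ∈ S → (fun j => b j + c) ∈ S → c = 0 := by
    rintro b c ⟨w, hw⟩ ⟨w', hw'⟩
    obtain ⟨v, hv⟩ := hcomm.exists_reverse hfull hw
    have hr := hv.append hw'
    obtain ⟨q, hq⟩ := run_apply hr
    have hcount : ∀ k, (v ++ w').count k = (c + q).toNat := by
      intro k
      obtain ⟨j, rfl⟩ := ZMod.intCast_surjective k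
      have := hq j
      omega
    have := hcomm.eq_iterate (F := id) (fun s hs => ⟨hfull s hs, hs⟩) hcount hr
    rw [Function.iterate_id] at this
    have := congrFun this 0
    simp only [id] at this
    omega
  have hsucc : ∀ (b : ℤ → ℤ) (k : ZMod (d + 1)), b ∈ S → IsSep (d + 1) m (fun j => b j + bump k j) →
      ∃ p : ℤ, 0 ≤ p ∧ p ≤ 1 ∧ (fun j => b j + bump k j - p) ∈ S := by
    intro b k hb hk
    obtain ⟨c, hc⟩ := hP.exists_step (hSP b hb) hk
    have hcS := hstep b c k hb hc
    obtain ⟨-, -, p, hp0, hp1, rfl⟩ := sliceStep_iff.1 hc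
    exact ⟨p, hp0, hp1, hcS⟩
  -- A translate of `b` lies above `a₀`; the unit steps that lead up to it are followed inside `S`,
  -- up to translation.
  have hex : ∀ b, IsSep (d + 1) m b → ∃ c : ℤ, (fun j => b j - c) ∈ S := by
    intro b hb
    have hsep₀ := hP.isSep h₀
    obtain ⟨K, hK⟩ : ∃ K : ℤ, ∀ j, a₀ j ≤ b j + K := by
      obtain ⟨K, hK⟩ : ∃ K : ℤ, ∀ r ∈ Finset.range (d + 1), a₀ r - b r ≤ K :=
        ⟨∑ r ∈ Finset.range (d + 1), |a₀ r - b r|, fun r hr => (le_abs_self _).trans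
          (Finset.single_le_sum (f := fun r : ℕ => |a₀ r - b r|) (fun _ _ => abs_nonneg _) hr)⟩
      refine ⟨K, fun j => ?_⟩
      have hD : (0 : ℤ) < (d + 1 : ℕ) := by positivity
      have e1 := Int.emod_nonneg j hD.ne'
      have e2 := Int.emod_lt_of_pos j hD
      have e3 := hK (j % (d + 1 : ℕ)).toNat (Finset.mem_range.2 (by omega))
      rw [Int.toNat_of_nonneg e1] at e3
      rw [hb.isCyclicSeq.add_mul_period' j, hsep₀.isCyclicSeq.add_mul_period' j]
      omega
    obtain ⟨c, hc⟩ := IsSep.le_induction (by omega) hsep₀ (hb.add_const K) hK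
      (Q := fun b => ∃ c : ℤ, (fun j => b j - c) ∈ S)
      ⟨0, [], by simpa using Run.nil a₀⟩
      (by
        rintro b k hb - hk - ⟨c, hc⟩
        obtain ⟨p, -, -, hp⟩ := hsucc _ k hc (by
          convert hk.add_const (-c) using 2; ring)
        refine ⟨c + p, ?_⟩
        convert hp using 2
        ring)
      (by
        rintro b hb - - ⟨c, hc⟩
        refine ⟨c + 1, ?_⟩
        convert hc using 2
        ring)
    refine ⟨c - K, ?_⟩
    convert hc using 2
    ring
  -- The height of `b` is the amount by which `b` must be lowered to lie in the slice.
  choose! h hh using hex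
  have hu : ∀ b c, IsSep (d + 1) m b → (fun j => b j - c) ∈ S → h b = c := by
    intro b c hb hc
    have := huniq _ (h b - c) (hh b hb) (by convert hc using 2; ring)
    omega
  refine ⟨h, fun b hb h0 => ?_, fun b c hb => ?_, fun b k hb hk => ?_⟩
  · have := hh b hb
    rw [h0] at this
    exact hSP _ (by simpa using this)
  · refine hu _ _ (hb.add_const c) ?_
    convert hh b hb using 2
    ring
  · obtain ⟨p, hp0, hp1, hp⟩ := hsucc _ k (hh b hb) (by
      convert hk.add_const (-(h b)) using 2; ring)
    have := hu _ (h b + p) hk (by convert hp using 2; ring)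
    omega

end IsSliceFamily

end slices

/-! ### Gap vectors -/

section gaps

variable {d m n : ℕ} {a b : ℤ → ℤ}

theorem exists_antidifference (F : ℤ → ℤ) : ∃ b : ℤ → ℤ, ∀ j, b (j + 1) = b j + F j := by
  refine ⟨fun j => Int.rec (fun k => ∑ i ∈ Finset.range k, F i)
    (fun k => -∑ i ∈ Finset.range (k + 1), F (-(i + 1 : ℕ))) j, fun j => ?_⟩
  rcases j with k | k
  · have : (Int.ofNat k + 1 : ℤ) = Int.ofNat (k + 1) := rfl
    rw [this]
    simp only [Finset.sum_range_succ]
    rfl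
  · rcases k with _ | k
    · have : (Int.negSucc 0 + 1 : ℤ) = Int.ofNat 0 := rfl
      rw [this]
      simp
    · have : (Int.negSucc (k + 1) + 1 : ℤ) = Int.negSucc k := rfl
      rw [this]
      simp only [Finset.sum_range_succ _ (k + 1), Int.negSucc_eq]
      push_cast
      ring

/-- The residue class of indices that belongs to the entry `i` of a gap vector. -/
def gapIndex (i : Fin (d + 1)) : ZMod (d + 1) := ((-(i.val : ℤ) : ℤ) : ZMod (d + 1))

theorem gapIndex_injective : Function.Injective (gapIndex (d := d)) := by
  intro i j h
  simp only [gapIndex, Int.cast_neg, neg_inj, Int.cast_natCast] at h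
  rw [ZMod.natCast_eq_natCast_iff', Nat.mod_eq_of_lt i.2, Nat.mod_eq_of_lt j.2] at h
  exact Fin.ext h

theorem gapIndex_add_one (i : Fin (d + 1)) : gapIndex (i + 1) + 1 = gapIndex i := by
  have h : (((i + 1 : Fin (d + 1)).val : ℕ) : ZMod (d + 1)) = ((i.val + 1 : ℕ) : ZMod (d + 1)) := by
    rw [ZMod.natCast_eq_natCast_iff', Fin.val_add, Nat.mod_mod, Fin.val_one', Nat.add_mod_mod]
  simp only [gapIndex, Int.cast_neg, Int.cast_natCast, h]
  push_cast
  ring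

theorem bump_gapIndex (i j : Fin (d + 1)) :
    bump (gapIndex i) (-(j.val : ℤ)) = if j = i then 1 else 0 :=
  if_congr (gapIndex_injective.eq_iff (a := j)) rfl rfl

theorem bump_gapIndex_succ (i j : Fin (d + 1)) :
    bump (gapIndex i) (-(j.val : ℤ) + 1) = if j = i + 1 then 1 else 0 := by
  refine if_congr ?_ rfl rfl
  rw [Int.cast_add, Int.cast_one, ← gapIndex_add_one]
  exact (add_left_inj _).trans gapIndex_injective.eq_iff

theorem exists_gapIndex (k : ZMod (d + 1)) : ∃ i : Fin (d + 1), gapIndex i = k := by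
  refine ⟨⟨(-k).val, ZMod.val_lt _⟩, ?_⟩
  simp [gapIndex]

theorem sum_gap (a : ℤ → ℤ) : ∑ k : Fin (d + 1), (a (-(k.val : ℤ) + 1) - a (-(k.val : ℤ)) - 2) =
    a 1 - a (-(d : ℤ)) - 2 * (d + 1) := by
  rw [← Finset.sum_range fun k : ℕ => a (-(k : ℤ) + 1) - a (-(k : ℤ)) - 2, Finset.sum_sub_distrib]
  have h := Finset.sum_range_sub' (fun k : ℕ => a (-(k : ℤ) + 1)) (d + 1)
  have e : ∀ k : ℕ, a (-((k + 1 : ℕ) : ℤ) + 1) = a (-(k : ℤ)) := fun k => by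
    congr 1; push_cast; ring
  simp only [e] at h
  rw [h]
  simp
  ring

/-- The vector of the gaps between consecutive entries of a separated sequence. -/
def gapVec (hm : m = n + 2 * d + 1) (ha : IsSep (d + 1) m a) : CutVertex d n :=
  ⟨fun k => (a (-(k.val : ℤ) + 1) - a (-(k.val : ℤ)) - 2).toNat, by
    have h := sum_gap (d := d) a
    have hp := ha.add_period (-(d : ℤ))
    rw [show -(d : ℤ) + ((d + 1 : ℕ) : ℤ) = 1 by push_cast; ring] at hp
    have e : ∀ k : Fin (d + 1), ((a (-(k.val : ℤ) + 1) - a (-(k.val : ℤ)) - 2).toNat : ℤ) =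
        a (-(k.val : ℤ) + 1) - a (-(k.val : ℤ)) - 2 := fun k =>
      Int.toNat_of_nonneg (by have := ha.two_le (-(k.val : ℤ)); omega)
    rw [← Nat.cast_inj (R := ℤ), Nat.cast_add, Nat.cast_sum]
    simp only [e, h, hp, hm]
    push_cast
    ring⟩

theorem gapVec_apply (hm : m = n + 2 * d + 1) (ha : IsSep (d + 1) m a) (k : Fin (d + 1)) :
    ((gapVec hm ha).1 k : ℤ) = a (-(k.val : ℤ) + 1) - a (-(k.val : ℤ)) - 2 :=
  Int.toNat_of_nonneg (by have := ha.two_le (-(k.val : ℤ)); omega)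

/-- Raising `a (-i)` shortens the gap after it and lengthens the gap before it. The latter has label
`i + 1`, as gaps are numbered backwards to match `f_i`. -/
theorem gapVec_bump (hm : m = n + 2 * d + 1) (ha : IsSep (d + 1) m a) {i : Fin (d + 1)}
    (hi : IsSep (d + 1) m fun j => a j + bump (gapIndex i) j) :
    IsArrow i (gapVec hm ha) (gapVec hm hi) := by
  intro j
  rw [gapVec_apply, gapVec_apply, bump_gapIndex, bump_gapIndex_succ, arrowVec_apply]
  ring

theorem exists_add_const_of_gapVec_eq (hm : m = n + 2 * d + 1) (ha : IsSep (d + 1) m a)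
    (hb : IsSep (d + 1) m b) (h : gapVec hm ha = gapVec hm hb) : ∃ c : ℤ, b = fun j => a j + c := by
  have hgap : ∀ j, a (j + 1) - a j = b (j + 1) - b j := by
    intro j
    obtain ⟨i, hi⟩ := exists_gapIndex (d := d) (j : ZMod (d + 1))
    obtain ⟨q, rfl⟩ := exists_eq_add_mul hi.symm
    have h1 := gapVec_apply hm ha i
    rw [h, gapVec_apply hm hb i] at h1
    rw [add_right_comm, ha.isCyclicSeq.add_mul_period, ha.isCyclicSeq.add_mul_period,
      hb.isCyclicSeq.add_mul_period, hb.isCyclicSeq.add_mul_period]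
    linarith
  refine ⟨b 0 - a 0, funext fun j => ?_⟩
  induction j using Int.induction_on with
  | zero => ring
  | succ i ih => have := hgap i; linarith
  | pred i ih => have := hgap (-i - 1); rw [sub_add_cancel] at this; linarith

/-- Entries plus two are the gaps of a sequence, and they sum to `n - 1 + 2 (d + 1) = m`, the
required period. -/
theorem exists_gapVec_eq (hm : m = n + 2 * d + 1) (x : CutVertex d n) :
    ∃ (a : ℤ → ℤ) (ha : IsSep (d + 1) m a), gapVec hm ha = x := by
  choose r hr using exists_gapIndex (d := d)
  obtain ⟨a, ha⟩ := exists_antidifference fun j => (x.1 (r j) : ℤ) + 2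
  have hx : ∀ k : Fin (d + 1), a (-(k.val : ℤ) + 1) - a (-(k.val : ℤ)) - 2 = x.1 k := by
    intro k
    have e : r ((-(k.val : ℤ) : ℤ) : ZMod (d + 1)) = k := gapIndex_injective (hr _)
    rw [ha, e]
    ring
  have hper : ∀ j, a (j + (d + 1 : ℕ)) - a j = a (0 + (d + 1 : ℕ)) - a 0 := by
    have hs : ∀ j, a (j + 1 + (d + 1 : ℕ)) - a (j + 1) = a (j + (d + 1 : ℕ)) - a j := by
      intro j
      rw [add_right_comm, ha, ha j]
      have e : ((j + (d + 1 : ℕ) : ℤ) : ZMod (d + 1)) = (j : ZMod (d + 1)) := by simp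
      rw [e]
      ring
    intro j
    induction j using Int.induction_on with
    | zero => rfl
    | succ i ih => rw [hs, ih]
    | pred i ih => rw [← ih, ← hs (-i - 1), sub_add_cancel]
  have hsum := sum_gap (d := d) a
  simp only [hx] at hsum
  have hx2 := x.2
  zify at hx2
  have h1 := hper (-(d : ℤ))
  rw [show -(d : ℤ) + ((d + 1 : ℕ) : ℤ) = 1 by push_cast; ring] at h1
  have hsep : IsSep (d + 1) m a := ⟨fun j => by
    have := hper j
    push_cast [hm] at *
    linarith, fun j => by
    rw [ha]
    have : (0 : ℤ) ≤ (x.1 (r j) : ℤ) := by positivity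
    linarith⟩
  refine ⟨a, hsep, Subtype.ext (funext fun k => ?_)⟩
  have := gapVec_apply hm hsep k
  rw [hx] at this
  exact_mod_cast this

theorem isSep_bump_of_pos (hm : m = n + 2 * d + 1) (ha : IsSep (d + 1) m a)
    {i : Fin (d + 1)} (hi : 1 ≤ (gapVec hm ha).1 i) :
    IsSep (d + 1) m fun j => a j + bump (gapIndex i) j := by
  refine ⟨fun j => by rw [ha.add_period, bump_add_period]; ring, fun j => ?_⟩
  have h1 := ha.two_le j
  have h2 := bump_nonneg (gapIndex i) (j + 1)
  rcases bump_cases (gapIndex i) j with ⟨h, h'⟩ | ⟨h, h'⟩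
  · obtain ⟨q, rfl⟩ := exists_eq_add_mul h
    have h3 := gapVec_apply hm ha i
    have h4 : a (-(i.val : ℤ) + (d + 1 : ℕ) * q + 1) = a (-(i.val : ℤ) + 1) + m * q := by
      rw [add_right_comm, ha.isCyclicSeq.add_mul_period]
    rw [h', h4, ha.isCyclicSeq.add_mul_period]
    zify at hi
    linarith
  · omega

end gaps

/-! ### Height functions -/

/-- A function on separated sequences that grows by one under translation, and by at most one under
unit steps. -/
structure IsHeight (d m : ℕ) (h : (ℤ → ℤ) → ℤ) : Prop where
  add_const : ∀ a c, IsSep (d + 1) m a → h (fun j => a j + c) = h a + c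
  bump : ∀ a (k : ZMod (d + 1)), IsSep (d + 1) m a → IsSep (d + 1) m (fun j => a j + bump k j) →
    h a ≤ h (fun j => a j + bump k j) ∧ h (fun j => a j + bump k j) ≤ h a + 1

namespace IsHeight

variable {d m n : ℕ} {h : (ℤ → ℤ) → ℤ} {a b : ℤ → ℤ} {P : (ℤ → ℤ) → Prop}

theorem mono (hh : IsHeight d m h) (ha : IsSep (d + 1) m a) (hb : IsSep (d + 1) m b)
    (hab : ∀ j, a j ≤ b j) : h a ≤ h b := by
  refine ha.le_induction (by omega) hb hab (Q := fun c => h a ≤ h c) le_rfl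
    (fun c k hc _ hck _ hQ => hQ.trans (hh.bump c k hc hck).1) fun c hc _ _ hQ => ?_
  rw [hh.add_const c 1 hc]
  omega

theorem add_le (hh : IsHeight d m h) (ha : IsSep (d + 1) m a) (hb : IsSep (d + 1) m b) (c : ℤ)
    (hab : ∀ j, a j + c ≤ b j) : h a + c ≤ h b := by
  rw [← hh.add_const a c ha]
  exact hh.mono (ha.add_const c) hb hab

/-- A negative index shift lowers all entries by at least one and hence lowers the height. -/
theorem shift_nonneg (hh : IsHeight d m h) (ha : IsSep (d + 1) m a) {k : ℤ}
    (hk : h a ≤ h fun j => a (j + k)) : 0 ≤ k := by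
  by_contra! hlt
  have := hh.add_le (ha.shift k) ha 1 fun j => by
    have := ha.isCyclicSeq.strictMono (show j + k < j by omega)
    omega
  omega

theorem eq_of_supp_eq [NeZero m] (hh : IsHeight d m h) (ha : IsSep (d + 1) m a)
    (hb : IsSep (d + 1) m b) (hab : h a = h b) (hs : supp (d + 1) m a = supp (d + 1) m b) :
    a = b := by
  obtain ⟨k, rfl⟩ := ha.isCyclicSeq.exists_shift hb.isCyclicSeq (by omega) hs
  have h1 := hh.shift_nonneg ha hab.le
  have h2 := hh.shift_nonneg hb (k := -k) (by simpa using hab.ge)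
  obtain rfl : k = 0 := by omega
  simp

/-- Let `b` be the shift of `a` by one index. Heights of shifts increase strictly; suppose that they
jump over zero between `a` and `b`. Then `a + 1` and `b - 1` have heights of opposite signs or zero,
and unit steps from one to the other pass height zero. The sequence found there lies in `P` and
interlaces with `a`. -/
theorem exists_shift_eq_zero (hh : IsHeight d m h) (hP : IsSliceFamily d m P)
    (hz : ∀ a, IsSep (d + 1) m a → h a = 0 → P a) (hshift : ∀ k, P fun j => a (j + k)) :
    ∃ k, h (fun j => a (j + k)) = 0 := by
  have hsep := fun k => hP.isSep (hshift k)
  obtain ⟨k, hk, hk'⟩ := exists_sign_change (f := fun k => h fun j => a (j + k)) fun k =>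
    hh.add_le (hsep k) (hsep (k + 1)) 1 fun j => by
      have := (hsep k).two_le j
      simp only [show j + (k + 1) = j + 1 + k by ring]
      omega
  refine ⟨k, hk.antisymm ?_⟩
  by_contra! hlt
  have hgap : ∀ j, a (j + k) + 2 ≤ a (j + (k + 1)) := fun j => by
    have := (hsep k).two_le j
    simpa only [show j + (k + 1) = j + 1 + k by ring] using this
  have hno : ∀ x, IsSep (d + 1) m x → (∀ j, a (j + k) + 1 ≤ x j) →
      (∀ j, x j ≤ a (j + (k + 1)) - 1) → h x ≠ 0 := fun x hx h1 h2 h0 =>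
    hP.not_interleaved (hshift k) (hz x hx h0) (fun j => by have := h1 j; omega) fun j => by
      have := h2 j
      simp only [show j + (k + 1) = j + 1 + k by ring] at this
      omega
  have h1 := (hsep k).add_const 1
  have h2 := (hsep (k + 1)).add_const (-1)
  have hle : ∀ j, a (j + k) + 1 ≤ a (j + (k + 1)) + -1 := fun j => by have := hgap j; omega
  have e1 := hh.add_const _ 1 (hsep k)
  have e2 := hh.add_const _ (-1) (hsep (k + 1))
  have n1 := hno _ h1 (fun j => le_rfl) fun j => by have := hgap j; omega
  have key : h (fun j => a (j + (k + 1)) + -1) < 0 := by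
    refine h1.le_induction (by omega) h2 hle (Q := fun c => h c < 0) (by omega)
      (fun c i hc hac hci hcb hQ => ?_) fun c hc hac hcb hQ => ?_
    · have := (hh.bump c i hc hci).2
      have := hno _ hci (fun j => by have := hac j; have := bump_nonneg i j; omega) fun j => by
        have := hcb j; omega
      omega
    · have := hh.add_const c 1 hc
      have := hno _ (hc.add_const 1) (fun j => by have := hac j; omega) fun j => by
        have := hcb j; omega
      omega
  omega

/-- A path from `a` up to `b` cannot contain a translation by one, as the heights agree;
monotonicity keeps its first step at this height. -/
theorem exists_bump_le (hh : IsHeight d m h) (ha : IsSep (d + 1) m a) (hb : IsSep (d + 1) m b)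
    (hab : ∀ j, a j ≤ b j) (hne : a ≠ b) (h0 : h a = h b) : ∃ k : ZMod (d + 1),
      IsSep (d + 1) m (fun j => a j + CyclicTriang.bump k j) ∧
      (∀ j, a j + CyclicTriang.bump k j ≤ b j) ∧
      h (fun j => a j + CyclicTriang.bump k j) = h a := by
  obtain ⟨k, hk, hkb⟩ : ∃ k : ZMod (d + 1),
      IsSep (d + 1) m (fun j => a j + CyclicTriang.bump k j) ∧
      ∀ j, a j + CyclicTriang.bump k j ≤ b j := by
    refine ha.le_induction (by omega) hb hab (Q := fun c => a ≠ c → ∃ k : ZMod (d + 1),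
      IsSep (d + 1) m (fun j => a j + CyclicTriang.bump k j) ∧
      ∀ j, a j + CyclicTriang.bump k j ≤ c j) (fun h => absurd rfl h)
      (fun c k hc _ hck _ hQ _ => ?_) (fun c hc hac hcb _ _ => ?_) hne
    · by_cases hac : a = c
      · subst hac
        exact ⟨k, hck, fun j => le_rfl⟩
      · obtain ⟨k', hk', hle⟩ := hQ hac
        exact ⟨k', hk', fun j => (hle j).trans (le_add_of_nonneg_right (bump_nonneg k j))⟩
    · have := hh.mono ha hc hac
      have := hh.add_le hc hb 1 hcb
      omega
  exact ⟨k, hk, hkb, le_antisymm ((hh.mono hk hb hkb).trans h0.ge) (hh.bump a k ha hk).1⟩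

theorem eq_of_gapVec_eq (hh : IsHeight d m h) (hm : m = n + 2 * d + 1) (ha : IsSep (d + 1) m a)
    (hb : IsSep (d + 1) m b) (hab : h a = h b) (he : gapVec hm ha = gapVec hm hb) : a = b := by
  obtain ⟨c, rfl⟩ := exists_add_const_of_gapVec_eq hm ha hb he
  have := hh.add_const a c ha
  obtain rfl : c = 0 := by omega
  simp

theorem exists_gapVec_eq (hh : IsHeight d m h) (hm : m = n + 2 * d + 1) (x : CutVertex d n) :
    ∃ (a : ℤ → ℤ) (ha : IsSep (d + 1) m a), gapVec hm ha = x ∧ h a = 0 := by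
  obtain ⟨a, ha, hx⟩ := CyclicTriang.exists_gapVec_eq hm x
  refine ⟨_, ha.add_const (-h a), ?_, by rw [hh.add_const a _ ha]; ring⟩
  rw [← hx]
  refine Subtype.ext (funext fun k => ?_)
  have h1 := gapVec_apply hm ha k
  have h2 := gapVec_apply hm (ha.add_const (-h a)) k
  omega

/-- The gap vector fixes `b` up to translation, and a unit step changes the height by 0 or 1. -/
theorem eq_bump_or_eq (hh : IsHeight d m h) (hd : 1 ≤ d) (hm : m = n + 2 * d + 1)
    (ha : IsSep (d + 1) m a) (hb : IsSep (d + 1) m b) (h0 : h a = h b) {i : Fin (d + 1)}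
    (hi : IsArrow i (gapVec hm ha) (gapVec hm hb)) :
    (∀ j, b j = a j + CyclicTriang.bump (gapIndex i) j) ∨
      ∀ j, b j = a j + CyclicTriang.bump (gapIndex i) j - 1 := by
  have hk := isSep_bump_of_pos hm ha (hi.pos hd)
  have hg : gapVec hm hk = gapVec hm hb := Subtype.ext (funext fun j => by
    have h1 := gapVec_bump hm ha hk j
    have h2 := hi j
    omega)
  obtain ⟨c, rfl⟩ := exists_add_const_of_gapVec_eq hm hk hb hg
  have h1 := hh.add_const _ c hk
  have h2 := hh.bump a _ ha hk
  have hc : c = 0 ∨ c = -1 := by omega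
  rcases hc with rfl | rfl
  · exact Or.inl fun j => by ring
  · exact Or.inr fun j => by ring

/-- The arrows of `Q^{(d, n)}` that are not steps between sequences of height zero form a cut. -/
theorem isCut (hh : IsHeight d m h) (hd : 1 ≤ d) (hm : m = n + 2 * d + 1)
    {s : CutVertex d n → ℤ → ℤ} (hs : ∀ x, IsSep (d + 1) m (s x))
    (hg : ∀ x, gapVec hm (hs x) = x) (h0 : ∀ x, h (s x) = 0) :
    IsCut {p : CutVertex d n × CutVertex d n | (typeAQuiver d n).Adj p.1 p.2 ∧
      ¬ ∃ k : ZMod (d + 1), s p.2 = fun j => s p.1 j + CyclicTriang.bump k j} := by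
  classical
  refine ⟨fun p hp => hp.1, fun c hc => ?_⟩
  set C : Set (CutVertex d n × CutVertex d n) := {p | (typeAQuiver d n).Adj p.1 p.2 ∧
      ¬ ∃ k : ZMod (d + 1), s p.2 = fun j => s p.1 j + CyclicTriang.bump k j} with hC
  choose l hl using hc
  have hstep : ∀ i j, s (c (i + 1)) j - s (c i) j = CyclicTriang.bump (gapIndex (l i)) j -
      if (c i, c (i + 1)) ∈ C then 1 else 0 := by
    intro i
    have hi : IsArrow (l i) (gapVec hm (hs (c i))) (gapVec hm (hs (c (i + 1)))) := by
      rw [hg, hg]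
      exact hl i
    rcases hh.eq_bump_or_eq hd hm (hs _) (hs _) ((h0 _).trans (h0 _).symm) hi with h | h
    · have hn : (c i, c (i + 1)) ∉ C := fun hmem => hmem.2 ⟨_, funext h⟩
      intro j
      rw [if_neg hn, h]
      ring
    · have hmem : (c i, c (i + 1)) ∈ C := by
        refine ⟨⟨_, hl i⟩, ?_⟩
        rintro ⟨k, hk⟩
        obtain ⟨j, rfl⟩ := ZMod.intCast_surjective k
        have h1 := congrFun hk j
        have h2 := h j
        have h3 := bump_le_one (gapIndex (l i)) j
        have h4 : CyclicTriang.bump (j : ZMod (d + 1)) j = 1 := by simp [CyclicTriang.bump]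
        simp only [h4] at h1
        omega
      intro j
      rw [if_pos hmem, h]
      ring
  -- The displacements cancel around the cycle, so at each index the number of raises equals the
  -- number of cut arrows.
  have hsum : ∀ j, ∑ i, CyclicTriang.bump (gapIndex (l i)) j =
      ∑ i, if (c i, c (i + 1)) ∈ C then (1 : ℤ) else 0 := by
    intro j
    rw [← sub_eq_zero, ← Finset.sum_sub_distrib, ← Finset.sum_congr rfl fun i _ => hstep i j,
      Finset.sum_sub_distrib, sub_eq_zero]
    exact Equiv.sum_comp (Equiv.addRight 1) fun i => s (c i) j
  -- Summed over the `d + 1` index classes, each arrow raises one of them; so `(d + 1)` times the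
  -- number of cut arrows is `d + 1`.
  have htot : ∑ k : Fin (d + 1), ∑ i, CyclicTriang.bump (gapIndex (l i)) (-(k.val : ℤ)) = d + 1 := by
    rw [Finset.sum_comm]
    simp [bump_gapIndex]
  simp only [hsum] at htot
  rw [Finset.sum_const, Finset.card_univ, Fintype.card_fin, Finset.sum_boole, nsmul_eq_mul] at htot
  have hcard : (Finset.univ.filter fun i => (c i, c (i + 1)) ∈ C).card = 1 := by
    have hpos : ((d : ℤ) + 1) ≠ 0 := by positivity
    have := mul_left_cancel₀ hpos (by push_cast at htot; rw [htot, mul_one] :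
      ((d : ℤ) + 1) * ((Finset.univ.filter fun i => (c i, c (i + 1)) ∈ C).card : ℤ) =
        ((d : ℤ) + 1) * 1)
    exact_mod_cast this
  obtain ⟨i, hi⟩ := Finset.card_eq_one.1 hcard
  have hiff : ∀ y, (c y, c (y + 1)) ∈ C ↔ y = i := fun y => by
    rw [← Finset.mem_singleton, ← hi]
    simp
  exact ⟨i, (hiff i).2 rfl, fun y hy => (hiff y).1 hy⟩

end IsHeight

/-! ### Triangulations without interior simplices -/

section slice

variable {d m n : ℕ} [NeZero m] {t : Fin m → ℝ} {T : Finset (Finset (Fin m))} {a b : ℤ → ℤ}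
  {h : (ℤ → ℤ) → ℤ}

theorem isSliceFamily_isArcSeq (ht : StrictMono t) (hd : 1 ≤ d) (hm : 2 * d + 1 ≤ m)
    (hT : IsTriangulation (2 * d) t T) (hint : ¬ ∃ A, IsInteriorSimplex d t T A) :
    IsSliceFamily d m (IsArcSeq d T) where
  isSep ha := ha.isSep
  not_interleaved ha hb := ha.not_interleaved ht hT hb
  bump_or ha hak := ha.bump_or ht hd hm hT hint hak

/-- If the separated simplex is not in `T`, it intertwines with a simplex of `T`, which is then an
arc. -/
theorem exists_isArcSeq_of_isSep (ht : StrictMono t) (hT : IsTriangulation (2 * d) t T)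
    (ha : IsSep (d + 1) m a) : ∃ b, IsArcSeq d T b := by
  obtain ⟨S, hS, h | ⟨C, hC, hI⟩⟩ := hT.subset_or_intertwining ht ha.isCyclicSeq.card_supp
  · exact ⟨a, ha, S, hS, h⟩
  · obtain ⟨x, c, -, hc, -, rfl, h1, h2⟩ := hI.exists_isCyclicSeq
    exact ⟨c, IsSep.of_interleaved hc h2 fun j => h1 (j + 1), S, hS, hC⟩

/-- A unit step leaves no room for an intermediate arc `c`: either `a ≤ c ≤ a + e_k`, which forces
`c` to be an end, or the indices are shifted and `c` intertwines with `a + e_k`. -/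
theorem adj_of_bump (ht : StrictMono t) (hd : 1 ≤ d) (hm : 2 * d + 1 ≤ m)
    (hT : IsTriangulation (2 * d) t T) (hh : IsHeight d m h) (ha : IsArcSeq d T a)
    {k : ZMod (d + 1)} (hb : IsArcSeq d T fun j => a j + bump k j)
    (h0 : h a = h fun j => a j + bump k j) :
    (triangulationQuiver d t T).Adj ⟨_, ha.isArc ht hd hm⟩ ⟨_, hb.isArc ht hd hm⟩ := by
  obtain ⟨i, rfl⟩ := ZMod.intCast_surjective k
  have hii : bump (i : ZMod (d + 1)) i = 1 := by simp [bump]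
  have hgap : ∀ j, a j + bump (i : ZMod (d + 1)) j + 2 ≤ a (j + 1) := fun j => by
    rcases bump_cases (i : ZMod (d + 1)) j with ⟨h, h'⟩ | ⟨h, h'⟩
    · have h1 : bump (i : ZMod (d + 1)) (j + 1) = 0 := by
        rw [bump, if_neg]
        rw [← h]
        exact cast_add_one_ne (by omega) j
      have := hb.isSep.two_le j
      simp only [h1] at this
      omega
    · have := ha.isSep.two_le j
      omega
  have hle : ∀ j, a j ≤ a j + bump (i : ZMod (d + 1)) j := fun j => by
    have := bump_nonneg (i : ZMod (d + 1)) j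
    omega
  refine ⟨fun he => ?_, intertwining_shiftDown ha.isCyclicSeq hle hgap, ?_⟩
  · have := congrFun (hh.eq_of_supp_eq ha.isSep hb.isSep h0 (congrArg Subtype.val he)) i
    omega
  rintro ⟨⟨A', hA'⟩, hA1, hA2, hA3, hA4⟩
  obtain ⟨c, hc, rfl, h1, h2⟩ := hA3.exists_of_shiftDown ha.isCyclicSeq
  have hc' := IsArcSeq.of_isArc ht hd hm hc hA'
  obtain ⟨b', hb', hs, h3, h4⟩ := hA4.exists_of_shiftDown hc
  obtain ⟨q, rfl⟩ := hb.isCyclicSeq.exists_shift hb' (by omega) hs.symm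
  have hac := hh.mono ha.isSep hc'.isSep h1
  have hbs := hb.isSep.shift q
  have hq := hh.shift_nonneg hb.isSep (k := q)
    (h0.ge.trans (hac.trans (hh.mono hc'.isSep hbs h3)))
  rcases hq.eq_or_lt with rfl | hq
  · simp only [add_zero] at h3
    rcases (h1 i).eq_or_lt with hi | hi
    · refine hA1 (Subtype.ext (congrArg (supp (d + 1) m) (funext fun j => ?_)))
      rcases bump_cases (i : ZMod (d + 1)) j with ⟨h, -⟩ | ⟨-, h⟩
      · obtain ⟨p, rfl⟩ := exists_eq_add_mul h
        rw [hc.add_mul_period, ha.isCyclicSeq.add_mul_period, hi]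
      · have := h1 j; have := h3 j; omega
    · suffices hcb : ∀ j, c j = a j + bump (i : ZMod (d + 1)) j from
        hA2 (Subtype.ext (congrArg (supp (d + 1) m) (funext hcb)))
      intro j
      rcases bump_cases (i : ZMod (d + 1)) j with ⟨h, h'⟩ | ⟨-, h⟩
      · obtain ⟨p, rfl⟩ := exists_eq_add_mul h
        rw [h', hc.add_mul_period, ha.isCyclicSeq.add_mul_period]
        have := h3 i
        omega
      · have := h1 j; have := h3 j; omega
  · have hlt : ∀ j, a j + bump (i : ZMod (d + 1)) j + 2 ≤ c j := fun j => by
      have e1 := h4 (j - 1)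
      have e2 := hb.isCyclicSeq.strictMono.monotone (show j ≤ j - 1 + q by omega)
      rw [sub_add_cancel] at e1
      exact (add_le_add_left e2 2).trans e1
    refine hb.not_interleaved ht hT hc' (fun j => ?_) fun j => ?_
    · have := hlt j; omega
    · have := h2 j; have := hle (j + 1); omega

/-- Otherwise a unit step from `a` towards `b` within height zero is an arc through which the arrow
factors. -/
theorem exists_bump_of_adj (ht : StrictMono t) (hd : 1 ≤ d) (hm : 2 * d + 1 ≤ m)
    (hh : IsHeight d m h) (hz : ∀ a, IsSep (d + 1) m a → h a = 0 → IsArcSeq d T a)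
    (ha : IsArcSeq d T a) (hb : IsArcSeq d T b) (ha0 : h a = 0) (hb0 : h b = 0)
    (hadj : (triangulationQuiver d t T).Adj ⟨_, ha.isArc ht hd hm⟩ ⟨_, hb.isArc ht hd hm⟩) :
    ∃ k : ZMod (d + 1), b = fun j => a j + bump k j := by
  obtain ⟨hne, hI, hirr⟩ := hadj
  obtain ⟨b', hb', hs, h1, h2⟩ := Intertwining.exists_of_shiftDown ha.isCyclicSeq hI
  obtain ⟨q, rfl⟩ := hb.isCyclicSeq.exists_shift hb' (by omega) hs.symm
  have hq := hh.shift_nonneg hb.isSep (k := q)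
    ((hb0.trans ha0.symm).le.trans (hh.mono ha.isSep (hb.isSep.shift q) h1))
  obtain rfl : q = 0 := by
    by_contra hq0
    have := hh.add_le hb.isSep ha.isSep 2 fun j => by
      have e1 := h2 (j - 1)
      have e2 := hb.isCyclicSeq.strictMono.monotone (show j ≤ j - 1 + q by omega)
      rw [sub_add_cancel] at e1
      exact (add_le_add_left e2 2).trans e1
    omega
  simp only [add_zero] at h1 h2
  have hab : a ≠ b := fun h => hne (by subst h; rfl)
  obtain ⟨k, hk, hkb, hk0⟩ := hh.exists_bump_le ha.isSep hb.isSep h1 hab (ha0.trans hb0.symm)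
  rw [ha0] at hk0
  have hkP := hz _ hk hk0
  refine ⟨k, ?_⟩
  by_contra hbk
  refine hirr ⟨⟨_, hkP.isArc ht hd hm⟩, fun he => ?_, fun he => ?_,
    intertwining_shiftDown ha.isCyclicSeq (fun j => ?_) (fun j => ?_),
    intertwining_shiftDown hk.isCyclicSeq hkb fun j => ?_⟩
  · obtain ⟨i, rfl⟩ := ZMod.intCast_surjective k
    have := congrFun (hh.eq_of_supp_eq hk ha.isSep (hk0.trans ha0.symm) (congrArg Subtype.val he)) i
    simp [bump] at this
  · exact hbk (hh.eq_of_supp_eq hk hb.isSep (hk0.trans hb0.symm) (congrArg Subtype.val he)).symm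
  · have := bump_nonneg k j; omega
  · have := hkb j; have := h2 j; omega
  · have := bump_nonneg k (j + 1); have := h2 j; omega

theorem isCutQuiver_of_isEmpty {V : Type} [IsEmpty V] [IsEmpty (CutVertex d n)] (Q : Digraph V) :
    IsCutQuiver d n Q :=
  ⟨∅, ⟨fun _ h => h.elim, fun c _ => isEmptyElim (c 0)⟩,
    ⟨⟨Equiv.equivOfIsEmpty _ _, fun {x} => isEmptyElim x⟩⟩⟩

theorem isCutQuiver_triangulationQuiver (ht : StrictMono t) (hd : 1 ≤ d) (hm : m = n + 2 * d + 1)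
    (hT : IsTriangulation (2 * d) t T) (hint : ¬ ∃ A, IsInteriorSimplex d t T A) :
    IsCutQuiver d n (triangulationQuiver d t T) := by
  have hm' : 2 * d + 1 ≤ m := by omega
  by_cases hex : ∃ a, IsArcSeq d T a
  swap
  · have h1 : IsEmpty (CutVertex d n) := ⟨fun x => by
      obtain ⟨a, ha, -⟩ := exists_gapVec_eq hm x
      exact hex (exists_isArcSeq_of_isSep ht hT ha)⟩
    have h2 : IsEmpty {A : Finset (Fin m) // IsArc d t T A} := ⟨fun A => by
      obtain ⟨a, ha, -⟩ := exists_isArcSeq ht hd hm' A.2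
      exact hex ⟨a, ha⟩⟩
    exact isCutQuiver_of_isEmpty _
  obtain ⟨a₀, ha₀⟩ := hex
  have hP := isSliceFamily_isArcSeq ht hd hm' hT hint
  obtain ⟨h, hz, h1, h2⟩ := hP.exists_height hd ha₀
  have hh : IsHeight d m h := ⟨h1, h2⟩
  choose s hs hg h0 using hh.exists_gapVec_eq hm
  have hsP : ∀ x, IsArcSeq d T (s x) := fun x => hz _ (hs x) (h0 x)
  -- Each gap vector has one sequence of height zero. It is an arc, and each arc arises since some
  -- enumeration of it has height zero.
  let φ : CutVertex d n → {A : Finset (Fin m) // IsArc d t T A} := fun x =>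
    ⟨_, (hsP x).isArc ht hd hm'⟩
  have hφ : Function.Bijective φ := by
    refine ⟨fun x y hxy => ?_, fun A => ?_⟩
    · have hxy := hh.eq_of_supp_eq (hs x) (hs y) ((h0 x).trans (h0 y).symm)
        (congrArg Subtype.val hxy)
      rw [← hg x, ← hg y]
      simp only [hxy]
    · obtain ⟨a, ha, hA⟩ := exists_isArcSeq ht hd hm' A.2
      obtain ⟨k, hk⟩ := hh.exists_shift_eq_zero hP hz ha.shift
      have hak := ha.shift k
      refine ⟨gapVec hm hak.isSep, Subtype.ext ?_⟩
      rw [← hA, ← ha.isCyclicSeq.supp_shift (by omega) k]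
      exact congrArg (supp (d + 1) m)
        (hh.eq_of_gapVec_eq hm (hs _) hak.isSep ((h0 _).trans hk.symm) (hg _))
  have hadj : ∀ x y, (triangulationQuiver d t T).Adj (φ x) (φ y) ↔
      ∃ k : ZMod (d + 1), s y = fun j => s x j + bump k j := by
    refine fun x y => ⟨exists_bump_of_adj ht hd hm' hh hz (hsP x) (hsP y) (h0 x) (h0 y), ?_⟩
    rintro ⟨k, hk⟩
    have hy := hsP y
    have hy0 := h0 y
    simp only [hk] at hy hy0
    have := adj_of_bump ht hd hm' hT hh (hsP x) hy ((h0 x).trans hy0.symm)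
    have e : φ y = ⟨_, hy.isArc ht hd hm'⟩ := Subtype.ext (congrArg (supp (d + 1) m) hk)
    rwa [e]
  refine ⟨_, hh.isCut hd hm hs hg h0, ⟨RelIso.symm ⟨Equiv.ofBijective φ hφ, fun {x y} => ?_⟩⟩⟩
  refine (hadj x y).trans ⟨fun hk => ⟨?_, fun hmem => hmem.2 hk⟩, fun hxy => ?_⟩
  · obtain ⟨k, hk⟩ := hk
    obtain ⟨i, rfl⟩ := exists_gapIndex k
    have hy := hs y
    simp only [hk] at hy
    have := gapVec_bump hm (hs x) hy
    have e : gapVec hm hy = y := by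
      rw [← hg y]
      simp only [hk]
    rw [hg, e] at this
    exact ⟨i, this⟩
  · by_contra hk
    exact hxy.2 ⟨hxy.1, hk⟩

end slice

theorem HasOrientedCycle.of_relIso {V W : Type} {Q : Digraph V} {Q' : Digraph W}
    (e : Q.Adj ≃r Q'.Adj) (h : HasOrientedCycle Q) : HasOrientedCycle Q' := by
  obtain ⟨v, hv⟩ := h
  exact ⟨e v, hv.lift e fun _ _ => e.map_rel_iff.2⟩

end CyclicTriang

open CyclicTriang in
theorem theorem3p6 (d n : ℕ) (hd : 1 ≤ d) (t : Fin (n + 2 * d + 1) → ℝ) (ht : StrictMono t)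
    (T : Finset (Finset (Fin (n + 2 * d + 1)))) (hT : IsTriangulation (2 * d) t T) :
    List.TFAE [
      ¬ ∃ A, IsInteriorSimplex d t T A,
      ¬ HasOrientedCycle (triangulationQuiver d t T),
      IsCutQuiver d n (triangulationQuiver d t T)] := by
  tfae_have 1 → 3 := isCutQuiver_triangulationQuiver ht hd rfl hT
  tfae_have 3 → 2 := fun ⟨_, hC, ⟨e⟩⟩ h => hC.acyclic hd (h.of_relIso e)
  tfae_have 2 → 1 := fun h ⟨_, hX⟩ => h (hX.hasOrientedCycle ht hd (by omega) hT)
  tfae_finish
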